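/- Let $(M,g)$ be a smooth finite-dimensional Riemannian manifold (without boundary) with Levi-Civita connection $\nabla$ and curvature tensor $R(X,Y)Z=\nabla_X\nabla_YZ-\nabla_Y\nabla_XZ-\nabla_{[X,Y]}Z$, let $p>0$, and let $I=[a,b]$ with $a<b$. For a smooth curve $\gamma\colon I\to M$ with parameter $s$ put $\tau=\tau(\gamma)=\nabla_{\gamma'}\gamma'$ and $$E_{2,p}(\gamma)=\frac1p\int_I|\tau(\gamma)|^p\,ds .$$ Let $\gamma_t$, $t\in(-\epsilon,\epsilon)$, be a smooth variation of $\gamma=\gamma_0$ with variation field $\eta=\partial_t\gamma_t|_{t=0}$ such that either * (clamped ends) $\gamma_t(a)=\gamma(a)$, $\gamma_t'(a)=\gamma'(a)$, $\gamma_t(b)=\gamma(b)$ and $\gamma_t'(b)=\gamma'(b)$ for all $t$, or * (closed curves) every $\gamma_t$ is the restriction to $[a,b]$ of a $(b-a)$-periodic curve $\mathbb R\to M$, and these curves depend smoothly on $(t,s)\in(-\epsilon,\epsilon)\times\mathbb R$. Suppose that $\gamma$ is a $p$-biharmonic curve, that is, the field $|\tau|^{p-2}\tau$ is twice differentiable along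 $\gamma$ and $$\nabla_{\gamma'}\nabla_{\gamma'}\big(|\tau|^{p-2}\tau\big)-|\tau|^{p-2}R(\gamma',\tau)\gamma'=0\quad\text{on } I,$$ and, if $p<2$, that $\tau$ has no zero on $I$. Then $|\tau(\gamma_t)|^p$ is integrable on $I$ for every $t\in(-\epsilon,\epsilon)$, the function $t\mapsto E_{2,p}(\gamma_t)$ is differentiable near $t=0$, its derivative is differentiable at $t=0$, all integrals below converge, and $$\begin{aligned} \frac{d^2}{dt^2}\Big|_{t=0}E_{2,p}(\gamma_t)={}&\int_I\big\langle\eta,R(\eta,\gamma')\nabla_{\gamma'}\big(|\tau|^{p-2}\tau\big)\big\rangle ds-2\int_I|\tau|^{p-2}\langle R(\nabla_{\gamma'}\eta,\tau)\gamma',\eta\rangle ds\\ &+(p-2)\int_I|\tau|^{p-4}|\langle\nabla_{\gamma'}\nabla_{\gamma'}\eta,\tau\rangle|^2ds\\ &+2(p-2)\int_I|\tau|^{p-4}\langle\nabla_{\gamma'}\nabla_{\gamma'}\eta,\tau\rangle\langle R(\eta,\gamma')\gamma',\tau\rangle ds\\ &+\int_I|\tau|^{p-2}|\nabla_{\gamma'}\nabla_{\gamma'}\eta|^2ds+2\int_I|\tau|^{p-2}\langle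 R(\eta,\gamma')\gamma',\nabla_{\gamma'}\nabla_{\gamma'}\eta\rangle ds\\ &+(p-2)\int_I|\tau|^{p-4}|\langle R(\gamma',\tau)\gamma',\eta\rangle|^2ds-\int_I|\tau|^{p-2}\langle(\nabla_\eta R)(\gamma',\tau)\gamma',\eta\rangle ds\\ &+\int_I|\tau|^{p-2}|R(\gamma',\eta)\gamma'|^2ds-\int_I|\tau|^{p-2}\langle R(\gamma',\tau)\nabla_{\gamma'}\eta,\eta\rangle ds . \end{aligned}$$ Here, at zeros of $\tau$ (possible only for $p\ge2$), $|\tau|^{p-2}$ means $1$ if $p=2$ and $0$ if $p>2$, and the integrands containing $|\tau|^{p-4}$, together with their factor $p-2$, are taken to be $0$. For $p=2$ the right-hand side equals Jiang's second variation of the bienergy, which for curves and with the above sign of $R$ reads $$\int_I\Big(\big|\nabla_{\gamma'}\nabla_{\gamma'}\eta+R(\eta,\gamma')\gamma'\big|^2-\big\langle\eta,(\nabla_{\gamma'}R)(\gamma',\tau)\eta+(\nabla_\tau R)(\gamma',\eta)\gamma'+R(\tau,\eta)\tau+2R(\gamma',\eta)\nabla_{\gamma'}\tau+2R(\gamma',\tau)\nabla_{\gamma'}\eta\big\rangle\Big)ds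 .$$ -/

import Mathlib

open Set Filter MeasureTheory Bundle FiberBundle VectorField
open scoped Manifold ContDiff Topology

noncomputable section

namespace PBiharmonic

set_option linter.unusedSectionVars false

section Geometry

variable {E : Type*} [NormedAddCommGroup E] [NormedSpace ℝ E] [FiniteDimensional ℝ E]
  {M : Type*} [TopologicalSpace M] [ChartedSpace E M] [IsManifold 𝓘(ℝ, E) ∞ M]
  [RiemannianBundle (fun x : M ↦ TangentSpace 𝓘(ℝ, E) x)]
  [IsContMDiffRiemannianBundle 𝓘(ℝ, E) ∞ E (fun x : M ↦ TangentSpace 𝓘(ℝ, E) x)]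

/-- The right-hand side of the Koszul formula for `⟨∇_X Y, Z⟩` at the point `x`. -/
def koszul (Y X Z : Π x : M, TangentSpace 𝓘(ℝ, E) x) (x : M) : ℝ :=
  (1 / 2) *
    (d% (fun y ↦ inner ℝ (Y y) (Z y)) x (X x) + d% (fun y ↦ inner ℝ (X y) (Z y)) x (Y x)
      - d% (fun y ↦ inner ℝ (X y) (Y y)) x (Z x)
      + inner ℝ (mlieBracket 𝓘(ℝ, E) X Y x) (Z x) - inner ℝ (mlieBracket 𝓘(ℝ, E) X Z x) (Y x)
      - inner ℝ (mlieBracket 𝓘(ℝ, E) Y Z x) (X x))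

theorem mdiffAt_inner {x : M} {Y Z : Π x : M, TangentSpace 𝓘(ℝ, E) x}
    (hY : MDiffAt (T% Y) x) (hZ : MDiffAt (T% Z) x) :
    MDiffAt (fun y ↦ inner ℝ (Y y) (Z y)) x :=
  MDifferentiableAt.inner_bundle (F := E) (E := fun x : M ↦ TangentSpace 𝓘(ℝ, E) x)
    (b := fun y ↦ y) hY hZ

theorem koszul_tensorial_left {x : M} {Y Z : Π x : M, TangentSpace 𝓘(ℝ, E) x}
    (hY : MDiffAt (T% Y) x) (hZ : MDiffAt (T% Z) x) :
    TensorialAt 𝓘(ℝ, E) E (koszul Y · Z x) x := by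
  have : CompleteSpace E := FiniteDimensional.complete ℝ E
  constructor
  · intro f X hf hX
    simp only [koszul, mlieBracket_smul_left hf hX, Pi.smul_apply', real_inner_smul_left,
      inner_add_left, mvfderiv_fun_mul hf (mdiffAt_inner hX hZ), real_inner_smul_right,
      mvfderiv_fun_mul hf (mdiffAt_inner hX hY)]
    simp [real_inner_comm (X x)]
    ring
  · intro X X' hX hX'
    simp only [koszul, mlieBracket_add_left hX hX', Pi.add_apply,
      inner_add_left, mvfderiv_fun_add (mdiffAt_inner hX hZ) (mdiffAt_inner hX' hZ),
      inner_add_right, mvfderiv_fun_add (mdiffAt_inner hX hY) (mdiffAt_inner hX' hY)]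
    simp
    ring

theorem koszul_tensorial_right {x : M} {Y X : Π x : M, TangentSpace 𝓘(ℝ, E) x}
    (hY : MDiffAt (T% Y) x) (hX : MDiffAt (T% X) x) :
    TensorialAt 𝓘(ℝ, E) E (koszul Y X · x) x := by
  have : CompleteSpace E := FiniteDimensional.complete ℝ E
  constructor
  · intro f Z hf hZ
    simp only [koszul, mlieBracket_smul_right hf hZ, Pi.smul_apply', real_inner_smul_left,
      inner_add_left, mvfderiv_fun_mul hf (mdiffAt_inner hX hZ), real_inner_smul_right,
      mvfderiv_fun_mul hf (mdiffAt_inner hY hZ)]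
    simp [real_inner_comm (Z x)]
    ring
  · intro Z Z' hZ hZ'
    simp only [koszul, mlieBracket_add_right hZ hZ', Pi.add_apply,
      inner_add_left, mvfderiv_fun_add (mdiffAt_inner hX hZ) (mdiffAt_inner hX hZ'),
      inner_add_right, mvfderiv_fun_add (mdiffAt_inner hY hZ) (mdiffAt_inner hY hZ')]
    simp
    ring

theorem koszul_add {x : M} {Y Y' X Z : Π x : M, TangentSpace 𝓘(ℝ, E) x}
    (hY : MDiffAt (T% Y) x) (hY' : MDiffAt (T% Y') x) (hX : MDiffAt (T% X) x)
    (hZ : MDiffAt (T% Z) x) :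
    koszul (Y + Y') X Z x = koszul Y X Z x + koszul Y' X Z x := by
  have : CompleteSpace E := FiniteDimensional.complete ℝ E
  simp only [koszul, mlieBracket_add_right hY hY', mlieBracket_add_left hY hY', Pi.add_apply,
    inner_add_left, mvfderiv_fun_add (mdiffAt_inner hY hZ) (mdiffAt_inner hY' hZ),
    inner_add_right, mvfderiv_fun_add (mdiffAt_inner hX hY) (mdiffAt_inner hX hY')]
  simp
  ring

theorem koszul_smul {x : M} {f : M → ℝ} {Y X Z : Π x : M, TangentSpace 𝓘(ℝ, E) x}
    (hf : MDiffAt f x) (hY : MDiffAt (T% Y) x) (hX : MDiffAt (T% X) x)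
    (hZ : MDiffAt (T% Z) x) :
    koszul (f • Y) X Z x = f x * koszul Y X Z x + d% f x (X x) * inner ℝ (Y x) (Z x) := by
  have : CompleteSpace E := FiniteDimensional.complete ℝ E
  simp only [koszul, mlieBracket_smul_right hf hY, mlieBracket_smul_left hf hY, Pi.smul_apply',
    real_inner_smul_left, inner_add_left, mvfderiv_fun_mul hf (mdiffAt_inner hY hZ),
    real_inner_smul_right, mvfderiv_fun_mul hf (mdiffAt_inner hX hY)]
  simp [real_inner_comm (X x)]
  ring

open scoped Classical in
/-- The covariant derivative `∇ Y` at `x`, determined by the Koszul formula; it is `0` by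
convention when `Y` is not differentiable at `x`. -/
def leviCivitaAux (Y : Π x : M, TangentSpace 𝓘(ℝ, E) x) (x : M) :
    TangentSpace 𝓘(ℝ, E) x →L[ℝ] TangentSpace 𝓘(ℝ, E) x :=
  have : FiniteDimensional ℝ (TangentSpace 𝓘(ℝ, E) x) := inferInstanceAs (FiniteDimensional ℝ E)
  have : CompleteSpace (TangentSpace 𝓘(ℝ, E) x) := FiniteDimensional.complete ℝ _
  if hY : MDiffAt (T% Y) x then
    LinearMap.toContinuousLinearMap
      { toFun := fun u ↦ (InnerProductSpace.toDual ℝ (TangentSpace 𝓘(ℝ, E) x)).symm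
          (TensorialAt.mkHom₂ (I := 𝓘(ℝ, E)) (F := E) (F' := E)
            (fun X Z ↦ koszul Y X Z x) x
            (fun _ hZ ↦ koszul_tensorial_left hY hZ) (fun _ hX ↦ koszul_tensorial_right hY hX) u)
        map_add' := by intro u v; simp
        map_smul' := by intro c u; simp }
  else 0

theorem inner_leviCivitaAux {x : M} {Y X Z : Π x : M, TangentSpace 𝓘(ℝ, E) x}
    (hY : MDiffAt (T% Y) x) (hX : MDiffAt (T% X) x) (hZ : MDiffAt (T% Z) x) :
    inner ℝ (leviCivitaAux Y x (X x)) (Z x) = koszul Y X Z x := by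
  have : FiniteDimensional ℝ (TangentSpace 𝓘(ℝ, E) x) := inferInstanceAs (FiniteDimensional ℝ E)
  have : CompleteSpace (TangentSpace 𝓘(ℝ, E) x) := FiniteDimensional.complete ℝ _
  simp only [leviCivitaAux, dif_pos hY]
  erw [InnerProductSpace.toDual_symm_apply]
  exact TensorialAt.mkHom₂_apply _ _ hX hZ

theorem ext_inner_extend {x : M} {u v : TangentSpace 𝓘(ℝ, E) x}
    (h : ∀ Z : Π x : M, TangentSpace 𝓘(ℝ, E) x, MDiffAt (T% Z) x →
      inner ℝ u (Z x) = inner ℝ v (Z x)) : u = v := by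
  refine ext_inner_right ℝ fun w ↦ ?_
  simpa using h (extend E w) (mdifferentiableAt_extend ..)

variable (E M) in
/-- The Levi-Civita connection of the Riemannian manifold `M`. -/
def leviCivita : CovariantDerivative 𝓘(ℝ, E) E (fun x : M ↦ TangentSpace 𝓘(ℝ, E) x) where
  toFun := leviCivitaAux
  isCovariantDerivativeOnUniv :=
    { add := by
        intro Y Y' x hY hY' _
        ext u
        refine ext_inner_extend fun Z hZ ↦ ?_
        have hu : MDiffAt (T% (extend E u)) x := mdifferentiableAt_extend ..
        have h := inner_leviCivitaAux (mdifferentiableAt_add_section hY hY') hu hZ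
        have h1 := inner_leviCivitaAux hY hu hZ
        have h2 := inner_leviCivitaAux hY' hu hZ
        rw [koszul_add hY hY' hu hZ, ← h1, ← h2, ← inner_add_left] at h
        simpa using h
      leibniz := by
        intro Y g x hY hg _
        ext u
        refine ext_inner_extend fun Z hZ ↦ ?_
        have hu : MDiffAt (T% (extend E u)) x := mdifferentiableAt_extend ..
        have h := inner_leviCivitaAux (hg.smul_section hY) hu hZ
        have h1 := inner_leviCivitaAux hY hu hZ
        rw [koszul_smul hg hY hu hZ, ← h1, ← real_inner_smul_left, ← real_inner_smul_left,
          ← inner_add_left] at h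
        simpa using h }

theorem leviCivita_metric {x : M} {X Y Z : Π x : M, TangentSpace 𝓘(ℝ, E) x}
    (hX : MDiffAt (T% X) x) (hY : MDiffAt (T% Y) x) (hZ : MDiffAt (T% Z) x) :
    d% (fun y ↦ inner ℝ (Y y) (Z y)) x (X x) =
      inner ℝ (leviCivita E M Y x (X x)) (Z x) + inner ℝ (Y x) (leviCivita E M Z x (X x)) := by
  have h1 := inner_leviCivitaAux hY hX hZ
  have h2 := inner_leviCivitaAux hZ hX hY
  rw [real_inner_comm _ (Y x)]
  change _ = inner ℝ (leviCivitaAux Y x (X x)) (Z x) + inner ℝ (leviCivitaAux Z x (X x)) (Y x)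
  have h3 : (fun y ↦ inner ℝ (Z y) (Y y)) = fun y ↦ inner ℝ (Y y) (Z y) :=
    funext fun y ↦ real_inner_comm _ _
  rw [h1, h2, koszul, koszul, h3, mlieBracket_swap_apply (V := Z) (W := Y)]
  simp only [inner_neg_left]
  ring

theorem leviCivita_torsionFree {x : M} {X Y : Π x : M, TangentSpace 𝓘(ℝ, E) x}
    (hX : MDiffAt (T% X) x) (hY : MDiffAt (T% Y) x) :
    leviCivita E M Y x (X x) - leviCivita E M X x (Y x) = mlieBracket 𝓘(ℝ, E) X Y x := by
  refine ext_inner_extend fun Z hZ ↦ ?_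
  have h1 := inner_leviCivitaAux hY hX hZ
  have h2 := inner_leviCivitaAux hX hY hZ
  rw [inner_sub_left]
  change inner ℝ (leviCivitaAux Y x (X x)) (Z x) - inner ℝ (leviCivitaAux X x (Y x)) (Z x) = _
  have h3 : (fun y ↦ inner ℝ (Y y) (X y)) = fun y ↦ inner ℝ (X y) (Y y) :=
    funext fun y ↦ real_inner_comm _ _
  rw [h1, h2, koszul, koszul, h3, mlieBracket_swap_apply (V := Y) (W := X)]
  simp only [inner_neg_left]
  ring

/-- The curvature tensor `R(u, v)w = ∇_u ∇_v w - ∇_v ∇_u w - ∇_[u,v] w` at the point `x`, computed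
on smooth local extensions of the three tangent vectors. -/
def curvature (x : M) (u v w : TangentSpace 𝓘(ℝ, E) x) : TangentSpace 𝓘(ℝ, E) x :=
  leviCivita E M (fun y ↦ leviCivita E M (extend E w) y (extend E v y)) x u
    - leviCivita E M (fun y ↦ leviCivita E M (extend E w) y (extend E u y)) x v
    - leviCivita E M (extend E w) x (mlieBracket 𝓘(ℝ, E) (extend E u) (extend E v) x)

/-- The covariant derivative `(∇_z R)(u, v)w` of the curvature tensor at the point `x`. -/
def nablaCurvature (x : M) (z u v w : TangentSpace 𝓘(ℝ, E) x) : TangentSpace 𝓘(ℝ, E) x :=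
  leviCivita E M (fun y ↦ curvature y (extend E u y) (extend E v y) (extend E w y)) x z
    - curvature x (leviCivita E M (extend E u) x z) v w
    - curvature x u (leviCivita E M (extend E v) x z) w
    - curvature x u v (leviCivita E M (extend E w) x z)

/-- The velocity `γ'(s)` of a curve parametrized by the set `S ⊆ ℝ`
(one-sided at end points of `S`). -/
def velocity (γ : ℝ → M) (S : Set ℝ) (s : ℝ) : TangentSpace 𝓘(ℝ, E) (γ s) :=
  mfderivWithin 𝓘(ℝ, ℝ) 𝓘(ℝ, E) γ S s (1 : ℝ)

/-- A vector field along `γ`, seen as a curve in the tangent bundle. -/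
def lift (γ : ℝ → M) (V : Π s : ℝ, TangentSpace 𝓘(ℝ, E) (γ s)) (s : ℝ) :
    TangentBundle 𝓘(ℝ, E) M :=
  ⟨γ s, V s⟩

/-- The covariant derivative `∇_{γ'} V` at `s` of a vector field `V` along the curve `γ`,
parametrized by `S ⊆ ℝ`. In a local frame `(e_i)` around `γ s`, with `V = ∑ V^i e_i`, it is
`∑ (V^i)' e_i + ∑ V^i ∇_{γ'} e_i`. Here the frame is the one of the preferred trivialization at
`γ s`, and `extend E (V s)` is the section with the constant coefficients `V^i(s)` in it. -/
def covDeriv (γ : ℝ → M) (S : Set ℝ) (V : Π s : ℝ, TangentSpace 𝓘(ℝ, E) (γ s)) (s : ℝ) :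
    TangentSpace 𝓘(ℝ, E) (γ s) :=
  (trivializationAt E (TangentSpace 𝓘(ℝ, E)) (γ s)).symm (γ s)
      (derivWithin
        (fun r ↦ (trivializationAt E (TangentSpace 𝓘(ℝ, E)) (γ s) (lift γ V r)).2) S s)
    + leviCivita E M (extend E (V s)) (γ s) (velocity γ S s)

/-- The tension field `τ(γ) = ∇_{γ'} γ'`. -/
def tension (γ : ℝ → M) (S : Set ℝ) (s : ℝ) : TangentSpace 𝓘(ℝ, E) (γ s) :=
  covDeriv γ S (velocity γ S) s

/-- The vector field `|τ(γ)|^{p-2} τ(γ)` along `γ`. -/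
def powTension (p : ℝ) (γ : ℝ → M) (S : Set ℝ) (s : ℝ) : TangentSpace 𝓘(ℝ, E) (γ s) :=
  ‖tension (E := E) γ S s‖ ^ (p - 2) • tension (E := E) γ S s

variable (E) in
/-- The energy `E_{2,p}(γ) = (1/p) ∫_a^b |τ(γ)|^p ds`. -/
def energy (p : ℝ) (γ : ℝ → M) (a b : ℝ) : ℝ :=
  (1 / p) * ∫ s in a..b, ‖tension (E := E) γ (Icc a b) s‖ ^ p

variable (E) in
/-- `γ : [a, b] → M` is a (classical) solution of the equation for `p`-biharmonic curves
`∇_{γ'} ∇_{γ'} (|τ|^{p-2} τ) - |τ|^{p-2} R(γ', τ) γ' = 0`; the two differentiability conditions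
say that the left-hand side makes sense. -/
structure IsPBiharmonic (p : ℝ) (γ : ℝ → M) (a b : ℝ) : Prop where
  differentiable : MDifferentiableOn 𝓘(ℝ, ℝ) 𝓘(ℝ, E).tangent
    (lift γ (powTension (E := E) p γ (Icc a b))) (Icc a b)
  differentiable_covDeriv : MDifferentiableOn 𝓘(ℝ, ℝ) 𝓘(ℝ, E).tangent
    (lift γ (covDeriv γ (Icc a b) (powTension (E := E) p γ (Icc a b)))) (Icc a b)
  equation : ∀ s ∈ Icc a b,
    covDeriv γ (Icc a b) (covDeriv γ (Icc a b) (powTension (E := E) p γ (Icc a b))) s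
      - ‖tension (E := E) γ (Icc a b) s‖ ^ (p - 2) •
        curvature (γ s) (velocity γ (Icc a b) s) (tension γ (Icc a b) s) (velocity γ (Icc a b) s)
      = 0

variable (E) in
/-- A smooth variation `F t s = γ_t(s)`, `(t, s) ∈ (-ε, ε) × [a, b]`, with fixed end points and
fixed end velocities: `γ_t(a) = γ_0(a)`, `γ_t'(a) = γ_0'(a)`, and likewise at `b`. -/
def IsClampedVariation (F : ℝ → ℝ → M) (ε a b : ℝ) : Prop :=
  ContMDiffOn 𝓘(ℝ, ℝ × ℝ) 𝓘(ℝ, E) ∞ (fun q : ℝ × ℝ ↦ F q.1 q.2) (Ioo (-ε) ε ×ˢ Icc a b) ∧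
  ∀ t ∈ Ioo (-ε) ε,
    lift (F t) (velocity (E := E) (F t) (Icc a b)) a
      = lift (F 0) (velocity (E := E) (F 0) (Icc a b)) a ∧
    lift (F t) (velocity (E := E) (F t) (Icc a b)) b
      = lift (F 0) (velocity (E := E) (F 0) (Icc a b)) b

variable (E) in
/-- A smooth variation `F t s = γ_t(s)`, `t ∈ (-ε, ε)`, through closed curves, that is, through
smooth curves `γ_t : ℝ → M` of period `b - a`. -/
def IsClosedVariation (F : ℝ → ℝ → M) (ε a b : ℝ) : Prop :=
  ContMDiffOn 𝓘(ℝ, ℝ × ℝ) 𝓘(ℝ, E) ∞ (fun q : ℝ × ℝ ↦ F q.1 q.2) (Ioo (-ε) ε ×ˢ univ) ∧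
  ∀ t ∈ Ioo (-ε) ε, ∀ s : ℝ, F t (s + (b - a)) = F t s

/-- The variation field `η(s) = ∂γ_t(s)/∂t` at `t = 0`. -/
def variationField (F : ℝ → ℝ → M) (s : ℝ) : TangentSpace 𝓘(ℝ, E) (F 0 s) :=
  mfderiv 𝓘(ℝ, ℝ) 𝓘(ℝ, E) (fun t ↦ F t s) 0 (1 : ℝ)

/-- The ten integrands of the second variation formula, at the parameter `s`. -/
def secondVariationIntegrand (p : ℝ) (γ : ℝ → M) (S : Set ℝ)
    (η : Π s : ℝ, TangentSpace 𝓘(ℝ, E) (γ s)) (i : Fin 10) (s : ℝ) : ℝ :=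
  let R := curvature (E := E) (γ s)
  let T : TangentSpace 𝓘(ℝ, E) (γ s) := velocity γ S s
  let τ : TangentSpace 𝓘(ℝ, E) (γ s) := tension γ S s
  let Dη : TangentSpace 𝓘(ℝ, E) (γ s) := covDeriv γ S η s
  let DDη : TangentSpace 𝓘(ℝ, E) (γ s) := covDeriv γ S (covDeriv γ S η) s
  ![inner ℝ (η s) (R (η s) T (covDeriv γ S (powTension p γ S) s)),
    -2 * (‖τ‖ ^ (p - 2) * inner ℝ (R Dη τ T) (η s)),
    (p - 2) * (‖τ‖ ^ (p - 4) * |inner ℝ DDη τ| ^ 2),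
    2 * (p - 2) * (‖τ‖ ^ (p - 4) * inner ℝ DDη τ * inner ℝ (R (η s) T T) τ),
    ‖τ‖ ^ (p - 2) * ‖DDη‖ ^ 2,
    2 * (‖τ‖ ^ (p - 2) * inner ℝ (R (η s) T T) DDη),
    (p - 2) * (‖τ‖ ^ (p - 4) * |inner ℝ (R T τ T) (η s)| ^ 2),
    -(‖τ‖ ^ (p - 2) * inner ℝ (nablaCurvature (γ s) (η s) T τ T) (η s)),
    ‖τ‖ ^ (p - 2) * ‖R T (η s) T‖ ^ 2,
    -(‖τ‖ ^ (p - 2) * inner ℝ (R T τ Dη) (η s))] i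

/-- The right-hand side of the second variation formula, a sum of ten integrals over `[a, b]`. -/
def secondVariation (p : ℝ) (γ : ℝ → M) (η : Π s : ℝ, TangentSpace 𝓘(ℝ, E) (γ s)) (a b : ℝ) : ℝ :=
  ∑ i : Fin 10, ∫ s in a..b, secondVariationIntegrand p γ (Icc a b) η i s

/-- The integrand of Jiang's second variation formula for the bienergy, for maps from an interval.
The curvature tensor has the sign `R(X, Y)Z = ∇_X ∇_Y Z - ∇_Y ∇_X Z - ∇_[X,Y] Z`. -/
def jiangIntegrand (γ : ℝ → M) (S : Set ℝ) (η : Π s : ℝ, TangentSpace 𝓘(ℝ, E) (γ s))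
    (s : ℝ) : ℝ :=
  let R := curvature (E := E) (γ s)
  let T : TangentSpace 𝓘(ℝ, E) (γ s) := velocity γ S s
  let τ : TangentSpace 𝓘(ℝ, E) (γ s) := tension γ S s
  ‖covDeriv γ S (covDeriv γ S η) s + R (η s) T T‖ ^ 2
    - inner ℝ (η s)
        (nablaCurvature (γ s) T T τ (η s) + nablaCurvature (γ s) τ T (η s) T + R τ (η s) τ
          + (2 : ℝ) • R T (η s) (covDeriv γ S (tension γ S) s)
          + (2 : ℝ) • R T τ (covDeriv γ S η s))

end Geometry

end PBiharmonic

end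

/-!
The second variation of `E_{2,p}` along a `p`-biharmonic curve.

Write `T = ∂F/∂s`, `H = ∂F/∂t`, `τ = ∇_s T`, `A = ∇_t H` and `W = |τ|^{p-2} τ`. The connection has
no torsion, so `∇_t T = ∇_s H`, and the commutator of `∇_t` and `∇_s` is `R(H, T)`. Hence
`∇_t τ = ∇_s ∇_s H + R(H, T)T`, and a second differentiation gives
`IsSmoothFamily.covDerivLeft_covDerivLeft_tensionField`:
`∇_t ∇_t τ = ∇_s ∇_s A + R(A, T)T + ∇_s(R(H, T)H) + 2 R(H, T)∇_s H + (∇_H R)(H, T)T + R(H, ∇_s H)T`.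
Pointwise, `∂_t |τ|^p = p ⟨∇_t τ, W⟩`, and
`∂_t ⟨∇_t τ, W⟩ = |τ|^{p-2} (⟨∇_t ∇_t τ, τ⟩ + |∇_t τ|^2) + (p-2) |τ|^{p-4} ⟨∇_t τ, τ⟩^2`.

Both derivatives are continuous in `(t, s)`: at zeros of `τ`, which are allowed only for `p ≥ 2`, the
singular weight `|τ|^{p-4}` multiplies two factors that are `O(|τ|)`, and the factor `p - 2` settles
`p = 2` (`continuousWithinAt_rpow_sub_four`). For `p < 2` the field `τ` has no zeros on a rectangle
around `{0} × [a, b]`. So the energy may be differentiated twice under the integral sign.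

At `t = 0`, the second derivative of the density differs from the sum of the ten integrands by the
`s`-derivative of `boundaryTerm`, which is
`⟨∇_s A, W⟩ - ⟨A, ∇_s W⟩ + ⟨R(H, T)H, W⟩`: the terms with `A` drop out by the equation of
`p`-biharmonic curves and the pair symmetry of `R`, and the remaining ones are matched by the
symmetries of `R` and `∇R` (`secondVariation_pointwise`). The boundary term has equal values at `a`
and `b` (`boundaryTerm_eq`). For clamped ends `H`, `∇_s H`, `A` and
`∇_s A = ∇_t ∇_s H - R(H, T)H` vanish there, since `T(·, a)` and `T(·, b)` are constant in the
tangent bundle; for closed curves all fields are periodic.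

For `p = 2`, Jiang's integrand differs from the sum of the ten by the derivative of
`-⟨R(τ, H)T, H⟩`, by the two Bianchi identities (`jiang_pointwise`).

Everything local is computed in charts. For a smooth metric on an open subset of a vector space, the
symmetries of `R` and `∇R` follow from the formula for `R` in terms of the Christoffel symbols
(`IsLocalLeviCivita`); the formulas `coords_leviCivita`, `coords_curvature`, `coords_nablaCurvature`
and `hasDerivWithinAt_coords` identify the connection of the manifold, its curvature and the
covariant derivative along curves with these local expressions, in an arbitrary chart.
-/


noncomputable section

namespace PBiharmonic

set_option linter.unusedSectionVars false

/-! ### Riemannian metrics on open subsets of a vector space -/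

section LocalGeometry

section Shortcuts

variable {F G : Type*} [NormedAddCommGroup F] [NormedSpace ℝ F] [NormedAddCommGroup G]
  [NormedSpace ℝ G] {H : Type*} [NormedAddCommGroup H] [NormedSpace ℝ H]

-- Without these shortcuts, instance search on spaces of trilinear maps times out.

instance instNormedAddCommGroupLinear : NormedAddCommGroup (F →L[ℝ] G) := inferInstance
instance instNormedSpaceLinear : NormedSpace ℝ (F →L[ℝ] G) := inferInstance
instance instAddCommGroupLinear : AddCommGroup (F →L[ℝ] G) := inferInstance
instance instAddCommMonoidLinear : AddCommMonoid (F →L[ℝ] G) := inferInstance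
instance instAddMonoidBilinear : AddMonoid (F →L[ℝ] G →L[ℝ] H) := inferInstance
instance instAddGroupBilinear : AddGroup (F →L[ℝ] G →L[ℝ] H) := inferInstance
instance instModuleLinear : Module ℝ (F →L[ℝ] G) := inferInstance
instance instNormedAddCommGroupBilinear : NormedAddCommGroup (F →L[ℝ] G →L[ℝ] H) := inferInstance
instance instSeminormedAddCommGroupBilinear : SeminormedAddCommGroup (F →L[ℝ] G →L[ℝ] H) :=
  NormedAddCommGroup.toSeminormedAddCommGroup
instance instNormedSpaceBilinear : NormedSpace ℝ (F →L[ℝ] G →L[ℝ] H) := inferInstance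
instance instAddCommGroupBilinear : AddCommGroup (F →L[ℝ] G →L[ℝ] H) := inferInstance
instance instAddCommMonoidBilinear : AddCommMonoid (F →L[ℝ] G →L[ℝ] H) := inferInstance
instance instTopologicalSpaceBilinear : TopologicalSpace (F →L[ℝ] G →L[ℝ] H) := inferInstance
instance instModuleBilinear : Module ℝ (F →L[ℝ] G →L[ℝ] H) := inferInstance
instance instIsTopologicalAddGroupBilinear : IsTopologicalAddGroup (F →L[ℝ] G →L[ℝ] H) :=
  inferInstance
instance instContinuousConstSMulBilinear : ContinuousConstSMul ℝ (F →L[ℝ] G →L[ℝ] H) :=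
  inferInstance

end Shortcuts

variable {E : Type*} [NormedAddCommGroup E] [NormedSpace ℝ E]

/-- `koszulForm D u w v = (D u w v + D w u v - D v u w) / 2`, the Christoffel symbols of the first
kind of a metric with derivative `D`. -/
def koszulForm (D : E →L[ℝ] E →L[ℝ] E →L[ℝ] ℝ) : E →L[ℝ] E →L[ℝ] E →L[ℝ] ℝ :=
  (1 / 2 : ℝ) • (D + D.flip
    - (ContinuousLinearMap.flipₗᵢ ℝ E E ℝ).toContinuousLinearEquiv.toContinuousLinearMap ∘L D.flip)

set_option synthInstance.maxHeartbeats 200000 in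
theorem koszulForm_apply (D : E →L[ℝ] E →L[ℝ] E →L[ℝ] ℝ) (u w v : E) :
    koszulForm D u w v = (1 / 2) * (D u w v + D w u v - D v u w) := by
  simp [koszulForm]

/-- The Christoffel symbols `Γ(u, w)` of the metric `g` given on (an open subset of) a vector space.
The inverse of `g z`, as a map to the dual space, is `0` by convention where `g` is degenerate. -/
def christoffel (g : E → E →L[ℝ] E →L[ℝ] ℝ) (z : E) : E →L[ℝ] E →L[ℝ] E :=
  ContinuousLinearMap.compL ℝ E (E →L[ℝ] ℝ) E (g z).inverse ∘L koszulForm (fderiv ℝ g z)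

/-- The curvature of the connection with Christoffel symbols `Γ`, as the antisymmetrization of
`(u, v) ↦ DΓ(u)(v, ·) + Γ(u, Γ(v, ·))`. -/
def chartCurvature (Γ : E → E →L[ℝ] E →L[ℝ] E) (z : E) : E →L[ℝ] E →L[ℝ] E →L[ℝ] E :=
  (fderiv ℝ Γ z + (ContinuousLinearMap.compL ℝ E E E).bilinearComp (Γ z) (Γ z))
   - (fderiv ℝ Γ z + (ContinuousLinearMap.compL ℝ E E E).bilinearComp (Γ z) (Γ z)).flip

theorem chartCurvature_apply (Γ : E → E →L[ℝ] E →L[ℝ] E) (z u v w : E) :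
    chartCurvature Γ z u v w = fderiv ℝ Γ z u v w + Γ z u (Γ z v w)
      - (fderiv ℝ Γ z v u w + Γ z v (Γ z u w)) := by
  simp [chartCurvature]

/-- The covariant derivative `(∇_a R)(u, v)w` of the curvature of the connection with Christoffel
symbols `Γ`. -/
def chartNablaCurvature (Γ : E → E →L[ℝ] E →L[ℝ] E) (z a u v w : E) : E :=
  fderiv ℝ (chartCurvature Γ) z a u v w + Γ z a (chartCurvature Γ z u v w)
    - chartCurvature Γ z (Γ z a u) v w - chartCurvature Γ z u (Γ z a v) w
    - chartCurvature Γ z u v (Γ z a w)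

/-- `Γ` are the Christoffel symbols of the smooth Riemannian metric `g` on the open set `O`: they are
smooth, symmetric and compatible with `g`. -/
structure IsLocalLeviCivita (g : E → E →L[ℝ] E →L[ℝ] ℝ) (Γ : E → E →L[ℝ] E →L[ℝ] E) (O : Set E) :
    Prop where
  isOpen : IsOpen O
  contDiffOn_metric : ContDiffOn ℝ ∞ g O
  contDiffOn : ContDiffOn ℝ ∞ Γ O
  metric_symm : ∀ z ∈ O, ∀ u v, g z u v = g z v u
  metric_pos : ∀ z ∈ O, ∀ u, u ≠ 0 → 0 < g z u u
  symm : ∀ z ∈ O, ∀ u v, Γ z u v = Γ z v u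
  metric : ∀ z ∈ O, ∀ u v w, fderiv ℝ g z u v w = g z (Γ z u v) w + g z v (Γ z u w)

theorem minSmoothness_two_le_infty : minSmoothness ℝ 2 ≤ (∞ : WithTop ℕ∞) := by
  simpa using (mod_cast le_top : ((2 : ℕ∞) : WithTop ℕ∞) ≤ ∞)

theorem one_add_one_le_infty : (1 : WithTop ℕ∞) + 1 ≤ ∞ := by
  simpa [one_add_one_eq_two] using (mod_cast le_top : ((2 : ℕ∞) : WithTop ℕ∞) ≤ ∞)

theorem fderiv_clm_apply_apply {F G : Type*} [NormedAddCommGroup F] [NormedSpace ℝ F]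
    [NormedAddCommGroup G] [NormedSpace ℝ G]
    {c : E → F →L[ℝ] G} {f : E → F} {z : E} (hc : DifferentiableAt ℝ c z)
    (hf : DifferentiableAt ℝ f z) (u : E) :
    fderiv ℝ (fun y ↦ c y (f y)) z u = fderiv ℝ c z u (f z) + c z (fderiv ℝ f z u) := by
  rw [fderiv_clm_apply hc hf]; simp [add_comm]

section
variable {g : E → E →L[ℝ] E →L[ℝ] ℝ} {Γ : E → E →L[ℝ] E →L[ℝ] E} {O : Set E}

theorem contDiffOn_chartCurvature [FiniteDimensional ℝ E] (hO : IsOpen O)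
    (hΓ : ContDiffOn ℝ ∞ Γ O) :
    ContDiffOn ℝ ∞ (chartCurvature Γ) O := by
  have hD : ContDiffOn ℝ ∞ (fderiv ℝ Γ) O := hΓ.fderiv_of_isOpen hO (by simp)
  refine contDiffOn_clm_apply.2 fun u ↦ contDiffOn_clm_apply.2 fun v ↦
    contDiffOn_clm_apply.2 fun w ↦ ?_
  simp only [chartCurvature_apply]
  have h1 : ∀ x y : E, ContDiffOn ℝ ∞ (fun z ↦ Γ z x y) O := fun x y ↦
    (hΓ.clm_apply contDiffOn_const).clm_apply contDiffOn_const
  have h2 : ∀ x y t : E, ContDiffOn ℝ ∞ (fun z ↦ fderiv ℝ Γ z x y t) O := fun x y t ↦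
    ((hD.clm_apply contDiffOn_const).clm_apply contDiffOn_const).clm_apply contDiffOn_const
  have h3 : ∀ x y t : E, ContDiffOn ℝ ∞ (fun z ↦ Γ z x (Γ z y t)) O := fun x y t ↦
    (hΓ.clm_apply contDiffOn_const).clm_apply (h1 y t)
  exact ((h2 u v w).add (h3 u v w)).sub ((h2 v u w).add (h3 v u w))

namespace IsLocalLeviCivita
variable (h : IsLocalLeviCivita g Γ O) {z : E} (hz : z ∈ O)
include h hz

theorem contDiffAt_metric : ContDiffAt ℝ ∞ g z :=
  h.contDiffOn_metric.contDiffAt (h.isOpen.mem_nhds hz)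

theorem contDiffAt : ContDiffAt ℝ ∞ Γ z := h.contDiffOn.contDiffAt (h.isOpen.mem_nhds hz)

theorem differentiableAt_metric : DifferentiableAt ℝ g z :=
  (h.contDiffAt_metric hz).differentiableAt (by simp)

theorem differentiableAt : DifferentiableAt ℝ Γ z :=
  (h.contDiffAt hz).differentiableAt (by simp)

theorem differentiableAt_fderiv : DifferentiableAt ℝ (fderiv ℝ Γ) z :=
  ((h.contDiffAt hz).fderiv_right (m := 1) one_add_one_le_infty).differentiableAt (by simp)

theorem ext {u v : E} (huv : ∀ w, g z u w = g z v w) : u = v := by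
  by_contra hne
  have := h.metric_pos z hz (u - v) (sub_ne_zero.2 hne)
  simp [huv] at this

theorem bianchi (u v w : E) :
    chartCurvature Γ z u v w + chartCurvature Γ z v w u + chartCurvature Γ z w u v = 0 := by
  have hs : ∀ a b c, fderiv ℝ Γ z a b c = fderiv ℝ Γ z a c b := by
    intro a b c
    have h1 : (fun y ↦ Γ y b c) =ᶠ[𝓝 z] fun y ↦ Γ y c b := by
      filter_upwards [h.isOpen.mem_nhds hz] with y hy using h.symm y hy b c
    have h2 := DFunLike.congr_fun (h1.fderiv_eq (𝕜 := ℝ)) a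
    have hd := h.differentiableAt hz
    simp (disch := fun_prop) only [fderiv_clm_apply_apply] at h2
    simpa using h2
  simp only [chartCurvature_apply]
  rw [hs u w v, hs w v u, hs v w u, h.symm z hz w v, h.symm z hz w u, h.symm z hz v u]
  abel

/-- `⟨R(u, v)w, w⟩ = 0`, since the second derivative of `|w|^2` is symmetric for a constant field
`w`. -/
theorem metric_curvature_self [FiniteDimensional ℝ E] (u v w : E) :
    g z (chartCurvature Γ z u v w) w = 0 := by
  have hg := h.differentiableAt_metric hz
  have hd := h.differentiableAt hz
  -- `G` is the squared length of the constant field `w`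
  let G : E → ℝ := fun y ↦ g y w w
  have hG : ∀ y ∈ O, ∀ a, fderiv ℝ G y a = 2 * g y (Γ y a w) w := by
    intro y hy a
    have hg := h.differentiableAt_metric hy
    have h1 := h.metric y hy a w w
    rw [h.metric_symm y hy w] at h1
    simp only [G]
    rw [fderiv_clm_apply_apply (by fun_prop) (by fun_prop),
      fderiv_clm_apply_apply hg (by fun_prop)]
    simp [h1]
    ring
  have hGs : ContDiffAt ℝ ∞ G z := by
    have := h.contDiffAt_metric hz
    simp only [G]; fun_prop
  have hG' : DifferentiableAt ℝ (fderiv ℝ G) z :=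
    (hGs.fderiv_right (m := 1) one_add_one_le_infty).differentiableAt (by simp)
  have hsymm := hGs.isSymmSndFDerivAt minSmoothness_two_le_infty
  have key : ∀ a b, fderiv ℝ (fderiv ℝ G) z a b =
      2 * (g z (Γ z a (Γ z b w)) w + g z (Γ z b w) (Γ z a w) + g z (fderiv ℝ Γ z a b w) w) := by
    intro a b
    have h1 : (fun y ↦ fderiv ℝ G y b) =ᶠ[𝓝 z] fun y ↦ 2 * g y (Γ y b w) w := by
      filter_upwards [h.isOpen.mem_nhds hz] with y hy using hG y hy b
    have h2 := DFunLike.congr_fun (h1.fderiv_eq (𝕜 := ℝ)) a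
    rw [fderiv_clm_apply_apply hG' (by fun_prop)] at h2
    rw [fderiv_const_mul (by fun_prop)] at h2
    simp only [fderiv_fun_const, Pi.zero_apply, _root_.zero_apply, map_zero,
      add_zero] at h2
    rw [h2, _root_.smul_apply,
      fderiv_clm_apply_apply (by fun_prop) (by fun_prop),
      fderiv_clm_apply_apply (by fun_prop) (by fun_prop),
      fderiv_clm_apply_apply (by fun_prop) (by fun_prop),
      fderiv_clm_apply_apply (by fun_prop) (by fun_prop)]
    simp [h.metric z hz]
  have h3 := hsymm u v
  rw [key, key, h.metric_symm z hz (Γ z u w)] at h3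
  simp only [chartCurvature_apply, map_sub, map_add, _root_.sub_apply,
    _root_.add_apply]
  linarith

theorem metric_curvature_swap [FiniteDimensional ℝ E] (u v w r : E) :
    g z (chartCurvature Γ z u v w) r = - g z (chartCurvature Γ z u v r) w := by
  have h1 := h.metric_curvature_self hz u v (w + r)
  simp only [map_add, _root_.add_apply, h.metric_curvature_self hz] at h1
  linarith

omit h hz in
theorem chartCurvature_swap (z u v w : E) :
    chartCurvature Γ z u v w = - chartCurvature Γ z v u w := by
  simp [chartCurvature_apply]

/-- The pair symmetry of the curvature tensor, a linear combination of four Bianchi identities. -/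
theorem metric_curvature_pair [FiniteDimensional ℝ E] (u v w r : E) :
    g z (chartCurvature Γ z u v w) r = g z (chartCurvature Γ z w r u) v := by
  have b : ∀ u v w r, g z (chartCurvature Γ z u v w) r + g z (chartCurvature Γ z v w u) r
      + g z (chartCurvature Γ z w u v) r = 0 := by
    intro u v w r
    simpa using congrArg (fun x ↦ g z x r) (h.bianchi hz u v w)
  have s : ∀ u v w r, g z (chartCurvature Γ z u v w) r = - g z (chartCurvature Γ z v u w) r := by
    intro u v w r
    rw [chartCurvature_swap]; simp
  have m := h.metric_curvature_swap hz
  linarith [b u v w r, b v w r u, b w r u v, b r u v w, m u v w r, m v w u r, m w u v r,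
    m v w r u, m w r u v, m r u v w, m r v w u, s r v w u, s r u v w, m w r v u, m u w r v, s u w r v,
    m v r u w, s v r u w, m u v r w, s w u v r, m r u w v, s u v w r, s w r u v, s v w u r]

theorem fderiv_chartCurvature [FiniteDimensional ℝ E] (a u v w : E) :
    fderiv ℝ (chartCurvature Γ) z a u v w =
      fderiv ℝ (fderiv ℝ Γ) z a u v w + fderiv ℝ Γ z a u (Γ z v w) + Γ z u (fderiv ℝ Γ z a v w)
      - (fderiv ℝ (fderiv ℝ Γ) z a v u w + fderiv ℝ Γ z a v (Γ z u w)
        + Γ z v (fderiv ℝ Γ z a u w)) := by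
  have hd := h.differentiableAt hz
  have hd' := h.differentiableAt_fderiv hz
  have hR : DifferentiableAt ℝ (chartCurvature Γ) z :=
    ((contDiffOn_chartCurvature h.isOpen h.contDiffOn).contDiffAt
      (h.isOpen.mem_nhds hz)).differentiableAt (by simp)
  have h1 : fderiv ℝ (chartCurvature Γ) z a u v w =
      fderiv ℝ (fun y ↦ chartCurvature Γ y u v w) z a := by
    rw [fderiv_clm_apply_apply (by fun_prop) (by fun_prop),
      fderiv_clm_apply_apply (by fun_prop) (by fun_prop),
      fderiv_clm_apply_apply (by fun_prop) (by fun_prop)]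
    simp
  rw [h1]
  simp only [chartCurvature_apply]
  rw [fderiv_fun_sub (by fun_prop) (by fun_prop), fderiv_fun_add (by fun_prop) (by fun_prop),
    fderiv_fun_add (by fun_prop) (by fun_prop)]
  simp only [_root_.sub_apply, _root_.add_apply]
  simp (disch := fun_prop) only [fderiv_clm_apply_apply]
  simp
  abel

/-- The second Bianchi identity. After insertion of `fderiv_chartCurvature`, the terms cancel by the
symmetry of `Γ` and of its second derivative. -/
theorem second_bianchi [FiniteDimensional ℝ E] (a u v w : E) :
    chartNablaCurvature Γ z a u v w + chartNablaCurvature Γ z u v a w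
      + chartNablaCurvature Γ z v a u w = 0 := by
  have hsymm := (h.contDiffAt hz).isSymmSndFDerivAt minSmoothness_two_le_infty
  have hs : ∀ a b, fderiv ℝ (fderiv ℝ Γ) z a b = fderiv ℝ (fderiv ℝ Γ) z b a := fun a b ↦ hsymm a b
  simp only [chartNablaCurvature, h.fderiv_chartCurvature hz]
  rw [h.symm z hz u a, h.symm z hz v a, h.symm z hz v u,
    chartCurvature_swap z (Γ z a u), chartCurvature_swap z (Γ z u v), chartCurvature_swap z (Γ z a v),
    hs u a, hs v a, hs v u]
  simp only [chartCurvature_apply, map_add, map_sub]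
  abel

/-- The product rule for `⟨R(u, v)w, r⟩` with constant fields, by which `∇R` inherits the symmetries
of `R`. -/
theorem metric_nablaCurvature [FiniteDimensional ℝ E] (a u v w r : E) :
    g z (chartNablaCurvature Γ z a u v w) r =
      fderiv ℝ (fun y ↦ g y (chartCurvature Γ y u v w) r) z a
      - g z (chartCurvature Γ z (Γ z a u) v w) r - g z (chartCurvature Γ z u (Γ z a v) w) r
      - g z (chartCurvature Γ z u v (Γ z a w)) r - g z (chartCurvature Γ z u v w) (Γ z a r) := by
  have hg := h.differentiableAt_metric hz
  have hR : DifferentiableAt ℝ (chartCurvature Γ) z :=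
    ((contDiffOn_chartCurvature h.isOpen h.contDiffOn).contDiffAt
      (h.isOpen.mem_nhds hz)).differentiableAt (by simp)
  simp (disch := fun_prop) only [fderiv_clm_apply_apply]
  simp [chartNablaCurvature, h.metric z hz]
  ring

theorem metric_nablaCurvature_pair [FiniteDimensional ℝ E] (a u v w r : E) :
    g z (chartNablaCurvature Γ z a u v w) r = g z (chartNablaCurvature Γ z a w r u) v := by
  have h1 : (fun y ↦ g y (chartCurvature Γ y u v w) r) =ᶠ[𝓝 z]
      fun y ↦ g y (chartCurvature Γ y w r u) v := by
    filter_upwards [h.isOpen.mem_nhds hz] with y hy using h.metric_curvature_pair hy u v w r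
  rw [h.metric_nablaCurvature hz, h.metric_nablaCurvature hz, h1.fderiv_eq (𝕜 := ℝ),
    h.metric_curvature_pair hz (Γ z a u), h.metric_curvature_pair hz u (Γ z a v),
    h.metric_curvature_pair hz u v (Γ z a w), h.metric_curvature_pair hz u v w (Γ z a r)]
  ring

theorem metric_nablaCurvature_swap [FiniteDimensional ℝ E] (a u v w r : E) :
    g z (chartNablaCurvature Γ z a u v w) r = - g z (chartNablaCurvature Γ z a u v r) w := by
  have h1 : (fun y ↦ g y (chartCurvature Γ y u v w) r) =ᶠ[𝓝 z]
      fun y ↦ - g y (chartCurvature Γ y u v r) w := by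
    filter_upwards [h.isOpen.mem_nhds hz] with y hy using h.metric_curvature_swap hy u v w r
  rw [h.metric_nablaCurvature hz, h.metric_nablaCurvature hz, h1.fderiv_eq (𝕜 := ℝ), fderiv_fun_neg,
    h.metric_curvature_swap hz (Γ z a u), h.metric_curvature_swap hz u (Γ z a v),
    h.metric_curvature_swap hz u v (Γ z a w), h.metric_curvature_swap hz u v w (Γ z a r)]
  simp only [_root_.neg_apply]
  ring

end IsLocalLeviCivita

end

variable [FiniteDimensional ℝ E] {g : E → E →L[ℝ] E →L[ℝ] ℝ} {O : Set E}

theorem isInvertible_of_pos {B : E →L[ℝ] E →L[ℝ] ℝ} (hB : ∀ u, u ≠ 0 → 0 < B u u) :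
    B.IsInvertible := by
  have hinj : Function.Injective (B : E →ₗ[ℝ] E →L[ℝ] ℝ) := by
    rw [injective_iff_map_eq_zero]
    intro u hu
    by_contra hne
    have := hB u hne
    have h0 : B u = 0 := hu
    simp [h0] at this
  have hdim : Module.finrank ℝ E = Module.finrank ℝ (E →L[ℝ] ℝ) := by
    rw [← (LinearMap.toContinuousLinearMap (𝕜 := ℝ) (E := E) (F' := ℝ)).finrank_eq]
    exact (Subspace.dual_finrank_eq (K := ℝ) (V := E)).symm
  refine ⟨(LinearEquiv.ofInjectiveOfFinrankEq
    (B : E →ₗ[ℝ] E →L[ℝ] ℝ) hinj hdim).toContinuousLinearEquiv, ?_⟩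
  ext u v
  rfl

/-- The Koszul formula for constant fields. -/
theorem metric_christoffel {z : E} (hpos : ∀ u, u ≠ 0 → 0 < g z u u) (u w v : E) :
    g z (christoffel g z u w) v = koszulForm (fderiv ℝ g z) u w v := by
  have h1 := isInvertible_of_pos hpos
  simp only [christoffel, ContinuousLinearMap.comp_apply, ContinuousLinearMap.compL_apply]
  obtain ⟨e, he⟩ := h1
  rw [← he]
  simp

/-- The Christoffel symbols of a smooth metric are smooth, symmetric and compatible with it. -/
theorem isLocalLeviCivita_christoffel (hO : IsOpen O) (hg : ContDiffOn ℝ ∞ g O)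
    (hsymm : ∀ z ∈ O, ∀ u v, g z u v = g z v u) (hpos : ∀ z ∈ O, ∀ u, u ≠ 0 → 0 < g z u u) :
    IsLocalLeviCivita g (christoffel g) O := by
  have hDs : ∀ z ∈ O, ∀ a b c, fderiv ℝ g z a b c = fderiv ℝ g z a c b := by
    intro z hz a b c
    have h1 : (fun y ↦ g y b c) =ᶠ[𝓝 z] fun y ↦ g y c b := by
      filter_upwards [hO.mem_nhds hz] with y hy using hsymm y hy b c
    have h2 := DFunLike.congr_fun (h1.fderiv_eq (𝕜 := ℝ)) a
    have hd := (hg.contDiffAt (hO.mem_nhds hz)).differentiableAt (by simp)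
    simp (disch := fun_prop) only [fderiv_clm_apply_apply] at h2
    simpa using h2
  have hext : ∀ z ∈ O, ∀ u v : E, (∀ w, g z u w = g z v w) → u = v := by
    intro z hz u v huv
    by_contra hne
    have := hpos z hz (u - v) (sub_ne_zero.2 hne)
    simp [huv] at this
  have hD : ContDiffOn ℝ ∞ (fderiv ℝ g) O := hg.fderiv_of_isOpen hO (by simp)
  refine ⟨hO, hg, ?_, hsymm, hpos, ?_, ?_⟩
  · have hK : ContDiffOn ℝ ∞ (fun z ↦ koszulForm (fderiv ℝ g z)) O := by
      refine contDiffOn_clm_apply.2 fun u ↦ contDiffOn_clm_apply.2 fun v ↦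
        contDiffOn_clm_apply.2 fun w ↦ ?_
      simp only [koszulForm_apply]
      fun_prop
    have hI : ContDiffOn ℝ ∞ (fun z ↦ (g z).inverse) O := by
      intro z hz
      have : CompleteSpace E := FiniteDimensional.complete ℝ E
      obtain ⟨e, he⟩ := isInvertible_of_pos (hpos z hz)
      have h1 := contDiffAt_map_inverse (𝕜 := ℝ) (n := ∞) e
      rw [he] at h1
      exact h1.comp_contDiffWithinAt z (hg z hz)
    refine contDiffOn_clm_apply.2 fun u ↦ contDiffOn_clm_apply.2 fun v ↦ ?_
    simp only [christoffel, ContinuousLinearMap.comp_apply, ContinuousLinearMap.compL_apply]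
    fun_prop
  · intro z hz u v
    refine hext z hz _ _ fun w ↦ ?_
    rw [metric_christoffel (hpos z hz), metric_christoffel (hpos z hz), koszulForm_apply,
      koszulForm_apply, hDs z hz w u v]
    ring
  · intro z hz u v w
    rw [hsymm z hz v, metric_christoffel (hpos z hz), metric_christoffel (hpos z hz),
      koszulForm_apply, koszulForm_apply, hDs z hz u w v]
    ring

end LocalGeometry

/-! ### Tangent vectors in charts -/

section Charts

variable {E : Type*} [NormedAddCommGroup E] [NormedSpace ℝ E]
  {M : Type*} [TopologicalSpace M] [ChartedSpace E M] [IsManifold 𝓘(ℝ, E) ∞ M]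

/-- The coordinates of a tangent vector at `y` in the frame given by the chart at `x₀`; they are `0`
by convention if `y` is outside the domain of the chart. -/
def coords (x₀ y : M) : TangentSpace 𝓘(ℝ, E) y →L[ℝ] E :=
  (trivializationAt E (TangentSpace 𝓘(ℝ, E)) x₀).continuousLinearMapAt ℝ y

/-- The tangent vector at `y` with given coordinates in the frame given by the chart at `x₀`; it is
`0` by convention if `y` is outside the domain of the chart. -/
def frame (x₀ y : M) : E →L[ℝ] TangentSpace 𝓘(ℝ, E) y :=
  (trivializationAt E (TangentSpace 𝓘(ℝ, E)) x₀).symmL ℝ y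

/-- The coordinate expression of a vector field in the chart at `x₀`, as a function on the range of
the chart. -/
def inChart (x₀ : M) (X : Π x : M, TangentSpace 𝓘(ℝ, E) x) (z : E) : E :=
  coords x₀ ((extChartAt 𝓘(ℝ, E) x₀).symm z) (X ((extChartAt 𝓘(ℝ, E) x₀).symm z))

variable {x₀ y : M} (hy : y ∈ (chartAt E x₀).source)

include hy in
theorem coords_eq (v : TangentSpace 𝓘(ℝ, E) y) :
    coords x₀ y v = (trivializationAt E (TangentSpace 𝓘(ℝ, E)) x₀ ⟨y, v⟩).2 :=
  Bundle.Trivialization.continuousLinearMapAt_apply_of_mem ℝ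
    (trivializationAt E (TangentSpace 𝓘(ℝ, E)) x₀) hy v

include hy in
theorem frame_coords (v : TangentSpace 𝓘(ℝ, E) y) : frame x₀ y (coords x₀ y v) = v :=
  Bundle.Trivialization.symmL_continuousLinearMapAt _ hy v

include hy in
theorem coords_frame (v : E) : coords x₀ y (frame x₀ y v) = v :=
  Bundle.Trivialization.continuousLinearMapAt_symmL _ hy v

include hy in
theorem frame_eq_symm (v : E) :
    frame x₀ y v = (trivializationAt E (TangentSpace 𝓘(ℝ, E)) x₀).symm y v :=
  Bundle.Trivialization.symmL_apply _ hy v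

include hy in
theorem coords_injective : Function.Injective (coords (E := E) x₀ y) :=
  Function.LeftInverse.injective (frame_coords hy)

include hy in
theorem coords_eq_mfderiv : coords x₀ y = mfderiv 𝓘(ℝ, E) 𝓘(ℝ, E) (extChartAt 𝓘(ℝ, E) x₀) y :=
  TangentBundle.continuousLinearMapAt_trivializationAt hy

theorem isOpen_extChartAt_target' (x₀ : M) : IsOpen (extChartAt 𝓘(ℝ, E) x₀).target :=
  isOpen_extChartAt_target x₀

include hy in
theorem extChartAt_mem_target : extChartAt 𝓘(ℝ, E) x₀ y ∈ (extChartAt 𝓘(ℝ, E) x₀).target :=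
  (extChartAt 𝓘(ℝ, E) x₀).map_source (by simpa using hy)

include hy in
theorem extChartAt_symm_apply : (extChartAt 𝓘(ℝ, E) x₀).symm (extChartAt 𝓘(ℝ, E) x₀ y) = y :=
  (extChartAt 𝓘(ℝ, E) x₀).left_inv (by simpa using hy)

theorem extChartAt_symm_mem {z : E} (hz : z ∈ (extChartAt 𝓘(ℝ, E) x₀).target) :
    (extChartAt 𝓘(ℝ, E) x₀).symm z ∈ (chartAt E x₀).source := by
  simpa using (extChartAt 𝓘(ℝ, E) x₀).map_target hz

include hy in
theorem inChart_apply (X : Π x : M, TangentSpace 𝓘(ℝ, E) x) :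
    inChart x₀ X (extChartAt 𝓘(ℝ, E) x₀ y) = coords x₀ y (X y) := by
  simp only [inChart]
  rw [extChartAt_symm_apply hy]

include hy in
theorem contMDiffAt_extChart : ContMDiffAt 𝓘(ℝ, E) 𝓘(ℝ, E) ∞ (extChartAt 𝓘(ℝ, E) x₀) y :=
  contMDiffAt_extChartAt' hy

theorem contMDiffAt_extChart_symm {z : E} (hz : z ∈ (extChartAt 𝓘(ℝ, E) x₀).target) :
    ContMDiffAt 𝓘(ℝ, E) 𝓘(ℝ, E) ∞ (extChartAt 𝓘(ℝ, E) x₀).symm z :=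
  (contMDiffOn_extChartAt_symm x₀).contMDiffAt ((isOpen_extChartAt_target' x₀).mem_nhds hz)

include hy in
theorem mdifferentiableAt_section_iff_inChart {X : Π x : M, TangentSpace 𝓘(ℝ, E) x} :
    MDiffAt (T% X) y ↔ DifferentiableAt ℝ (inChart x₀ X) (extChartAt 𝓘(ℝ, E) x₀ y) := by
  rw [Bundle.Trivialization.mdifferentiableAt_section_iff 𝓘(ℝ, E)
    (trivializationAt E (TangentSpace 𝓘(ℝ, E)) x₀) X hy, ← mdifferentiableAt_iff_differentiableAt]
  have hsrc : ∀ᶠ y' in 𝓝 y, y' ∈ (chartAt E x₀).source := (chartAt E x₀).open_source.mem_nhds hy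
  constructor
  · intro h
    have h1 := (contMDiffAt_extChart_symm (extChartAt_mem_target hy)).mdifferentiableAt (by simp)
    have h2 := MDifferentiableAt.comp_of_eq (extChartAt 𝓘(ℝ, E) x₀ y) h h1
      (extChartAt_symm_apply hy)
    refine h2.congr_of_eventuallyEq ?_
    filter_upwards [(isOpen_extChartAt_target' x₀).mem_nhds (extChartAt_mem_target hy)] with z hz
    exact coords_eq (extChartAt_symm_mem hz) _
  · intro h
    have h1 := (contMDiffAt_extChart hy).mdifferentiableAt (by simp)
    refine (MDifferentiableAt.comp y h h1).congr_of_eventuallyEq ?_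
    filter_upwards [hsrc] with y' hy'
    rw [Function.comp, inChart_apply hy', coords_eq hy']

include hy in
theorem mvfderiv_eq_fderiv {h : M → ℝ}
    (hh : DifferentiableAt ℝ (h ∘ (extChartAt 𝓘(ℝ, E) x₀).symm) (extChartAt 𝓘(ℝ, E) x₀ y))
    (u : TangentSpace 𝓘(ℝ, E) y) :
    d% h y u = fderiv ℝ (h ∘ (extChartAt 𝓘(ℝ, E) x₀).symm) (extChartAt 𝓘(ℝ, E) x₀ y)
      (coords x₀ y u) := by
  have hsrc : ∀ᶠ y' in 𝓝 y, y' ∈ (chartAt E x₀).source := (chartAt E x₀).open_source.mem_nhds hy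
  have h0 : h =ᶠ[𝓝 y] (h ∘ (extChartAt 𝓘(ℝ, E) x₀).symm) ∘ extChartAt 𝓘(ℝ, E) x₀ := by
    filter_upwards [hsrc] with y' hy'
    simp only [Function.comp]
    rw [extChartAt_symm_apply hy']
  have h1 := (contMDiffAt_extChart hy).mdifferentiableAt (by simp)
  have h2 : mfderiv 𝓘(ℝ, E) 𝓘(ℝ, ℝ) h y =
      mfderiv 𝓘(ℝ, E) 𝓘(ℝ, ℝ) ((h ∘ (extChartAt 𝓘(ℝ, E) x₀).symm) ∘ extChartAt 𝓘(ℝ, E) x₀) y :=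
    h0.mfderiv_eq
  rw [mfderiv_comp y hh.mdifferentiableAt h1, mfderiv_eq_fderiv, ← coords_eq_mfderiv hy] at h2
  have h3 := DFunLike.congr_fun h2 u
  exact h3

theorem mdifferentiableAt_vectorField_iff {V : E → E} {z : E} :
    MDifferentiableAt 𝓘(ℝ, E) 𝓘(ℝ, E).tangent
      (fun y ↦ (⟨y, V y⟩ : TangentBundle 𝓘(ℝ, E) E)) z ↔ DifferentiableAt ℝ V z := by
  rw [← mdifferentiableAt_iff_differentiableAt]
  have := mdifferentiableAt_section 𝓘(ℝ, E) (F := E) (E := TangentSpace 𝓘(ℝ, E) (M := E)) V (b₀ := z)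
  refine this.trans ?_
  simp

include hy in
/-- The Lie bracket in the chart at `x₀`, by its invariance under the pullback by the chart. -/
theorem coords_mlieBracket [CompleteSpace E] {X Y : Π x : M, TangentSpace 𝓘(ℝ, E) x}
    (hX : MDiffAt (T% X) y) (hY : MDiffAt (T% Y) y) :
    coords x₀ y (mlieBracket 𝓘(ℝ, E) X Y y) =
      fderiv ℝ (inChart x₀ Y) (extChartAt 𝓘(ℝ, E) x₀ y) (coords x₀ y (X y))
      - fderiv ℝ (inChart x₀ X) (extChartAt 𝓘(ℝ, E) x₀ y) (coords x₀ y (Y y)) := by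
  have hsrc : ∀ᶠ y' in 𝓝 y, y' ∈ (chartAt E x₀).source := (chartAt E x₀).open_source.mem_nhds hy
  have : IsManifold 𝓘(ℝ, E) (minSmoothness ℝ 2) M :=
    IsManifold.of_le (n := ∞) minSmoothness_two_le_infty
  have hinv : ∀ y' ∈ (chartAt E x₀).source, ∀ v : TangentSpace 𝓘(ℝ, E) y',
      (mfderiv 𝓘(ℝ, E) 𝓘(ℝ, E) (extChartAt 𝓘(ℝ, E) x₀) y').inverse
        (mfderiv 𝓘(ℝ, E) 𝓘(ℝ, E) (extChartAt 𝓘(ℝ, E) x₀) y' v) = v := by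
    intro y' hy' v
    obtain ⟨e, he⟩ := isInvertible_mfderiv_extChartAt (I := 𝓘(ℝ, E)) (x := x₀) (y := y')
      (by simpa using hy')
    rw [← he]
    exact (DFunLike.congr_fun (ContinuousLinearMap.inverse_equiv e) _).trans (e.symm_apply_apply v)
  have hinv' : ∀ v : TangentSpace 𝓘(ℝ, E) (extChartAt 𝓘(ℝ, E) x₀ y),
      mfderiv 𝓘(ℝ, E) 𝓘(ℝ, E) (extChartAt 𝓘(ℝ, E) x₀) y
        ((mfderiv 𝓘(ℝ, E) 𝓘(ℝ, E) (extChartAt 𝓘(ℝ, E) x₀) y).inverse v) = v := by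
    intro v
    obtain ⟨e, he⟩ := isInvertible_mfderiv_extChartAt (I := 𝓘(ℝ, E)) (x := x₀) (y := y)
      (by simpa using hy)
    rw [← he]
    exact (congrArg e (DFunLike.congr_fun (ContinuousLinearMap.inverse_equiv e) v)).trans
      (e.apply_symm_apply v)
  -- the coordinate expression, as a vector field on the vector space `E`
  let V (X : Π x : M, TangentSpace 𝓘(ℝ, E) x) (z : E) : TangentSpace 𝓘(ℝ, E) z :=
    inChart (E := E) x₀ X z
  have hV : ∀ X : Π x : M, TangentSpace 𝓘(ℝ, E) x, ∀ y' ∈ (chartAt E x₀).source,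
      V X (extChartAt 𝓘(ℝ, E) x₀ y') =
        mfderiv 𝓘(ℝ, E) 𝓘(ℝ, E) (extChartAt 𝓘(ℝ, E) x₀) y' (X y') := by
    intro X y' hy'
    rw [← coords_eq_mfderiv hy']
    exact inChart_apply hy' X
  have hpull : ∀ X : Π x : M, TangentSpace 𝓘(ℝ, E) x,
      mpullback 𝓘(ℝ, E) 𝓘(ℝ, E) (extChartAt 𝓘(ℝ, E) x₀) (V X) =ᶠ[𝓝 y] X := by
    intro X
    filter_upwards [hsrc] with y' hy'
    rw [mpullback_apply, hV X y' hy', hinv y' hy']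
  have h1 := mpullback_mlieBracket (I := 𝓘(ℝ, E)) (I' := 𝓘(ℝ, E)) (n := ∞)
    (f := extChartAt 𝓘(ℝ, E) x₀) (V := V X) (W := V Y) (x₀ := y)
    (mdifferentiableAt_vectorField_iff.2 ((mdifferentiableAt_section_iff_inChart hy).1 hX))
    (mdifferentiableAt_vectorField_iff.2 ((mdifferentiableAt_section_iff_inChart hy).1 hY))
    (contMDiffAt_extChart hy) minSmoothness_two_le_infty
  rw [Filter.EventuallyEq.mlieBracket_vectorField_eq (hpull X) (hpull Y), mpullback_apply] at h1
  have h2 : mlieBracket 𝓘(ℝ, E) (V X) (V Y) (extChartAt 𝓘(ℝ, E) x₀ y) =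
      lieBracket ℝ (inChart x₀ X) (inChart x₀ Y) (extChartAt 𝓘(ℝ, E) x₀ y) := by
    rw [← mlieBracketWithin_univ, mlieBracketWithin_eq_lieBracketWithin]
    exact congrFun (lieBracketWithin_univ (𝕜 := ℝ) (E := E) (V := inChart x₀ X)
      (W := inChart x₀ Y)) _
  have h3 := hinv' (mlieBracket 𝓘(ℝ, E) (V X) (V Y) (extChartAt 𝓘(ℝ, E) x₀ y))
  rw [h1, h2, ← coords_eq_mfderiv hy, lieBracket] at h3
  rw [inChart_apply hy X, inChart_apply hy Y] at h3
  exact h3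

section Riemannian
variable [FiniteDimensional ℝ E] [RiemannianBundle (fun x : M ↦ TangentSpace 𝓘(ℝ, E) x)]

/-- The Riemannian metric in the chart at `x₀`. -/
def chartMetric (x₀ : M) (z : E) : E →L[ℝ] E →L[ℝ] ℝ :=
  ((RiemannianBundle.g (E := fun x : M ↦ TangentSpace 𝓘(ℝ, E) x)).inner
    ((extChartAt 𝓘(ℝ, E) x₀).symm z)).bilinearComp
      (frame x₀ ((extChartAt 𝓘(ℝ, E) x₀).symm z)) (frame x₀ ((extChartAt 𝓘(ℝ, E) x₀).symm z))

theorem chartMetric_apply (x₀ : M) (z u v : E) : chartMetric x₀ z u v =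
    inner ℝ (frame x₀ ((extChartAt 𝓘(ℝ, E) x₀).symm z) u)
      (frame x₀ ((extChartAt 𝓘(ℝ, E) x₀).symm z) v) := rfl

include hy in
theorem chartMetric_coords (u v : TangentSpace 𝓘(ℝ, E) y) :
    chartMetric x₀ (extChartAt 𝓘(ℝ, E) x₀ y) (coords x₀ y u) (coords x₀ y v) = inner ℝ u v := by
  rw [chartMetric_apply, extChartAt_symm_apply hy, frame_coords hy, frame_coords hy]

/-- The Christoffel symbols in the chart at `x₀`. -/
def chartChristoffel (x₀ : M) : E → E →L[ℝ] E →L[ℝ] E := christoffel (chartMetric x₀)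

include hy in
theorem contMDiffAt_frame (w : E) : CMDiffAt ∞ (T% (fun y ↦ frame x₀ y w)) y := by
  rw [Bundle.Trivialization.contMDiffAt_section_iff
    (trivializationAt E (TangentSpace 𝓘(ℝ, E)) x₀) hy]
  refine (contMDiffAt_const (c := w)).congr_of_eventuallyEq ?_
  filter_upwards [(chartAt E x₀).open_source.mem_nhds hy] with y' hy'
  rw [← coords_eq hy', coords_frame hy']

variable [IsContMDiffRiemannianBundle 𝓘(ℝ, E) ∞ E (fun x : M ↦ TangentSpace 𝓘(ℝ, E) x)]

theorem contDiffOn_chartMetric (x₀ : M) :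
    ContDiffOn ℝ ∞ (chartMetric x₀) (extChartAt 𝓘(ℝ, E) x₀).target := by
  refine contDiffOn_clm_apply.2 fun u ↦ contDiffOn_clm_apply.2 fun v ↦ ?_
  intro z hz
  refine ContDiffAt.contDiffWithinAt ?_
  rw [← contMDiffAt_iff_contDiffAt]
  have h1 : ContMDiffAt 𝓘(ℝ, E) 𝓘(ℝ, ℝ) ∞ (fun y ↦ inner ℝ (frame x₀ y u) (frame x₀ y v))
      ((extChartAt 𝓘(ℝ, E) x₀).symm z) :=
    ContMDiffAt.inner_bundle (F := E) (E := fun x : M ↦ TangentSpace 𝓘(ℝ, E) x)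
      (b := fun y ↦ y) (contMDiffAt_frame (extChartAt_symm_mem hz) u)
      (contMDiffAt_frame (extChartAt_symm_mem hz) v)
  exact ContMDiffAt.comp z h1 (contMDiffAt_extChart_symm hz)

/-- The interface between the manifold and the local computations: the metric and the Christoffel
symbols in a chart satisfy the assumptions of the latter. -/
theorem isLocalLeviCivita_chart (x₀ : M) : IsLocalLeviCivita (chartMetric x₀) (chartChristoffel x₀)
    (extChartAt 𝓘(ℝ, E) x₀).target := by
  refine isLocalLeviCivita_christoffel (isOpen_extChartAt_target' x₀) (contDiffOn_chartMetric x₀)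
    ?_ ?_
  · intro z _ u v
    rw [chartMetric_apply, chartMetric_apply, real_inner_comm]
  · intro z hz u hu
    rw [chartMetric_apply]
    refine real_inner_self_pos.2 fun h ↦ hu ?_
    rw [← coords_frame (extChartAt_symm_mem hz) u, h, map_zero]

end Riemannian
end Charts

/-! ### The Levi-Civita connection and its curvature in charts -/

section ChartFormulas

variable {E : Type*} [NormedAddCommGroup E] [NormedSpace ℝ E] [FiniteDimensional ℝ E]
  {M : Type*} [TopologicalSpace M] [ChartedSpace E M] [IsManifold 𝓘(ℝ, E) ∞ M]

variable {x₀ y : M} (hy : y ∈ (chartAt E x₀).source)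

include hy in
theorem contDiffAt_inChart {X : Π x : M, TangentSpace 𝓘(ℝ, E) x} (hX : CMDiffAt ∞ (T% X) y) :
    ContDiffAt ℝ ∞ (inChart x₀ X) (extChartAt 𝓘(ℝ, E) x₀ y) := by
  rw [Bundle.Trivialization.contMDiffAt_section_iff
    (trivializationAt E (TangentSpace 𝓘(ℝ, E)) x₀) hy] at hX
  rw [← contMDiffAt_iff_contDiffAt]
  have h1 := contMDiffAt_extChart_symm (extChartAt_mem_target hy)
  have h2 := ContMDiffAt.comp_of_eq (x := extChartAt 𝓘(ℝ, E) x₀ y) hX h1 (extChartAt_symm_apply hy)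
  refine h2.congr_of_eventuallyEq ?_
  filter_upwards [(isOpen_extChartAt_target' x₀).mem_nhds (extChartAt_mem_target hy)] with z hz
  exact coords_eq (extChartAt_symm_mem hz) _

theorem inChart_frame {z : E} (hz : z ∈ (extChartAt 𝓘(ℝ, E) x₀).target) (w : E) :
    inChart x₀ (fun y ↦ frame x₀ y w) z = w :=
  coords_frame (extChartAt_symm_mem hz) w

include hy in
theorem fderiv_inChart_frame (w : E) :
    fderiv ℝ (inChart x₀ (fun y ↦ frame x₀ y w)) (extChartAt 𝓘(ℝ, E) x₀ y) = 0 := by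
  have : inChart x₀ (fun y ↦ frame x₀ y w) =ᶠ[𝓝 (extChartAt 𝓘(ℝ, E) x₀ y)] fun _ ↦ w := by
    filter_upwards [(isOpen_extChartAt_target' x₀).mem_nhds (extChartAt_mem_target hy)] with z hz
      using inChart_frame hz w
  rw [this.fderiv_eq (𝕜 := ℝ)]
  simp

variable [RiemannianBundle (fun x : M ↦ TangentSpace 𝓘(ℝ, E) x)]

theorem chartMetric_inChart {z : E} (hz : z ∈ (extChartAt 𝓘(ℝ, E) x₀).target)
    (Y Z : Π x : M, TangentSpace 𝓘(ℝ, E) x) :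
    chartMetric x₀ z (inChart x₀ Y z) (inChart x₀ Z z) =
      inner ℝ (Y ((extChartAt 𝓘(ℝ, E) x₀).symm z)) (Z ((extChartAt 𝓘(ℝ, E) x₀).symm z)) := by
  rw [chartMetric_apply, inChart, inChart, frame_coords (extChartAt_symm_mem hz),
    frame_coords (extChartAt_symm_mem hz)]

variable [IsContMDiffRiemannianBundle 𝓘(ℝ, E) ∞ E (fun x : M ↦ TangentSpace 𝓘(ℝ, E) x)]

include hy in
/-- The derivative of `⟨Y, Z⟩` in the chart at `x₀`. -/
theorem mvfderiv_inner {Y Z : Π x : M, TangentSpace 𝓘(ℝ, E) x}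
    (hY : MDiffAt (T% Y) y) (hZ : MDiffAt (T% Z) y) (u : TangentSpace 𝓘(ℝ, E) y) :
    d% (fun y ↦ inner ℝ (Y y) (Z y)) y u =
      fderiv ℝ (chartMetric x₀) (extChartAt 𝓘(ℝ, E) x₀ y) (coords x₀ y u) (coords x₀ y (Y y))
        (coords x₀ y (Z y))
      + chartMetric x₀ (extChartAt 𝓘(ℝ, E) x₀ y)
        (fderiv ℝ (inChart x₀ Y) (extChartAt 𝓘(ℝ, E) x₀ y) (coords x₀ y u)) (coords x₀ y (Z y))
      + chartMetric x₀ (extChartAt 𝓘(ℝ, E) x₀ y) (coords x₀ y (Y y))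
        (fderiv ℝ (inChart x₀ Z) (extChartAt 𝓘(ℝ, E) x₀ y) (coords x₀ y u)) := by
  have hY' := (mdifferentiableAt_section_iff_inChart hy).1 hY
  have hZ' := (mdifferentiableAt_section_iff_inChart hy).1 hZ
  have hg := (isLocalLeviCivita_chart x₀).differentiableAt_metric (extChartAt_mem_target hy)
  have heq : (fun y ↦ inner ℝ (Y y) (Z y)) ∘ (extChartAt 𝓘(ℝ, E) x₀).symm
      =ᶠ[𝓝 (extChartAt 𝓘(ℝ, E) x₀ y)]
      fun z ↦ chartMetric x₀ z (inChart x₀ Y z) (inChart x₀ Z z) := by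
    filter_upwards [(isOpen_extChartAt_target' x₀).mem_nhds (extChartAt_mem_target hy)] with z hz
    rw [chartMetric_inChart hz]; rfl
  have hd : DifferentiableAt ℝ (fun z ↦ chartMetric x₀ z (inChart x₀ Y z) (inChart x₀ Z z))
    (extChartAt 𝓘(ℝ, E) x₀ y) := by fun_prop
  rw [mvfderiv_eq_fderiv hy (hd.congr_of_eventuallyEq heq), heq.fderiv_eq (𝕜 := ℝ)]
  simp (disch := fun_prop) only [fderiv_clm_apply_apply]
  rw [inChart_apply hy, inChart_apply hy]
  simp

include hy in
/-- The Levi-Civita connection in the chart at `x₀`. Both sides agree in the Koszul formula for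
fields with constant coefficients in the frame of the chart. -/
theorem coords_leviCivita {Y : Π x : M, TangentSpace 𝓘(ℝ, E) x} (hY : MDiffAt (T% Y) y)
    (u : TangentSpace 𝓘(ℝ, E) y) :
    coords x₀ y (leviCivita E M Y y u) =
      fderiv ℝ (inChart x₀ Y) (extChartAt 𝓘(ℝ, E) x₀ y) (coords x₀ y u)
      + chartChristoffel x₀ (extChartAt 𝓘(ℝ, E) x₀ y) (coords x₀ y u) (coords x₀ y (Y y)) := by
  have : CompleteSpace E := FiniteDimensional.complete ℝ E
  have hz := extChartAt_mem_target hy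
  have hG := isLocalLeviCivita_chart x₀ (E := E)
  refine hG.ext hz fun v ↦ ?_
  -- test against the coordinate field with components `v`, extending `u` to a coordinate field
  have hX : MDiffAt (T% (fun y' ↦ frame x₀ y' (coords x₀ y u))) y :=
    (contMDiffAt_frame hy _).mdifferentiableAt (by simp)
  have hZ : MDiffAt (T% (fun y' ↦ frame x₀ y' v)) y :=
    (contMDiffAt_frame hy _).mdifferentiableAt (by simp)
  have h1 := inner_leviCivitaAux hY hX hZ
  have hb1 := coords_mlieBracket hy hX hY
  have hb2 := coords_mlieBracket hy hX hZ
  have hb3 := coords_mlieBracket hy hY hZ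
  simp only [fderiv_inChart_frame hy, frame_coords hy, _root_.zero_apply, sub_zero, zero_sub,
    coords_frame hy] at hb1 hb2 hb3
  have hΓ := metric_christoffel (g := chartMetric x₀) (hG.metric_pos _ hz) (coords x₀ y u)
    (coords x₀ y (Y y)) v
  rw [koszulForm_apply] at hΓ
  have hsymm := hG.metric_symm _ hz
  rw [koszul, mvfderiv_inner hy hY hZ, mvfderiv_inner hy hX hZ, mvfderiv_inner hy hX hY,
    ← chartMetric_coords hy, ← chartMetric_coords hy, ← chartMetric_coords hy,
    ← chartMetric_coords hy, hb1, hb2, hb3] at h1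
  simp only [fderiv_inChart_frame hy, frame_coords hy, _root_.zero_apply, coords_frame hy,
    map_zero, map_neg, _root_.neg_apply] at h1
  rw [map_add, _root_.add_apply]
  change _ = _ + chartMetric x₀ _ (christoffel (chartMetric x₀) _ _ _) v
  rw [hΓ]
  refine h1.trans ?_
  rw [hsymm (fderiv ℝ (inChart x₀ Y) (extChartAt 𝓘(ℝ, E) x₀ y) v)]
  ring

theorem coords_leviCivita_eventuallyEq {X Y : Π x : M, TangentSpace 𝓘(ℝ, E) x}
    (hy : y ∈ (chartAt E x₀).source) (hY : CMDiffAt ∞ (T% Y) y) :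
    inChart x₀ (fun y ↦ leviCivita E M Y y (X y)) =ᶠ[𝓝 (extChartAt 𝓘(ℝ, E) x₀ y)]
      fun z ↦ fderiv ℝ (inChart x₀ Y) z (inChart x₀ X z)
        + chartChristoffel x₀ z (inChart x₀ X z) (inChart x₀ Y z) := by
  have h1 : ∀ᶠ z in 𝓝 (extChartAt 𝓘(ℝ, E) x₀ y), ContDiffAt ℝ 1 (inChart x₀ Y) z :=
    ((contDiffAt_inChart hy hY).of_le (by simp)).eventually (by simp)
  filter_upwards [h1, (isOpen_extChartAt_target' x₀).mem_nhds (extChartAt_mem_target hy)]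
    with z hz1 hz
  have hs := extChartAt_symm_mem hz
  have hr : extChartAt 𝓘(ℝ, E) x₀ ((extChartAt 𝓘(ℝ, E) x₀).symm z) = z :=
    (extChartAt 𝓘(ℝ, E) x₀).right_inv hz
  have h2 : MDiffAt (T% Y) ((extChartAt 𝓘(ℝ, E) x₀).symm z) := by
    rw [mdifferentiableAt_section_iff_inChart hs, hr]
    exact hz1.differentiableAt (by simp)
  have h3 := coords_leviCivita hs h2 (X ((extChartAt 𝓘(ℝ, E) x₀).symm z))
  rw [hr] at h3
  exact h3

include hy in
/-- The first derivative of the coordinates of `∇_X Y`. -/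
theorem fderiv_inChart_leviCivita {X Y : Π x : M, TangentSpace 𝓘(ℝ, E) x}
    (hX : CMDiffAt ∞ (T% X) y) (hY : CMDiffAt ∞ (T% Y) y) :
    MDiffAt (T% (fun y ↦ leviCivita E M Y y (X y))) y ∧ ∀ a,
    fderiv ℝ (inChart x₀ (fun y ↦ leviCivita E M Y y (X y))) (extChartAt 𝓘(ℝ, E) x₀ y) a =
      fderiv ℝ (fderiv ℝ (inChart x₀ Y)) (extChartAt 𝓘(ℝ, E) x₀ y) a (coords x₀ y (X y))
      + fderiv ℝ (inChart x₀ Y) (extChartAt 𝓘(ℝ, E) x₀ y)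
        (fderiv ℝ (inChart x₀ X) (extChartAt 𝓘(ℝ, E) x₀ y) a)
      + fderiv ℝ (chartChristoffel x₀) (extChartAt 𝓘(ℝ, E) x₀ y) a (coords x₀ y (X y))
        (coords x₀ y (Y y))
      + chartChristoffel x₀ (extChartAt 𝓘(ℝ, E) x₀ y)
        (fderiv ℝ (inChart x₀ X) (extChartAt 𝓘(ℝ, E) x₀ y) a) (coords x₀ y (Y y))
      + chartChristoffel x₀ (extChartAt 𝓘(ℝ, E) x₀ y) (coords x₀ y (X y))
        (fderiv ℝ (inChart x₀ Y) (extChartAt 𝓘(ℝ, E) x₀ y) a) := by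
  have h1 := coords_leviCivita_eventuallyEq (X := X) hy hY
  have hX' := (contDiffAt_inChart hy hX).differentiableAt (by simp)
  have hY' := (contDiffAt_inChart hy hY).differentiableAt (by simp)
  have hDY : DifferentiableAt ℝ (fderiv ℝ (inChart x₀ Y)) (extChartAt 𝓘(ℝ, E) x₀ y) :=
    ((contDiffAt_inChart hy hY).fderiv_right (m := 1) one_add_one_le_infty).differentiableAt
      (by simp)
  have hΓ := (isLocalLeviCivita_chart x₀).differentiableAt (extChartAt_mem_target hy)
  have hd : DifferentiableAt ℝ (fun z ↦ fderiv ℝ (inChart x₀ Y) z (inChart x₀ X z)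
        + chartChristoffel x₀ z (inChart x₀ X z) (inChart x₀ Y z)) (extChartAt 𝓘(ℝ, E) x₀ y) := by
    fun_prop
  refine ⟨(mdifferentiableAt_section_iff_inChart hy).2 (hd.congr_of_eventuallyEq h1), fun a ↦ ?_⟩
  rw [h1.fderiv_eq (𝕜 := ℝ), fderiv_fun_add (by fun_prop) (by fun_prop), _root_.add_apply]
  simp (disch := fun_prop) only [fderiv_clm_apply_apply]
  rw [inChart_apply hy, inChart_apply hy]
  simp only [_root_.add_apply]
  abel

include hy in
/-- The curvature tensor in the chart at `x₀`. The derivatives of the extensions of `u`, `v`, `w`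
used in its definition cancel. -/
theorem coords_curvature (u v w : TangentSpace 𝓘(ℝ, E) y) :
    coords x₀ y (curvature y u v w) = chartCurvature (chartChristoffel x₀)
      (extChartAt 𝓘(ℝ, E) x₀ y) (coords x₀ y u) (coords x₀ y v) (coords x₀ y w) := by
  have : CompleteSpace E := FiniteDimensional.complete ℝ E
  have hsm : ∀ u : TangentSpace 𝓘(ℝ, E) y, CMDiffAt ∞ (T% (extend E u)) y :=
    fun u ↦ contMDiffAt_extend ..
  have hmd : ∀ u : TangentSpace 𝓘(ℝ, E) y, MDiffAt (T% (extend E u)) y :=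
    fun u ↦ (hsm u).mdifferentiableAt (by simp)
  have h1 := fderiv_inChart_leviCivita hy (hsm v) (hsm w)
  have h2 := fderiv_inChart_leviCivita hy (hsm u) (hsm w)
  have hs := (contDiffAt_inChart hy (hsm w)).isSymmSndFDerivAt minSmoothness_two_le_infty
  have hs' : ∀ a b, fderiv ℝ (fderiv ℝ (inChart x₀ (extend E w))) (extChartAt 𝓘(ℝ, E) x₀ y) a b =
    fderiv ℝ (fderiv ℝ (inChart x₀ (extend E w))) (extChartAt 𝓘(ℝ, E) x₀ y) b a := fun a b ↦ hs a b
  rw [curvature, map_sub, map_sub, coords_leviCivita hy h1.1, coords_leviCivita hy h2.1,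
    h1.2, h2.2]
  simp only [coords_leviCivita hy (hmd w), coords_mlieBracket hy (hmd u) (hmd v),
    extend_apply_self]
  rw [hs' (coords x₀ y u), chartCurvature_apply]
  simp only [map_add, map_sub, _root_.sub_apply]
  abel

include hy in
/-- The covariant derivative of the curvature tensor in the chart at `x₀`. -/
theorem coords_nablaCurvature (a u v w : TangentSpace 𝓘(ℝ, E) y) :
    coords x₀ y (nablaCurvature y a u v w) = chartNablaCurvature (chartChristoffel x₀)
      (extChartAt 𝓘(ℝ, E) x₀ y) (coords x₀ y a) (coords x₀ y u) (coords x₀ y v)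
      (coords x₀ y w) := by
  have hmd : ∀ u : TangentSpace 𝓘(ℝ, E) y, MDiffAt (T% (extend E u)) y :=
    fun u ↦ mdifferentiableAt_extend ..
  have hd := fun u ↦ (mdifferentiableAt_section_iff_inChart hy).1 (hmd u)
  have hu := hd u
  have hv := hd v
  have hw := hd w
  have hR : DifferentiableAt ℝ (chartCurvature (chartChristoffel x₀)) (extChartAt 𝓘(ℝ, E) x₀ y) :=
    ((contDiffOn_chartCurvature (isOpen_extChartAt_target' x₀)
      (isLocalLeviCivita_chart x₀).contDiffOn).contDiffAt
      ((isOpen_extChartAt_target' x₀).mem_nhds (extChartAt_mem_target hy))).differentiableAt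
      (by simp)
  have heq : inChart x₀ (fun y' ↦ curvature y' (extend E u y') (extend E v y') (extend E w y'))
      =ᶠ[𝓝 (extChartAt 𝓘(ℝ, E) x₀ y)] fun z ↦ chartCurvature (chartChristoffel x₀) z
        (inChart x₀ (extend E u) z) (inChart x₀ (extend E v) z) (inChart x₀ (extend E w) z) := by
    filter_upwards [(isOpen_extChartAt_target' x₀).mem_nhds (extChartAt_mem_target hy)] with z hz
    have h1 := coords_curvature (extChartAt_symm_mem hz)
      (extend E u ((extChartAt 𝓘(ℝ, E) x₀).symm z)) (extend E v ((extChartAt 𝓘(ℝ, E) x₀).symm z))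
      (extend E w ((extChartAt 𝓘(ℝ, E) x₀).symm z))
    rw [(extChartAt 𝓘(ℝ, E) x₀).right_inv hz] at h1
    exact h1
  have hdR : DifferentiableAt ℝ (fun z ↦ chartCurvature (chartChristoffel x₀) z
        (inChart x₀ (extend E u) z) (inChart x₀ (extend E v) z) (inChart x₀ (extend E w) z))
        (extChartAt 𝓘(ℝ, E) x₀ y) := by fun_prop
  have hm := (mdifferentiableAt_section_iff_inChart hy).2 (hdR.congr_of_eventuallyEq heq)
  rw [nablaCurvature, map_sub, map_sub, map_sub, coords_leviCivita hy hm, heq.fderiv_eq (𝕜 := ℝ),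
    coords_curvature hy, coords_curvature hy, coords_curvature hy, coords_curvature hy,
    coords_leviCivita hy (hmd u), coords_leviCivita hy (hmd v), coords_leviCivita hy (hmd w)]
  simp (disch := fun_prop) only [fderiv_clm_apply_apply]
  simp only [inChart_apply hy, extend_apply_self, chartNablaCurvature, map_add, _root_.add_apply]
  abel

end ChartFormulas

/-! ### Fields along curves -/

section Curves

variable {E : Type*} [NormedAddCommGroup E] [NormedSpace ℝ E] [FiniteDimensional ℝ E]
  {M : Type*} [TopologicalSpace M] [ChartedSpace E M] [IsManifold 𝓘(ℝ, E) ∞ M]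

/-- The vector field `V` along `γ` is differentiable at `s` within `S`. -/
def IsDiffField (γ : ℝ → M) (S : Set ℝ) (V : Π s : ℝ, TangentSpace 𝓘(ℝ, E) (γ s)) (s : ℝ) : Prop :=
  MDifferentiableWithinAt 𝓘(ℝ, ℝ) 𝓘(ℝ, E).tangent (lift γ V) S s

variable {x₀ : M} {γ : ℝ → M} {S : Set ℝ} {s : ℝ}
  {U V W : Π s : ℝ, TangentSpace 𝓘(ℝ, E) (γ s)}

theorem IsDiffField.base (hV : IsDiffField γ S V s) :
    MDifferentiableWithinAt 𝓘(ℝ, ℝ) 𝓘(ℝ, E) γ S s :=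
  ((mdifferentiableWithinAt_totalSpace 𝓘(ℝ, E) _).1 hV).1

theorem eventually_mem_source (hγ : MDifferentiableWithinAt 𝓘(ℝ, ℝ) 𝓘(ℝ, E) γ S s)
    (hs : γ s ∈ (chartAt E x₀).source) : ∀ᶠ r in 𝓝[S] s, γ r ∈ (chartAt E x₀).source :=
  hγ.continuousWithinAt.preimage_mem_nhdsWithin ((chartAt E x₀).open_source.mem_nhds hs)

theorem isDiffField_iff (hs : γ s ∈ (chartAt E x₀).source)
    (hγ : MDifferentiableWithinAt 𝓘(ℝ, ℝ) 𝓘(ℝ, E) γ S s) :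
    IsDiffField γ S V s ↔ DifferentiableWithinAt ℝ (fun r ↦ coords x₀ (γ r) (V r)) S s := by
  have hsrc : lift γ V s ∈ (trivializationAt E (TangentSpace 𝓘(ℝ, E)) x₀).source := by
    rw [TangentBundle.trivializationAt_source]; exact hs
  have h1 := Bundle.Trivialization.mdifferentiableWithinAt_totalSpace_iff (s := S) (x₀ := s)
    (IM := 𝓘(ℝ, ℝ)) 𝓘(ℝ, E) (trivializationAt E (TangentSpace 𝓘(ℝ, E)) x₀) (lift γ V) hsrc
  refine h1.trans ?_
  rw [← mdifferentiableWithinAt_iff_differentiableWithinAt]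
  have h2 : (fun r ↦ coords x₀ (γ r) (V r)) =ᶠ[𝓝[S] s]
      fun r ↦ (trivializationAt E (TangentSpace 𝓘(ℝ, E)) x₀ (lift γ V r)).2 := by
    filter_upwards [eventually_mem_source hγ hs] with r hr using coords_eq hr _
  have h3 : coords x₀ (γ s) (V s) =
    (trivializationAt E (TangentSpace 𝓘(ℝ, E)) x₀ (lift γ V s)).2 := coords_eq hs _
  rw [Filter.EventuallyEq.mdifferentiableWithinAt_iff h2 h3]
  exact ⟨fun h ↦ h.2, fun h ↦ ⟨hγ, h⟩⟩

theorem hasDerivWithinAt_extChartAt (hs : γ s ∈ (chartAt E x₀).source)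
    (hγ : MDifferentiableWithinAt 𝓘(ℝ, ℝ) 𝓘(ℝ, E) γ S s) :
    HasDerivWithinAt (fun r ↦ extChartAt 𝓘(ℝ, E) x₀ (γ r))
      (coords x₀ (γ s) (velocity γ S s)) S s := by
  have h1 := ((contMDiffAt_extChart hs).mdifferentiableAt (by simp)).hasMFDerivAt
  have h2 := h1.comp_hasMFDerivWithinAt s hγ.hasMFDerivWithinAt
  rw [hasMFDerivWithinAt_iff_hasFDerivWithinAt, ← coords_eq_mfderiv hs] at h2
  let L : ℝ →L[ℝ] E := coords x₀ (γ s) ∘L mfderivWithin 𝓘(ℝ, ℝ) 𝓘(ℝ, E) γ S s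
  have h3 : HasFDerivWithinAt (fun r ↦ extChartAt 𝓘(ℝ, E) x₀ (γ r)) L S s := h2
  exact h3.hasDerivWithinAt

variable [RiemannianBundle (fun x : M ↦ TangentSpace 𝓘(ℝ, E) x)]
  [IsContMDiffRiemannianBundle 𝓘(ℝ, E) ∞ E (fun x : M ↦ TangentSpace 𝓘(ℝ, E) x)]

/-- The covariant derivative along a curve in the chart at an arbitrary point `x₀`:
`V' = ∇_{γ'} V - Γ(γ', V)`. The definition of `covDeriv` gives this in the chart at `γ s`, and the
change of frames is accounted for by `coords_leviCivita`. -/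
theorem hasDerivWithinAt_coords (hs : γ s ∈ (chartAt E x₀).source)
    (hV : IsDiffField γ S V s) :
    HasDerivWithinAt (fun r ↦ coords x₀ (γ r) (V r)) (coords x₀ (γ s) (covDeriv γ S V s)
      - chartChristoffel x₀ (extChartAt 𝓘(ℝ, E) x₀ (γ s)) (coords x₀ (γ s) (velocity γ S s))
        (coords x₀ (γ s) (V s))) S s := by
  have hγ := hV.base
  have hs₁ : γ s ∈ (chartAt E (γ s)).source := mem_chart_source E (γ s)
  have hφ := hasDerivWithinAt_extChartAt hs hγ
  have h1 := ((isDiffField_iff hs₁ hγ).1 hV).hasDerivWithinAt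
  -- the change of frames, from the chart at `γ s` to the chart at `x₀`
  let B : E → E →L[ℝ] E := fun z ↦ coords x₀ ((extChartAt 𝓘(ℝ, E) x₀).symm z) ∘L
    frame (γ s) ((extChartAt 𝓘(ℝ, E) x₀).symm z)
  have hBy : ∀ y ∈ (chartAt E x₀).source, ∀ w,
      B (extChartAt 𝓘(ℝ, E) x₀ y) w = coords x₀ y (frame (γ s) y w) := by
    intro y hy w
    simp only [B, ContinuousLinearMap.comp_apply]
    rw [extChartAt_symm_apply hy]
  have hBd : DifferentiableAt ℝ B (extChartAt 𝓘(ℝ, E) x₀ (γ s)) := by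
    have hopen : IsOpen ((chartAt E x₀).source ∩ (chartAt E (γ s)).source) :=
      (chartAt E x₀).open_source.inter (chartAt E (γ s)).open_source
    have hU : IsOpen ((extChartAt 𝓘(ℝ, E) x₀).target ∩
        (extChartAt 𝓘(ℝ, E) x₀).symm ⁻¹' (chartAt E (γ s)).source) :=
      (continuousOn_extChartAt_symm x₀).isOpen_inter_preimage (isOpen_extChartAt_target' x₀)
        (chartAt E (γ s)).open_source
    have hc : ContDiffOn ℝ ∞ B ((extChartAt 𝓘(ℝ, E) x₀).target ∩
        (extChartAt 𝓘(ℝ, E) x₀).symm ⁻¹' (chartAt E (γ s)).source) := by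
      refine contDiffOn_clm_apply.2 fun w z hz ↦ ContDiffAt.contDiffWithinAt ?_
      have h2 := contDiffAt_inChart (extChartAt_symm_mem hz.1)
        (contMDiffAt_frame (x₀ := γ s) hz.2 w)
      rw [(extChartAt 𝓘(ℝ, E) x₀).right_inv hz.1] at h2
      exact h2
    refine (hc.contDiffAt (hU.mem_nhds ⟨extChartAt_mem_target hs, ?_⟩)).differentiableAt (by simp)
    rw [mem_preimage, extChartAt_symm_apply hs]
    exact hs₁
  have h2 : HasDerivWithinAt (fun r ↦ B (extChartAt 𝓘(ℝ, E) x₀ (γ r)) (coords (γ s) (γ r) (V r)))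
      (fderiv ℝ B (extChartAt 𝓘(ℝ, E) x₀ (γ s)) (coords x₀ (γ s) (velocity γ S s))
          (coords (γ s) (γ s) (V s))
        + B (extChartAt 𝓘(ℝ, E) x₀ (γ s))
          (derivWithin (fun r ↦ coords (γ s) (γ r) (V r)) S s)) S s :=
    (hBd.hasFDerivAt.comp_hasDerivWithinAt s hφ).clm_apply h1
  have heq : (fun r ↦ coords x₀ (γ r) (V r)) =ᶠ[𝓝[S] s]
      fun r ↦ B (extChartAt 𝓘(ℝ, E) x₀ (γ r)) (coords (γ s) (γ r) (V r)) := by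
    filter_upwards [eventually_mem_source hγ hs, eventually_mem_source hγ hs₁] with r hr hr'
    rw [hBy _ hr, frame_coords hr']
  have heqs : coords x₀ (γ s) (V s) =
      B (extChartAt 𝓘(ℝ, E) x₀ (γ s)) (coords (γ s) (γ s) (V s)) := by
    rw [hBy _ hs, frame_coords hs₁]
  refine (h2.congr_of_eventuallyEq heq heqs).congr_deriv ?_
  have hext : MDiffAt (T% (extend E (V s))) (γ s) := mdifferentiableAt_extend ..
  have h3 : inChart x₀ (extend E (V s)) =ᶠ[𝓝 (extChartAt 𝓘(ℝ, E) x₀ (γ s))]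
      fun z ↦ B z (coords (γ s) (γ s) (V s)) := by
    have hcont : ContinuousAt (extChartAt 𝓘(ℝ, E) x₀).symm (extChartAt 𝓘(ℝ, E) x₀ (γ s)) :=
      (contMDiffAt_extChart_symm (extChartAt_mem_target hs)).continuousAt
    have h4 : ∀ᶠ z in 𝓝 (extChartAt 𝓘(ℝ, E) x₀ (γ s)),
        (extChartAt 𝓘(ℝ, E) x₀).symm z ∈ (chartAt E (γ s)).source := by
      refine hcont.preimage_mem_nhds ((chartAt E (γ s)).open_source.mem_nhds ?_)
      rw [extChartAt_symm_apply hs]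
      exact hs₁
    filter_upwards [h4] with z hz
    simp only [inChart, B, ContinuousLinearMap.comp_apply]
    rw [frame_eq_symm hz, coords_eq hs₁]
    rfl
  have h5 : derivWithin (fun r ↦ (trivializationAt E (TangentSpace 𝓘(ℝ, E)) (γ s)
        (lift γ V r)).2) S s = derivWithin (fun r ↦ coords (γ s) (γ r) (V r)) S s := by
    refine Filter.EventuallyEq.derivWithin_eq ?_ (coords_eq hs₁ _).symm
    filter_upwards [eventually_mem_source hγ hs₁] with r hr using (coords_eq hr _).symm
  have h6 : fderiv ℝ (fun z ↦ B z (coords (γ s) (γ s) (V s))) (extChartAt 𝓘(ℝ, E) x₀ (γ s))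
      (coords x₀ (γ s) (velocity γ S s)) = fderiv ℝ B (extChartAt 𝓘(ℝ, E) x₀ (γ s))
        (coords x₀ (γ s) (velocity γ S s)) (coords (γ s) (γ s) (V s)) := by
    rw [fderiv_clm_apply_apply hBd (by fun_prop)]
    simp
  rw [covDeriv, map_add, coords_leviCivita hs hext, h3.fderiv_eq (𝕜 := ℝ), h6, h5,
    ← frame_eq_symm hs₁, hBy _ hs, extend_apply_self]
  abel

/-- Differentiability and covariant derivative of a field, read off from its expression in a
chart. -/
theorem isDiffField_of_hasDerivWithinAt (hs : γ s ∈ (chartAt E x₀).source)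
    (hS : UniqueDiffWithinAt ℝ S s) (hγ : MDifferentiableWithinAt 𝓘(ℝ, ℝ) 𝓘(ℝ, E) γ S s) {d : E}
    (hd : HasDerivWithinAt (fun r ↦ coords x₀ (γ r) (V r)) d S s) :
    IsDiffField γ S V s ∧ coords x₀ (γ s) (covDeriv γ S V s) = d
      + chartChristoffel x₀ (extChartAt 𝓘(ℝ, E) x₀ (γ s)) (coords x₀ (γ s) (velocity γ S s))
        (coords x₀ (γ s) (V s)) := by
  have hV : IsDiffField γ S V s := (isDiffField_iff hs hγ).2 hd.differentiableWithinAt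
  refine ⟨hV, ?_⟩
  have h1 := (hasDerivWithinAt_coords hs hV).derivWithin hS
  rw [hd.derivWithin hS] at h1
  rw [h1]
  abel

theorem hasDerivWithinAt_inner
    (hV : IsDiffField γ S V s) (hW : IsDiffField γ S W s) :
    HasDerivWithinAt (fun r ↦ inner ℝ (V r) (W r))
      (inner ℝ (covDeriv γ S V s) (W s) + inner ℝ (V s) (covDeriv γ S W s)) S s := by
  have hγ := hV.base
  have hs : γ s ∈ (chartAt E (γ s)).source := mem_chart_source E (γ s)
  have hG := isLocalLeviCivita_chart (γ s) (E := E)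
  have hz := extChartAt_mem_target hs
  have h1 := (((hG.differentiableAt_metric hz).hasFDerivAt.comp_hasDerivWithinAt s
    (hasDerivWithinAt_extChartAt hs hγ)).clm_apply
      (hasDerivWithinAt_coords hs hV)).clm_apply (hasDerivWithinAt_coords hs hW)
  refine (h1.congr_of_eventuallyEq ?_ ?_).congr_deriv ?_
  · filter_upwards [eventually_mem_source hγ hs] with r hr
    exact (chartMetric_coords hr _ _).symm
  · exact (chartMetric_coords hs _ _).symm
  · simp only [_root_.add_apply, map_sub, _root_.sub_apply, hG.metric _ hz, Function.comp_apply,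
      ← chartMetric_coords hs (covDeriv γ S V s), ← chartMetric_coords hs (V s)]
    ring

/-- The product rule for the curvature tensor applied to three fields along a curve. -/
theorem covDeriv_curvature (hS : UniqueDiffWithinAt ℝ S s)
    (hU : IsDiffField γ S U s) (hV : IsDiffField γ S V s) (hW : IsDiffField γ S W s) :
    IsDiffField γ S (fun r ↦ curvature (γ r) (U r) (V r) (W r)) s ∧
    covDeriv γ S (fun r ↦ curvature (γ r) (U r) (V r) (W r)) s =
      nablaCurvature (γ s) (velocity γ S s) (U s) (V s) (W s)
      + curvature (γ s) (covDeriv γ S U s) (V s) (W s)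
      + curvature (γ s) (U s) (covDeriv γ S V s) (W s)
      + curvature (γ s) (U s) (V s) (covDeriv γ S W s) := by
  have hγ := hV.base
  have hs : γ s ∈ (chartAt E (γ s)).source := mem_chart_source E (γ s)
  have hG := isLocalLeviCivita_chart (γ s) (E := E)
  have hz := extChartAt_mem_target hs
  have hR : DifferentiableAt ℝ (chartCurvature (chartChristoffel (γ s)))
      (extChartAt 𝓘(ℝ, E) (γ s) (γ s)) :=
    ((contDiffOn_chartCurvature hG.isOpen hG.contDiffOn).contDiffAt
      (hG.isOpen.mem_nhds hz)).differentiableAt (by simp)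
  have h1 := (((hR.hasFDerivAt.comp_hasDerivWithinAt s
    (hasDerivWithinAt_extChartAt hs hγ)).clm_apply
      (hasDerivWithinAt_coords hs hU)).clm_apply (hasDerivWithinAt_coords hs hV)).clm_apply
      (hasDerivWithinAt_coords hs hW)
  have h2 := h1.congr_of_eventuallyEq
    (f₁ := fun r ↦ coords (γ s) (γ r) (curvature (γ r) (U r) (V r) (W r))) (by
      filter_upwards [eventually_mem_source hγ hs] with r hr
      exact coords_curvature hr _ _ _) (coords_curvature hs _ _ _)
  obtain ⟨h3, h4⟩ := isDiffField_of_hasDerivWithinAt hs hS hγ h2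
  refine ⟨h3, coords_injective hs ?_⟩
  rw [h4]
  simp only [map_add, coords_curvature hs, coords_nablaCurvature hs, chartNablaCurvature,
    _root_.add_apply, map_sub, _root_.sub_apply, Function.comp_apply]
  abel

theorem covDeriv_smul {f : ℝ → ℝ} {f' : ℝ} (hS : UniqueDiffWithinAt ℝ S s)
    (hf : HasDerivWithinAt f f' S s) (hV : IsDiffField γ S V s) :
    IsDiffField γ S (fun r ↦ f r • V r) s ∧
    covDeriv γ S (fun r ↦ f r • V r) s = f' • V s + f s • covDeriv γ S V s := by
  have hs : γ s ∈ (chartAt E (γ s)).source := mem_chart_source E (γ s)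
  have h1 := hf.smul (hasDerivWithinAt_coords hs hV)
  have h2 : HasDerivWithinAt (fun r ↦ coords (γ s) (γ r) (f r • V r)) _ S s :=
    h1.congr_of_eventuallyEq (Eventually.of_forall fun r ↦ map_smul _ _ _) (map_smul _ _ _)
  obtain ⟨h3, h4⟩ := isDiffField_of_hasDerivWithinAt hs hS hV.base h2
  refine ⟨h3, coords_injective hs ?_⟩
  rw [h4]
  simp only [map_add, map_smul, smul_sub]
  abel

theorem covDeriv_add (hS : UniqueDiffWithinAt ℝ S s)
    (hV : IsDiffField γ S V s) (hW : IsDiffField γ S W s) :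
    IsDiffField γ S (fun r ↦ V r + W r) s ∧
    covDeriv γ S (fun r ↦ V r + W r) s = covDeriv γ S V s + covDeriv γ S W s := by
  have hs : γ s ∈ (chartAt E (γ s)).source := mem_chart_source E (γ s)
  have h1 := (hasDerivWithinAt_coords hs hV).add (hasDerivWithinAt_coords hs hW)
  have h2 : HasDerivWithinAt (fun r ↦ coords (γ s) (γ r) (V r + W r)) _ S s :=
    h1.congr_of_eventuallyEq (Eventually.of_forall fun r ↦ map_add _ _ _) (map_add _ _ _)
  obtain ⟨h3, h4⟩ := isDiffField_of_hasDerivWithinAt hs hS hV.base h2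
  refine ⟨h3, coords_injective hs ?_⟩
  rw [h4]
  simp only [map_add]
  abel

/-- The covariant derivative at `s` depends only on the germ at `s` of the field, seen as a curve in
the tangent bundle. The base curves may differ elsewhere, so equality is stated in the bundle. -/
theorem lift_covDeriv_congr {γ₁ γ₂ : ℝ → M} {V₁ : Π s : ℝ, TangentSpace 𝓘(ℝ, E) (γ₁ s)}
    {V₂ : Π s : ℝ, TangentSpace 𝓘(ℝ, E) (γ₂ s)} (h : lift γ₁ V₁ =ᶠ[𝓝[S] s] lift γ₂ V₂)
    (hs : lift γ₁ V₁ s = lift γ₂ V₂ s) :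
    lift γ₁ (covDeriv γ₁ S V₁) s = lift γ₂ (covDeriv γ₂ S V₂) s := by
  let G : TangentBundle 𝓘(ℝ, E) M → (ℝ → TangentBundle 𝓘(ℝ, E) M) → E → TangentBundle 𝓘(ℝ, E) M :=
    fun p σ v ↦ ⟨p.1, (trivializationAt E (TangentSpace 𝓘(ℝ, E)) p.1).symm p.1
      (derivWithin (fun r ↦ (trivializationAt E (TangentSpace 𝓘(ℝ, E)) p.1 (σ r)).2) S s)
      + leviCivita E M (extend E p.2) p.1 v⟩
  -- only the germ of `σ` at `s` matters in `G p σ v`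
  have hG : ∀ p (σ₁ σ₂ : ℝ → TangentBundle 𝓘(ℝ, E) M) v, σ₁ =ᶠ[𝓝[S] s] σ₂ → σ₁ s = σ₂ s →
      G p σ₁ v = G p σ₂ v := by
    intro p σ₁ σ₂ v h1 h2
    have : derivWithin (fun r ↦ (trivializationAt E (TangentSpace 𝓘(ℝ, E)) p.1 (σ₁ r)).2) S s =
        derivWithin (fun r ↦ (trivializationAt E (TangentSpace 𝓘(ℝ, E)) p.1 (σ₂ r)).2) S s := by
      refine Filter.EventuallyEq.derivWithin_eq ?_ (by rw [h2])
      filter_upwards [h1] with r hr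
      rw [hr]
    simp only [G, this]
  have hγ : γ₁ =ᶠ[𝓝[S] s] γ₂ := by
    filter_upwards [h] with r hr using congrArg TotalSpace.proj hr
  have hγs : γ₁ s = γ₂ s := congrArg TotalSpace.proj hs
  have hv : (velocity γ₁ S s : E) = (velocity γ₂ S s : E) :=
    DFunLike.congr_fun (hγ.mfderivWithin_eq (I := 𝓘(ℝ, ℝ)) (I' := 𝓘(ℝ, E)) hγs) (1 : ℝ)
  change G (lift γ₁ V₁ s) (lift γ₁ V₁) (velocity γ₁ S s) =
    G (lift γ₂ V₂ s) (lift γ₂ V₂) (velocity γ₂ S s)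
  exact ((hG _ _ _ _ h hs).trans (congrArg (fun q ↦ G q (lift γ₂ V₂) _) hs)).trans
    (congrArg (G (lift γ₂ V₂ s) (lift γ₂ V₂)) hv)

theorem lift_velocity_congr {γ₁ γ₂ : ℝ → M} (h : γ₁ =ᶠ[𝓝[S] s] γ₂) (hs : γ₁ s = γ₂ s) :
    lift γ₁ (velocity (E := E) γ₁ S) s = lift γ₂ (velocity (E := E) γ₂ S) s := by
  have hv : (velocity γ₁ S s : E) = (velocity γ₂ S s : E) :=
    DFunLike.congr_fun (h.mfderivWithin_eq (I := 𝓘(ℝ, ℝ)) (I' := 𝓘(ℝ, E)) hs) (1 : ℝ)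
  let G : M → E → TangentBundle 𝓘(ℝ, E) M := fun x v ↦ ⟨x, v⟩
  change G (γ₁ s) (velocity γ₁ S s) = G (γ₂ s) (velocity γ₂ S s)
  rw [hs]
  exact congrArg (G (γ₂ s)) hv

theorem covDeriv_congr (h : ∀ᶠ r in 𝓝[S] s, V r = W r) (hs : V s = W s) :
    covDeriv γ S V s = covDeriv γ S W s := by
  have h1 := lift_covDeriv_congr (S := S) (s := s) (V₁ := V) (V₂ := W)
    (by filter_upwards [h] with r hr; rw [lift, hr]; rfl) (by rw [lift, hs]; rfl)
  exact eq_of_heq (TotalSpace.mk.inj h1).2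

end Curves

/-! ### Symmetries of the curvature tensor -/

section Symmetries

variable {E : Type*} [NormedAddCommGroup E] [NormedSpace ℝ E] [FiniteDimensional ℝ E]
  {M : Type*} [TopologicalSpace M] [ChartedSpace E M] [IsManifold 𝓘(ℝ, E) ∞ M]
  [RiemannianBundle (fun x : M ↦ TangentSpace 𝓘(ℝ, E) x)]
  [IsContMDiffRiemannianBundle 𝓘(ℝ, E) ∞ E (fun x : M ↦ TangentSpace 𝓘(ℝ, E) x)]
  {x : M} (a u v w r : TangentSpace 𝓘(ℝ, E) x)

theorem curvature_swap : curvature x u v w = - curvature x v u w := by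
  have hx := mem_chart_source E x
  refine coords_injective hx ?_
  rw [map_neg, coords_curvature hx, coords_curvature hx, IsLocalLeviCivita.chartCurvature_swap]

theorem curvature_zero_left : curvature x 0 v w = 0 := by
  have hx := mem_chart_source E x
  refine coords_injective hx ?_
  simp only [map_zero, coords_curvature hx, _root_.zero_apply]

theorem inner_curvature_swap :
    inner ℝ (curvature x u v w) r = - inner ℝ (curvature x u v r) w := by
  have hx := mem_chart_source E x
  rw [← chartMetric_coords hx, ← chartMetric_coords hx, coords_curvature hx, coords_curvature hx]
  exact (isLocalLeviCivita_chart x).metric_curvature_swap (extChartAt_mem_target hx) _ _ _ _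

theorem inner_curvature_pair :
    inner ℝ (curvature x u v w) r = inner ℝ (curvature x w r u) v := by
  have hx := mem_chart_source E x
  rw [← chartMetric_coords hx, ← chartMetric_coords hx, coords_curvature hx, coords_curvature hx]
  exact (isLocalLeviCivita_chart x).metric_curvature_pair (extChartAt_mem_target hx) _ _ _ _

theorem curvature_bianchi :
    curvature x u v w + curvature x v w u + curvature x w u v = 0 := by
  have hx := mem_chart_source E x
  refine coords_injective hx ?_
  simp only [map_add, coords_curvature hx, map_zero]
  exact (isLocalLeviCivita_chart x).bianchi (extChartAt_mem_target hx) _ _ _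

theorem nablaCurvature_bianchi :
    nablaCurvature x a u v w + nablaCurvature x u v a w + nablaCurvature x v a u w = 0 := by
  have hx := mem_chart_source E x
  refine coords_injective hx ?_
  simp only [map_add, coords_nablaCurvature hx, map_zero]
  exact (isLocalLeviCivita_chart x).second_bianchi (extChartAt_mem_target hx) _ _ _ _

theorem inner_nablaCurvature_pair :
    inner ℝ (nablaCurvature x a u v w) r = inner ℝ (nablaCurvature x a w r u) v := by
  have hx := mem_chart_source E x
  rw [← chartMetric_coords hx, ← chartMetric_coords hx, coords_nablaCurvature hx,
    coords_nablaCurvature hx]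
  exact (isLocalLeviCivita_chart x).metric_nablaCurvature_pair (extChartAt_mem_target hx) _ _ _ _ _

theorem inner_nablaCurvature_swap :
    inner ℝ (nablaCurvature x a u v w) r = - inner ℝ (nablaCurvature x a u v r) w := by
  have hx := mem_chart_source E x
  rw [← chartMetric_coords hx, ← chartMetric_coords hx, coords_nablaCurvature hx,
    coords_nablaCurvature hx]
  exact (isLocalLeviCivita_chart x).metric_nablaCurvature_swap (extChartAt_mem_target hx) _ _ _ _ _

end Symmetries

/-! ### The derivative of `|V|^{p-2} V` -/

section Power

/-- A product with a continuous factor is differentiable at a zero of the other factor. -/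
theorem hasDerivWithinAt_smul_of_eq_zero {F : Type*} [NormedAddCommGroup F] [NormedSpace ℝ F]
    {c : ℝ → ℝ} {f : ℝ → F} {f' : F} {S : Set ℝ} {s : ℝ} (hc : ContinuousWithinAt c S s)
    (hf : HasDerivWithinAt f f' S s) (hs : f s = 0) :
    HasDerivWithinAt (fun r ↦ c r • f r) (c s • f') S s := by
  rw [hasDerivWithinAt_iff_tendsto_slope] at hf ⊢
  have hc' : Tendsto c (𝓝[S \ {s}] s) (𝓝 (c s)) := hc.mono_left (nhdsWithin_mono _ sdiff_subset)
  refine (hc'.smul hf).congr fun r ↦ ?_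
  simp only [slope_def_module, hs, smul_zero, sub_zero]
  rw [smul_comm]

variable {E : Type*} [NormedAddCommGroup E] [NormedSpace ℝ E] [FiniteDimensional ℝ E]
  {M : Type*} [TopologicalSpace M] [ChartedSpace E M] [IsManifold 𝓘(ℝ, E) ∞ M]
  [RiemannianBundle (fun x : M ↦ TangentSpace 𝓘(ℝ, E) x)]
  [IsContMDiffRiemannianBundle 𝓘(ℝ, E) ∞ E (fun x : M ↦ TangentSpace 𝓘(ℝ, E) x)]
  {γ : ℝ → M} {S : Set ℝ} {s : ℝ} {V : Π s : ℝ, TangentSpace 𝓘(ℝ, E) (γ s)}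

theorem rpow_norm_eq {F : Type*} [NormedAddCommGroup F] [InnerProductSpace ℝ F] (v : F) (q : ℝ) :
    ‖v‖ ^ q = (inner ℝ v v) ^ (q / 2) := by
  rw [real_inner_self_eq_norm_sq, ← Real.rpow_natCast, ← Real.rpow_mul (norm_nonneg v)]
  congr 1
  push_cast
  ring

theorem IsDiffField.continuousWithinAt_norm (hV : IsDiffField γ S V s) :
    ContinuousWithinAt (fun r ↦ ‖V r‖) S s := by
  have h := (hasDerivWithinAt_inner hV hV).continuousWithinAt.sqrt
  refine h.congr (fun r _ ↦ ?_) ?_ <;> exact norm_eq_sqrt_real_inner _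

/-- The covariant derivative of `|V|^{p-2} V`. At a zero of `V` the second term vanishes, whatever
the value of `|V|^{p-4}`. -/
theorem covDeriv_rpow_norm_smul {p : ℝ} (hS : UniqueDiffWithinAt ℝ S s) (hV : IsDiffField γ S V s)
    (hp : 2 ≤ p ∨ V s ≠ 0) :
    IsDiffField γ S (fun r ↦ ‖V r‖ ^ (p - 2) • V r) s ∧
    covDeriv γ S (fun r ↦ ‖V r‖ ^ (p - 2) • V r) s = ‖V s‖ ^ (p - 2) • covDeriv γ S V s
      + ((p - 2) * (‖V s‖ ^ (p - 4) * inner ℝ (covDeriv γ S V s) (V s))) • V s := by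
  by_cases h0 : V s = 0
  · have hs : γ s ∈ (chartAt E (γ s)).source := mem_chart_source E (γ s)
    have hp2 : 0 ≤ p - 2 := by
      rcases hp with h | h
      · linarith
      · exact absurd h0 h
    have hc : ContinuousWithinAt (fun r ↦ ‖V r‖ ^ (p - 2)) S s :=
      hV.continuousWithinAt_norm.rpow_const (Or.inr hp2)
    have h1 := hasDerivWithinAt_smul_of_eq_zero hc (hasDerivWithinAt_coords hs hV)
      (by rw [h0, map_zero])
    have h2 : HasDerivWithinAt (fun r ↦ coords (γ s) (γ r) (‖V r‖ ^ (p - 2) • V r)) _ S s :=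
      h1.congr_of_eventuallyEq (Eventually.of_forall fun r ↦ map_smul _ _ _) (map_smul _ _ _)
    obtain ⟨h3, h4⟩ := isDiffField_of_hasDerivWithinAt hs hS hV.base h2
    refine ⟨h3, coords_injective hs ?_⟩
    rw [h4]
    simp only [map_add, map_smul, smul_sub, h0, map_zero, smul_zero]
    abel
  · have hN := hasDerivWithinAt_inner hV hV
    have h1 := hN.rpow_const (p := (p - 2) / 2) (Or.inl (inner_self_ne_zero.2 h0))
    have h2 : HasDerivWithinAt (fun r ↦ ‖V r‖ ^ (p - 2))
        ((p - 2) * (‖V s‖ ^ (p - 4) * inner ℝ (covDeriv γ S V s) (V s))) S s := by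
      refine (h1.congr (fun r _ ↦ rpow_norm_eq _ _) (rpow_norm_eq _ _)).congr_deriv ?_
      rw [rpow_norm_eq _ (p - 4), real_inner_comm (covDeriv γ S V s),
        show (p - 2) / 2 - 1 = (p - 4) / 2 by ring]
      ring
    obtain ⟨h3, h4⟩ := covDeriv_smul hS h2 hV
    exact ⟨h3, by rw [h4, add_comm]⟩

end Power

/-! ### Fields along two-parameter families -/

section Families

variable {E : Type*} [NormedAddCommGroup E] [NormedSpace ℝ E] [FiniteDimensional ℝ E]
  {M : Type*} [TopologicalSpace M] [ChartedSpace E M] [IsManifold 𝓘(ℝ, E) ∞ M]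

variable (E) in
/-- `F t s`, for `(t, s) ∈ J × S`, is a smooth two-parameter family of points of `M`; the sets `J`
and `S` of parameters may contain end points, but are not too thin for derivatives of all orders to
be unique and for mixed second derivatives to commute. -/
structure IsSmoothFamily (F : ℝ → ℝ → M) (J S : Set ℝ) : Prop where
  contMDiffOn : ContMDiffOn 𝓘(ℝ, ℝ × ℝ) 𝓘(ℝ, E) ∞ (fun q : ℝ × ℝ ↦ F q.1 q.2) (J ×ˢ S)
  left : UniqueDiffOn ℝ J
  right : UniqueDiffOn ℝ S
  subset_closure : J ×ˢ S ⊆ closure (interior (J ×ˢ S))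

/-- A vector field along a two-parameter family is smooth if its coordinates in every chart are. -/
def IsSmoothField (F : ℝ → ℝ → M) (J S : Set ℝ)
    (V : Π t s : ℝ, TangentSpace 𝓘(ℝ, E) (F t s)) : Prop :=
  ∀ q ∈ J ×ˢ S, ∀ x₀ : M, F q.1 q.2 ∈ (chartAt E x₀).source →
    ContDiffWithinAt ℝ ∞ (fun r : ℝ × ℝ ↦ coords x₀ (F r.1 r.2) (V r.1 r.2)) (J ×ˢ S) q

/-- The velocity `∂F/∂t` of the transversal curves `t ↦ F t s`. -/
def velocityLeft (F : ℝ → ℝ → M) (J : Set ℝ) (t s : ℝ) : TangentSpace 𝓘(ℝ, E) (F t s) :=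
  velocity (fun t ↦ F t s) J t

/-- The velocity `∂F/∂s` of the curves `s ↦ F t s`. -/
def velocityRight (F : ℝ → ℝ → M) (S : Set ℝ) (t s : ℝ) : TangentSpace 𝓘(ℝ, E) (F t s) :=
  velocity (F t) S s

section Derivatives

variable {F : ℝ → ℝ → M} {J S : Set ℝ} {x₀ : M} {q : ℝ × ℝ} {i : ℝ → ℝ × ℝ} {I : Set ℝ} {r : ℝ}
  {ξ : ℝ × ℝ} {U V W : Π t s : ℝ, TangentSpace 𝓘(ℝ, E) (F t s)}

theorem IsSmoothFamily.uniqueDiffOn (hF : IsSmoothFamily E F J S) : UniqueDiffOn ℝ (J ×ˢ S) :=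
  hF.left.prod hF.right

theorem IsSmoothFamily.eventually_mem_source (hF : IsSmoothFamily E F J S) (hq : q ∈ J ×ˢ S)
    (hs : F q.1 q.2 ∈ (chartAt E x₀).source) :
    ∀ᶠ r in 𝓝[J ×ˢ S] q, r ∈ J ×ˢ S ∧ F r.1 r.2 ∈ (chartAt E x₀).source :=
  eventually_mem_nhdsWithin.and ((hF.contMDiffOn q hq).continuousWithinAt.preimage_mem_nhdsWithin
    ((chartAt E x₀).open_source.mem_nhds hs))

theorem IsSmoothFamily.contDiffWithinAt (hF : IsSmoothFamily E F J S) (hq : q ∈ J ×ˢ S)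
    (hs : F q.1 q.2 ∈ (chartAt E x₀).source) :
    ContDiffWithinAt ℝ ∞ (fun r : ℝ × ℝ ↦ extChartAt 𝓘(ℝ, E) x₀ (F r.1 r.2)) (J ×ˢ S) q := by
  rw [← contMDiffWithinAt_iff_contDiffWithinAt]
  exact (contMDiffAt_extChart hs).comp_contMDiffWithinAt q (hF.contMDiffOn q hq)

-- In the lemmas named `comp`, `i` is a curve with velocity `ξ` in the plane of parameters; it will be
-- a horizontal or a vertical line.

theorem IsSmoothFamily.mdifferentiableWithinAt_comp (hF : IsSmoothFamily E F J S)
    (hi : HasDerivWithinAt i ξ I r) (hI : MapsTo i I (J ×ˢ S)) (hr : r ∈ I) :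
    MDifferentiableWithinAt 𝓘(ℝ, ℝ) 𝓘(ℝ, E) (fun t ↦ F (i t).1 (i t).2) I r :=
  ((hF.contMDiffOn (i r) (hI hr)).mdifferentiableWithinAt (by simp)).comp r
    hi.differentiableWithinAt.mdifferentiableWithinAt hI

theorem IsSmoothFamily.coords_velocity_comp (hF : IsSmoothFamily E F J S)
    (hi : HasDerivWithinAt i ξ I r) (hI : MapsTo i I (J ×ˢ S)) (hr : r ∈ I)
    (hu : UniqueDiffWithinAt ℝ I r) (hs : F (i r).1 (i r).2 ∈ (chartAt E x₀).source) :
    coords x₀ (F (i r).1 (i r).2) (velocity (fun t ↦ F (i t).1 (i t).2) I r) =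
      fderivWithin ℝ (fun q : ℝ × ℝ ↦ extChartAt 𝓘(ℝ, E) x₀ (F q.1 q.2)) (J ×ˢ S) (i r) ξ := by
  have h1 := hasDerivWithinAt_extChartAt (γ := fun t ↦ F (i t).1 (i t).2) hs
    (hF.mdifferentiableWithinAt_comp hi hI hr)
  have h2 := ((hF.contDiffWithinAt (hI hr) hs).differentiableWithinAt
    (by simp)).hasFDerivWithinAt.comp_hasDerivWithinAt r hi hI
  rw [← h1.derivWithin hu, ← h2.derivWithin hu]
  rfl

theorem IsSmoothField.isDiffField_comp (hV : IsSmoothField F J S V) (hF : IsSmoothFamily E F J S)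
    (hi : HasDerivWithinAt i ξ I r) (hI : MapsTo i I (J ×ˢ S)) (hr : r ∈ I) :
    IsDiffField (fun t ↦ F (i t).1 (i t).2) I (fun t ↦ V (i t).1 (i t).2) r := by
  have hs := mem_chart_source E (F (i r).1 (i r).2)
  refine (isDiffField_iff (γ := fun t ↦ F (i t).1 (i t).2) hs
    (hF.mdifferentiableWithinAt_comp hi hI hr)).2 ?_
  exact (((hV (i r) (hI hr) _ hs).differentiableWithinAt
    (by simp)).hasFDerivWithinAt.comp_hasDerivWithinAt r hi hI).differentiableWithinAt

variable [RiemannianBundle (fun x : M ↦ TangentSpace 𝓘(ℝ, E) x)]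
  [IsContMDiffRiemannianBundle 𝓘(ℝ, E) ∞ E (fun x : M ↦ TangentSpace 𝓘(ℝ, E) x)]

/-- The coordinate expression of the covariant derivative, in the direction `ξ` of the plane of
parameters, of the field with coordinates `v` along the family with coordinates `f`. -/
def chartCovDeriv (Γ : E → E →L[ℝ] E →L[ℝ] E) (Ω : Set (ℝ × ℝ)) (f v : ℝ × ℝ → E) (ξ q : ℝ × ℝ) :
    E :=
  fderivWithin ℝ v Ω q ξ + Γ (f q) (fderivWithin ℝ f Ω q ξ) (v q)

theorem IsSmoothField.coords_covDeriv_comp (hV : IsSmoothField F J S V)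
    (hF : IsSmoothFamily E F J S)
    (hi : HasDerivWithinAt i ξ I r) (hI : MapsTo i I (J ×ˢ S)) (hr : r ∈ I)
    (hu : UniqueDiffWithinAt ℝ I r) (hs : F (i r).1 (i r).2 ∈ (chartAt E x₀).source) :
    coords x₀ (F (i r).1 (i r).2)
      (covDeriv (fun t ↦ F (i t).1 (i t).2) I (fun t ↦ V (i t).1 (i t).2) r) =
    chartCovDeriv (chartChristoffel x₀) (J ×ˢ S) (fun q ↦ extChartAt 𝓘(ℝ, E) x₀ (F q.1 q.2))
      (fun q ↦ coords x₀ (F q.1 q.2) (V q.1 q.2)) ξ (i r) := by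
  have h2 := ((hV (i r) (hI hr) _ hs).differentiableWithinAt
    (by simp)).hasFDerivWithinAt.comp_hasDerivWithinAt r hi hI
  rw [(isDiffField_of_hasDerivWithinAt (γ := fun t ↦ F (i t).1 (i t).2) hs hu
    (hF.mdifferentiableWithinAt_comp hi hI hr) h2).2,
    hF.coords_velocity_comp hi hI hr hu hs]
  rfl

/-- The covariant derivative in the first parameter of a field along a two-parameter family. -/
def covDerivLeft (F : ℝ → ℝ → M) (J : Set ℝ) (V : Π t s : ℝ, TangentSpace 𝓘(ℝ, E) (F t s))
    (t s : ℝ) : TangentSpace 𝓘(ℝ, E) (F t s) :=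
  covDeriv (fun t ↦ F t s) J (fun t ↦ V t s) t

/-- The covariant derivative in the second parameter of a field along a two-parameter family. -/
def covDerivRight (F : ℝ → ℝ → M) (S : Set ℝ) (V : Π t s : ℝ, TangentSpace 𝓘(ℝ, E) (F t s))
    (t s : ℝ) : TangentSpace 𝓘(ℝ, E) (F t s) :=
  covDeriv (F t) S (V t) s

variable {t s : ℝ}

theorem hasDerivWithinAt_mk_left (s t : ℝ) (J : Set ℝ) :
    HasDerivWithinAt (fun t : ℝ ↦ (t, s)) ((1, 0) : ℝ × ℝ) J t :=
  (hasDerivWithinAt_id t J).prodMk (hasDerivWithinAt_const t J s)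

theorem hasDerivWithinAt_mk_right (t s : ℝ) (S : Set ℝ) :
    HasDerivWithinAt (fun s : ℝ ↦ (t, s)) ((0, 1) : ℝ × ℝ) S s :=
  (hasDerivWithinAt_const s S t).prodMk (hasDerivWithinAt_id s S)

theorem mapsTo_mk_left (hs : s ∈ S) : MapsTo (fun t : ℝ ↦ (t, s)) J (J ×ˢ S) :=
  fun _ ht ↦ ⟨ht, hs⟩

theorem mapsTo_mk_right (ht : t ∈ J) : MapsTo (fun s : ℝ ↦ (t, s)) S (J ×ˢ S) :=
  fun _ hs ↦ ⟨ht, hs⟩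

theorem IsSmoothField.isDiffField_left (hV : IsSmoothField F J S V) (hF : IsSmoothFamily E F J S)
    (ht : t ∈ J) (hs : s ∈ S) : IsDiffField (fun t ↦ F t s) J (fun t ↦ V t s) t :=
  hV.isDiffField_comp hF (hasDerivWithinAt_mk_left s t J) (mapsTo_mk_left hs) ht

theorem IsSmoothField.isDiffField_right (hV : IsSmoothField F J S V) (hF : IsSmoothFamily E F J S)
    (ht : t ∈ J) (hs : s ∈ S) : IsDiffField (F t) S (V t) s :=
  hV.isDiffField_comp hF (hasDerivWithinAt_mk_right t s S) (mapsTo_mk_right ht) hs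

theorem IsSmoothFamily.coords_velocityLeft (hF : IsSmoothFamily E F J S) (hq : q ∈ J ×ˢ S)
    (hs : F q.1 q.2 ∈ (chartAt E x₀).source) :
    coords x₀ (F q.1 q.2) (velocityLeft F J q.1 q.2) =
      fderivWithin ℝ (fun q : ℝ × ℝ ↦ extChartAt 𝓘(ℝ, E) x₀ (F q.1 q.2)) (J ×ˢ S) q (1, 0) :=
  hF.coords_velocity_comp (hasDerivWithinAt_mk_left q.2 q.1 J) (mapsTo_mk_left hq.2) hq.1
    (hF.left _ hq.1) hs

theorem IsSmoothFamily.coords_velocityRight (hF : IsSmoothFamily E F J S) (hq : q ∈ J ×ˢ S)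
    (hs : F q.1 q.2 ∈ (chartAt E x₀).source) :
    coords x₀ (F q.1 q.2) (velocityRight F S q.1 q.2) =
      fderivWithin ℝ (fun q : ℝ × ℝ ↦ extChartAt 𝓘(ℝ, E) x₀ (F q.1 q.2)) (J ×ˢ S) q (0, 1) :=
  hF.coords_velocity_comp (hasDerivWithinAt_mk_right q.1 q.2 S) (mapsTo_mk_right hq.1) hq.2
    (hF.right _ hq.2) hs

theorem IsSmoothField.coords_covDerivLeft (hV : IsSmoothField F J S V)
    (hF : IsSmoothFamily E F J S) (hq : q ∈ J ×ˢ S) (hs : F q.1 q.2 ∈ (chartAt E x₀).source) :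
    coords x₀ (F q.1 q.2) (covDerivLeft F J V q.1 q.2) =
    chartCovDeriv (chartChristoffel x₀) (J ×ˢ S) (fun q ↦ extChartAt 𝓘(ℝ, E) x₀ (F q.1 q.2))
      (fun q ↦ coords x₀ (F q.1 q.2) (V q.1 q.2)) (1, 0) q :=
  hV.coords_covDeriv_comp hF (hasDerivWithinAt_mk_left q.2 q.1 J) (mapsTo_mk_left hq.2) hq.1
    (hF.left _ hq.1) hs

theorem IsSmoothField.coords_covDerivRight (hV : IsSmoothField F J S V)
    (hF : IsSmoothFamily E F J S) (hq : q ∈ J ×ˢ S) (hs : F q.1 q.2 ∈ (chartAt E x₀).source) :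
    coords x₀ (F q.1 q.2) (covDerivRight F S V q.1 q.2) =
    chartCovDeriv (chartChristoffel x₀) (J ×ˢ S) (fun q ↦ extChartAt 𝓘(ℝ, E) x₀ (F q.1 q.2))
      (fun q ↦ coords x₀ (F q.1 q.2) (V q.1 q.2)) (0, 1) q :=
  hV.coords_covDeriv_comp hF (hasDerivWithinAt_mk_right q.1 q.2 S) (mapsTo_mk_right hq.1) hq.2
    (hF.right _ hq.2) hs

/-- A field is smooth as soon as its coordinates agree with smooth functions. -/
theorem IsSmoothFamily.isSmoothField_of_eq (hF : IsSmoothFamily E F J S) (v : M → ℝ × ℝ → E)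
    (hv : ∀ q ∈ J ×ˢ S, ∀ x₀ : M, F q.1 q.2 ∈ (chartAt E x₀).source →
      ContDiffWithinAt ℝ ∞ (v x₀) (J ×ˢ S) q ∧ coords x₀ (F q.1 q.2) (V q.1 q.2) = v x₀ q) :
    IsSmoothField F J S V := by
  intro q hq x₀ hs
  refine (hv q hq x₀ hs).1.congr_of_eventuallyEq ?_ (hv q hq x₀ hs).2
  filter_upwards [hF.eventually_mem_source hq hs] with r hr using (hv r hr.1 x₀ hr.2).2

theorem contDiffWithinAt_fderivWithin_apply {f : ℝ × ℝ → E} {Ω : Set (ℝ × ℝ)}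
    (hΩ : UniqueDiffOn ℝ Ω) (hq : q ∈ Ω) (hf : ContDiffWithinAt ℝ ∞ f Ω q) (ξ : ℝ × ℝ) :
    ContDiffWithinAt ℝ ∞ (fun q ↦ fderivWithin ℝ f Ω q ξ) Ω q :=
  (hf.fderivWithin_right hΩ (by simp) hq).clm_apply contDiffWithinAt_const

theorem IsSmoothFamily.isSmoothField_velocityLeft (hF : IsSmoothFamily E F J S) :
    IsSmoothField F J S (velocityLeft (E := E) F J) :=
  hF.isSmoothField_of_eq _ fun _ hq _ hs ↦ ⟨contDiffWithinAt_fderivWithin_apply hF.uniqueDiffOn hq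
    (hF.contDiffWithinAt hq hs) (1, 0), hF.coords_velocityLeft hq hs⟩

theorem IsSmoothFamily.isSmoothField_velocityRight (hF : IsSmoothFamily E F J S) :
    IsSmoothField F J S (velocityRight (E := E) F S) :=
  hF.isSmoothField_of_eq _ fun _ hq _ hs ↦ ⟨contDiffWithinAt_fderivWithin_apply hF.uniqueDiffOn hq
    (hF.contDiffWithinAt hq hs) (0, 1), hF.coords_velocityRight hq hs⟩

theorem contDiffAt_chartChristoffel {y : M} (hy : y ∈ (chartAt E x₀).source) :
    ContDiffAt ℝ ∞ (chartChristoffel x₀) (extChartAt 𝓘(ℝ, E) x₀ y) :=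
  (isLocalLeviCivita_chart x₀).contDiffAt (extChartAt_mem_target hy)

theorem IsSmoothField.contDiffWithinAt_chartCovDeriv (hV : IsSmoothField F J S V)
    (hF : IsSmoothFamily E F J S) (hq : q ∈ J ×ˢ S) (hs : F q.1 q.2 ∈ (chartAt E x₀).source)
    (ξ : ℝ × ℝ) :
    ContDiffWithinAt ℝ ∞ (chartCovDeriv (chartChristoffel x₀) (J ×ˢ S)
      (fun q ↦ extChartAt 𝓘(ℝ, E) x₀ (F q.1 q.2))
      (fun q ↦ coords x₀ (F q.1 q.2) (V q.1 q.2)) ξ) (J ×ˢ S) q := by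
  have hv := hV q hq x₀ hs
  have hf := hF.contDiffWithinAt hq hs
  exact (contDiffWithinAt_fderivWithin_apply hF.uniqueDiffOn hq hv ξ).add
    ((((contDiffAt_chartChristoffel hs).comp_contDiffWithinAt q hf).clm_apply
      (contDiffWithinAt_fderivWithin_apply hF.uniqueDiffOn hq hf ξ)).clm_apply hv)

theorem IsSmoothField.covDerivLeft (hV : IsSmoothField F J S V) (hF : IsSmoothFamily E F J S) :
    IsSmoothField F J S (covDerivLeft F J V) :=
  hF.isSmoothField_of_eq _ fun _ hq _ hs ↦
    ⟨hV.contDiffWithinAt_chartCovDeriv hF hq hs (1, 0), hV.coords_covDerivLeft hF hq hs⟩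

theorem IsSmoothField.covDerivRight (hV : IsSmoothField F J S V) (hF : IsSmoothFamily E F J S) :
    IsSmoothField F J S (covDerivRight F S V) :=
  hF.isSmoothField_of_eq _ fun _ hq _ hs ↦
    ⟨hV.contDiffWithinAt_chartCovDeriv hF hq hs (0, 1), hV.coords_covDerivRight hF hq hs⟩

theorem IsSmoothField.curvature (hU : IsSmoothField F J S U) (hV : IsSmoothField F J S V)
    (hW : IsSmoothField F J S W) (hF : IsSmoothFamily E F J S) :
    IsSmoothField F J S (fun t s ↦ curvature (F t s) (U t s) (V t s) (W t s)) := by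
  refine hF.isSmoothField_of_eq (fun x₀ q ↦ chartCurvature (chartChristoffel x₀)
    (extChartAt 𝓘(ℝ, E) x₀ (F q.1 q.2)) (coords x₀ (F q.1 q.2) (U q.1 q.2))
    (coords x₀ (F q.1 q.2) (V q.1 q.2)) (coords x₀ (F q.1 q.2) (W q.1 q.2)))
    fun q hq x₀ hs ↦ ⟨?_, coords_curvature hs _ _ _⟩
  have hG := isLocalLeviCivita_chart x₀ (E := E)
  have hR : ContDiffAt ℝ ∞ (chartCurvature (chartChristoffel x₀))
      (extChartAt 𝓘(ℝ, E) x₀ (F q.1 q.2)) :=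
    (contDiffOn_chartCurvature hG.isOpen hG.contDiffOn).contDiffAt
      (hG.isOpen.mem_nhds (extChartAt_mem_target hs))
  exact (((hR.comp_contDiffWithinAt q (hF.contDiffWithinAt hq hs)).clm_apply
    (hU q hq x₀ hs)).clm_apply (hV q hq x₀ hs)).clm_apply (hW q hq x₀ hs)

theorem IsSmoothField.continuousOn_inner (hV : IsSmoothField F J S V) (hW : IsSmoothField F J S W)
    (hF : IsSmoothFamily E F J S) :
    ContinuousOn (fun q : ℝ × ℝ ↦ inner ℝ (V q.1 q.2) (W q.1 q.2)) (J ×ˢ S) := by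
  intro q hq
  have hs := mem_chart_source E (F q.1 q.2)
  have hg := (isLocalLeviCivita_chart (F q.1 q.2)).contDiffAt_metric (extChartAt_mem_target hs)
  have h1 := (((hg.comp_contDiffWithinAt q (hF.contDiffWithinAt hq hs)).clm_apply
    (hV q hq _ hs)).clm_apply (hW q hq _ hs)).continuousWithinAt
  refine h1.congr_of_eventuallyEq ?_ (chartMetric_coords hs _ _).symm
  filter_upwards [hF.eventually_mem_source hq hs] with r hr
  exact (chartMetric_coords hr.2 _ _).symm

theorem IsSmoothFamily.isSymmSndFDerivWithinAt (hF : IsSmoothFamily E F J S) (hq : q ∈ J ×ˢ S)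
    {v : ℝ × ℝ → E} (hv : ContDiffWithinAt ℝ ∞ v (J ×ˢ S) q) :
    IsSymmSndFDerivWithinAt ℝ v (J ×ˢ S) q :=
  hv.isSymmSndFDerivWithinAt minSmoothness_two_le_infty hF.uniqueDiffOn (hF.subset_closure hq) hq

theorem hasFDerivWithinAt_fderivWithin_apply {Ω : Set (ℝ × ℝ)} (hΩ : UniqueDiffOn ℝ Ω)
    (hq : q ∈ Ω) {v : ℝ × ℝ → E} (hv : ContDiffWithinAt ℝ ∞ v Ω q) (ξ : ℝ × ℝ) :
    HasFDerivWithinAt (fun q ↦ fderivWithin ℝ v Ω q ξ)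
      ((fderivWithin ℝ (fderivWithin ℝ v Ω) Ω q).flip ξ) Ω q := by
  have h := ((hv.fderivWithin_right (m := 1) hΩ one_add_one_le_infty hq).differentiableWithinAt
    (by simp)).hasFDerivWithinAt.clm_apply (hasFDerivWithinAt_const ξ q Ω)
  refine h.congr_fderiv ?_
  ext <;> simp

/-- Equality of mixed second derivatives: `∇_t ∂_s F = ∇_s ∂_t F`, as the connection has no
torsion. -/
theorem IsSmoothFamily.covDerivLeft_velocityRight (hF : IsSmoothFamily E F J S)
    (ht : t ∈ J) (hs : s ∈ S) :
    PBiharmonic.covDerivLeft F J (velocityRight (E := E) F S) t s =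
      PBiharmonic.covDerivRight F S (velocityLeft (E := E) F J) t s := by
  have hx := mem_chart_source E (F t s)
  have hq : (t, s) ∈ J ×ˢ S := ⟨ht, hs⟩
  have hf := hF.contDiffWithinAt hq hx
  have hΩ := hF.uniqueDiffOn
  refine coords_injective hx ?_
  rw [hF.isSmoothField_velocityRight.coords_covDerivLeft hF hq hx,
    hF.isSmoothField_velocityLeft.coords_covDerivRight hF hq hx, chartCovDeriv, chartCovDeriv,
    hF.coords_velocityRight hq hx, hF.coords_velocityLeft hq hx]
  have h1 : (fun q : ℝ × ℝ ↦ coords (F t s) (F q.1 q.2) (velocityRight F S q.1 q.2))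
      =ᶠ[𝓝[J ×ˢ S] (t, s)] fun q ↦ fderivWithin ℝ
        (fun q : ℝ × ℝ ↦ extChartAt 𝓘(ℝ, E) (F t s) (F q.1 q.2)) (J ×ˢ S) q (0, 1) := by
    filter_upwards [hF.eventually_mem_source hq hx] with r hr
      using hF.coords_velocityRight hr.1 hr.2
  have h2 : (fun q : ℝ × ℝ ↦ coords (F t s) (F q.1 q.2) (velocityLeft F J q.1 q.2))
      =ᶠ[𝓝[J ×ˢ S] (t, s)] fun q ↦ fderivWithin ℝ
        (fun q : ℝ × ℝ ↦ extChartAt 𝓘(ℝ, E) (F t s) (F q.1 q.2)) (J ×ˢ S) q (1, 0) := by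
    filter_upwards [hF.eventually_mem_source hq hx] with r hr
      using hF.coords_velocityLeft hr.1 hr.2
  rw [h1.fderivWithin_eq_of_mem hq, h2.fderivWithin_eq_of_mem hq,
    (hasFDerivWithinAt_fderivWithin_apply hΩ hq hf _).fderivWithin (hΩ _ hq),
    (hasFDerivWithinAt_fderivWithin_apply hΩ hq hf _).fderivWithin (hΩ _ hq),
    (isLocalLeviCivita_chart (F t s)).symm _ (extChartAt_mem_target hx)]
  congr 1
  exact hF.isSymmSndFDerivWithinAt hq hf _ _

/-- The derivative in the direction `ζ` of the coordinates of the covariant derivative in the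
direction `ξ`. -/
theorem IsSmoothFamily.fderivWithin_chartCovDeriv (hF : IsSmoothFamily E F J S)
    (hV : IsSmoothField F J S V) (hq : q ∈ J ×ˢ S) (hs : F q.1 q.2 ∈ (chartAt E x₀).source)
    (ξ ζ : ℝ × ℝ) {Γ : E → E →L[ℝ] E →L[ℝ] E} (hΓ : Γ = chartChristoffel x₀)
    {f v : ℝ × ℝ → E} (hf : f = fun q ↦ extChartAt 𝓘(ℝ, E) x₀ (F q.1 q.2))
    (hv : v = fun q ↦ coords x₀ (F q.1 q.2) (V q.1 q.2)) :
    fderivWithin ℝ (chartCovDeriv Γ (J ×ˢ S) f v ξ) (J ×ˢ S) q ζ =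
      fderivWithin ℝ (fderivWithin ℝ v (J ×ˢ S)) (J ×ˢ S) q ζ ξ
      + (fderiv ℝ Γ (f q) (fderivWithin ℝ f (J ×ˢ S) q ζ) (fderivWithin ℝ f (J ×ˢ S) q ξ) (v q)
        + Γ (f q) (fderivWithin ℝ (fderivWithin ℝ f (J ×ˢ S)) (J ×ˢ S) q ζ ξ) (v q)
        + Γ (f q) (fderivWithin ℝ f (J ×ˢ S) q ξ) (fderivWithin ℝ v (J ×ˢ S) q ζ)) := by
  have hΩ := hF.uniqueDiffOn
  have hf' : ContDiffWithinAt ℝ ∞ f (J ×ˢ S) q := hf ▸ hF.contDiffWithinAt hq hs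
  have hv' : ContDiffWithinAt ℝ ∞ v (J ×ˢ S) q := hv ▸ hV q hq x₀ hs
  have hΓ' : DifferentiableAt ℝ Γ (f q) := by
    rw [hΓ, hf]
    exact (contDiffAt_chartChristoffel hs).differentiableAt (by simp)
  have h1 := (hasFDerivWithinAt_fderivWithin_apply hΩ hq hv' ξ).add
    (((hΓ'.hasFDerivAt.comp_hasFDerivWithinAt q
      (hf'.differentiableWithinAt (by simp)).hasFDerivWithinAt).clm_apply
      (hasFDerivWithinAt_fderivWithin_apply hΩ hq hf' ξ)).clm_apply
      (hv'.differentiableWithinAt (by simp)).hasFDerivWithinAt)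
  have h2 := h1.fderivWithin (hΩ _ hq)
  have h3 := DFunLike.congr_fun h2 ζ
  refine Eq.trans h3 ?_
  simp
  abel

/-- The commutator of covariant derivatives is curvature:
`∇_t ∇_s V - ∇_s ∇_t V = R(∂_t F, ∂_s F) V`. -/
theorem IsSmoothField.covDerivLeft_covDerivRight (hV : IsSmoothField F J S V)
    (hF : IsSmoothFamily E F J S) (ht : t ∈ J) (hs : s ∈ S) :
    PBiharmonic.covDerivLeft F J (PBiharmonic.covDerivRight F S V) t s =
      PBiharmonic.covDerivRight F S (PBiharmonic.covDerivLeft F J V) t s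
      + PBiharmonic.curvature (F t s) (velocityLeft F J t s) (velocityRight F S t s) (V t s) := by
  have hx := mem_chart_source E (F t s)
  have hq : (t, s) ∈ J ×ˢ S := ⟨ht, hs⟩
  have hΩ := hF.uniqueDiffOn
  refine coords_injective hx ?_
  rw [map_add, (hV.covDerivRight hF).coords_covDerivLeft hF hq hx,
    (hV.covDerivLeft hF).coords_covDerivRight hF hq hx, coords_curvature hx,
    hF.coords_velocityRight hq hx, hF.coords_velocityLeft hq hx]
  set Γ := chartChristoffel (E := E) (F t s) with hΓ
  set f : ℝ × ℝ → E := fun q ↦ extChartAt 𝓘(ℝ, E) (F t s) (F q.1 q.2) with hf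
  set v : ℝ × ℝ → E := fun q ↦ coords (F t s) (F q.1 q.2) (V q.1 q.2) with hv
  have h1 : (fun q : ℝ × ℝ ↦ coords (F t s) (F q.1 q.2)
      (PBiharmonic.covDerivRight F S V q.1 q.2)) =ᶠ[𝓝[J ×ˢ S] (t, s)]
      chartCovDeriv Γ (J ×ˢ S) f v (0, 1) := by
    filter_upwards [hF.eventually_mem_source hq hx] with r hr
      using hV.coords_covDerivRight hF hr.1 hr.2
  have h2 : (fun q : ℝ × ℝ ↦ coords (F t s) (F q.1 q.2)
      (PBiharmonic.covDerivLeft F J V q.1 q.2)) =ᶠ[𝓝[J ×ˢ S] (t, s)]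
      chartCovDeriv Γ (J ×ˢ S) f v (1, 0) := by
    filter_upwards [hF.eventually_mem_source hq hx] with r hr
      using hV.coords_covDerivLeft hF hr.1 hr.2
  have h3 := hF.isSymmSndFDerivWithinAt hq (hF.contDiffWithinAt hq hx) (1, 0) (0, 1)
  have h4 := hF.isSymmSndFDerivWithinAt hq (hV (t, s) hq _ hx) (1, 0) (0, 1)
  rw [← hf] at h3
  rw [← hv] at h4
  rw [chartCovDeriv, chartCovDeriv, h1.fderivWithin_eq_of_mem hq, h2.fderivWithin_eq_of_mem hq,
    h1.eq_of_nhdsWithin hq, h2.eq_of_nhdsWithin hq,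
    hF.fderivWithin_chartCovDeriv hV hq hx _ _ hΓ hf hv,
    hF.fderivWithin_chartCovDeriv hV hq hx _ _ hΓ hf hv, h3, h4, chartCurvature_apply]
  simp only [chartCovDeriv, map_add]
  abel

end Derivatives

end Families

/-! ### Variations of the tension field -/

section Variation

variable {E : Type*} [NormedAddCommGroup E] [NormedSpace ℝ E] [FiniteDimensional ℝ E]
  {M : Type*} [TopologicalSpace M] [ChartedSpace E M] [IsManifold 𝓘(ℝ, E) ∞ M]
  [RiemannianBundle (fun x : M ↦ TangentSpace 𝓘(ℝ, E) x)]
  [IsContMDiffRiemannianBundle 𝓘(ℝ, E) ∞ E (fun x : M ↦ TangentSpace 𝓘(ℝ, E) x)]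
  {F : ℝ → ℝ → M} {J S : Set ℝ} {t s : ℝ}

variable (E) in
/-- The tension fields of the curves `F t`, as a field along the family. -/
def tensionField (F : ℝ → ℝ → M) (S : Set ℝ) (t s : ℝ) : TangentSpace 𝓘(ℝ, E) (F t s) :=
  tension (F t) S s

variable (E) in
/-- The acceleration of the transversal curves `t ↦ F t s`. -/
def accelerationLeft (F : ℝ → ℝ → M) (J : Set ℝ) : Π t s : ℝ, TangentSpace 𝓘(ℝ, E) (F t s) :=
  covDerivLeft F J (velocityLeft F J)

namespace IsSmoothFamily

theorem isSmoothField_tensionField (hF : IsSmoothFamily E F J S) :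
    IsSmoothField F J S (tensionField E F S) :=
  hF.isSmoothField_velocityRight.covDerivRight hF

theorem isSmoothField_accelerationLeft (hF : IsSmoothFamily E F J S) :
    IsSmoothField F J S (accelerationLeft E F J) :=
  hF.isSmoothField_velocityLeft.covDerivLeft hF

/-- The Jacobi operator as the first variation of the tension field. -/
theorem covDerivLeft_tensionField (hF : IsSmoothFamily E F J S) (ht : t ∈ J) (hs : s ∈ S) :
    covDerivLeft F J (tensionField E F S) t s =
      covDerivRight F S (covDerivRight F S (velocityLeft F J)) t s
      + curvature (F t s) (velocityLeft F J t s) (velocityRight F S t s)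
        (velocityRight F S t s) := by
  have h1 := hF.isSmoothField_velocityRight.covDerivLeft_covDerivRight hF ht hs
  refine h1.trans ?_
  congr 1
  refine covDeriv_congr ?_ (hF.covDerivLeft_velocityRight ht hs)
  filter_upwards [self_mem_nhdsWithin] with r hr using hF.covDerivLeft_velocityRight ht hr

/-- The second variation of the tension field, by `∇_t ∇_s = ∇_s ∇_t + R(H, T)`, used twice, and the
product rule for `R(H, T)T`. -/
theorem covDerivLeft_covDerivLeft_tensionField (hF : IsSmoothFamily E F J S) (ht : t ∈ J)
    (hs : s ∈ S) :
    covDerivLeft F J (covDerivLeft F J (tensionField E F S)) t s =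
      covDerivRight F S (covDerivRight F S (accelerationLeft E F J)) t s
      + covDerivRight F S (fun t s ↦ curvature (F t s) (velocityLeft F J t s)
          (velocityRight F S t s) (velocityLeft F J t s)) t s
      + curvature (F t s) (velocityLeft F J t s) (velocityRight F S t s)
          (covDerivRight F S (velocityLeft F J) t s)
      + (nablaCurvature (F t s) (velocityLeft F J t s) (velocityLeft F J t s)
          (velocityRight F S t s) (velocityRight F S t s)
        + curvature (F t s) (accelerationLeft E F J t s) (velocityRight F S t s)
          (velocityRight F S t s)
        + curvature (F t s) (velocityLeft F J t s) (covDerivRight F S (velocityLeft F J) t s)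
          (velocityRight F S t s)
        + curvature (F t s) (velocityLeft F J t s) (velocityRight F S t s)
          (covDerivRight F S (velocityLeft F J) t s)) := by
  have hH := hF.isSmoothField_velocityLeft
  have hT := hF.isSmoothField_velocityRight
  have hDH := hH.covDerivRight hF
  have h1 : covDerivLeft F J (covDerivLeft F J (tensionField E F S)) t s =
      covDerivLeft F J (fun t s ↦ covDerivRight F S (covDerivRight F S (velocityLeft F J)) t s
      + curvature (F t s) (velocityLeft F J t s) (velocityRight F S t s)
        (velocityRight F S t s)) t s := by
    refine covDeriv_congr ?_ (hF.covDerivLeft_tensionField ht hs)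
    filter_upwards [self_mem_nhdsWithin] with r hr using hF.covDerivLeft_tensionField hr hs
  have h2 := (covDeriv_add (hF.left t ht) ((hDH.covDerivRight hF).isDiffField_left hF ht hs)
    ((hH.curvature hT hT hF).isDiffField_left hF ht hs)).2
  have h3 := hDH.covDerivLeft_covDerivRight hF ht hs
  have h4 : covDerivRight F S (covDerivLeft F J (covDerivRight F S (velocityLeft F J))) t s =
      covDerivRight F S (fun t s ↦ covDerivRight F S (accelerationLeft E F J) t s
        + curvature (F t s) (velocityLeft F J t s) (velocityRight F S t s)
          (velocityLeft F J t s)) t s := by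
    refine covDeriv_congr ?_ (hH.covDerivLeft_covDerivRight hF ht hs)
    filter_upwards [self_mem_nhdsWithin] with r hr using hH.covDerivLeft_covDerivRight hF ht hr
  have h5 := (covDeriv_add (hF.right s hs)
    ((hF.isSmoothField_accelerationLeft.covDerivRight hF).isDiffField_right hF ht hs)
    ((hH.curvature hT hH hF).isDiffField_right hF ht hs)).2
  have h6 := (covDeriv_curvature (hF.left t ht) (hH.isDiffField_left hF ht hs)
    (hT.isDiffField_left hF ht hs) (hT.isDiffField_left hF ht hs)).2
  have h7 := hF.covDerivLeft_velocityRight ht hs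
  refine h1.trans (h2.trans ?_)
  refine congrArg₂ (· + ·) (h3.trans ?_) (h6.trans ?_)
  · exact congrArg (· + _) (h4.trans h5)
  · change _ + _ + curvature (F t s) (velocityLeft F J t s)
      (covDerivLeft F J (velocityRight F S) t s) (velocityRight F S t s)
      + curvature (F t s) (velocityLeft F J t s) (velocityRight F S t s)
      (covDerivLeft F J (velocityRight F S) t s) = _
    rw [h7]
    rfl

end IsSmoothFamily

/-- The derivative in `t` of `|τ|^p`, divided by `p`. It is `⟨∇_t τ, |τ|^{p-2} τ⟩`, and
so equals `0` at zeros of `τ`. -/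
def energyDensityDeriv (p : ℝ) (F : ℝ → ℝ → M) (J S : Set ℝ) (t s : ℝ) : ℝ :=
  ‖tensionField E F S t s‖ ^ (p - 2)
    * inner ℝ (covDerivLeft F J (tensionField E F S) t s) (tensionField E F S t s)

variable (E) in
/-- The second derivative in `t` of `|τ|^p`, divided by `p`. At zeros of `τ` the last summand is `0`,
whatever the value of `|τ|^{p-4}`. -/
def energyDensityDerivTwo (p : ℝ) (F : ℝ → ℝ → M) (J S : Set ℝ) (t s : ℝ) : ℝ :=
  ‖tensionField E F S t s‖ ^ (p - 2)
    * (inner ℝ (covDerivLeft F J (covDerivLeft F J (tensionField E F S)) t s)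
        (tensionField E F S t s)
      + inner ℝ (covDerivLeft F J (tensionField E F S) t s)
        (covDerivLeft F J (tensionField E F S) t s))
  + (p - 2) * (‖tensionField E F S t s‖ ^ (p - 4)
    * (inner ℝ (covDerivLeft F J (tensionField E F S) t s) (tensionField E F S t s)
      * inner ℝ (covDerivLeft F J (tensionField E F S) t s) (tensionField E F S t s)))

theorem hasDerivWithinAt_rpow_norm {γ : ℝ → M} {V : Π s : ℝ, TangentSpace 𝓘(ℝ, E) (γ s)}
    {p : ℝ} (hV : IsDiffField γ S V s) (hp : 2 ≤ p ∨ V s ≠ 0) :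
    HasDerivWithinAt (fun r ↦ ‖V r‖ ^ p)
      (p * (‖V s‖ ^ (p - 2) * inner ℝ (covDeriv γ S V s) (V s))) S s := by
  -- `|V|^p` is the power `p / 2` of the differentiable function `⟨V, V⟩`
  have hp' : (inner ℝ (V s) (V s) : ℝ) ≠ 0 ∨ 1 ≤ p / 2 :=
    hp.symm.imp (fun h ↦ inner_self_ne_zero.2 h) (fun h ↦ by linarith)
  have h1 := (hasDerivWithinAt_inner hV hV).rpow_const hp'
  refine (h1.congr (fun r _ ↦ rpow_norm_eq _ _) (rpow_norm_eq _ _)).congr_deriv ?_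
  rw [rpow_norm_eq _ (p - 2), real_inner_comm (covDeriv γ S V s),
    show p / 2 - 1 = (p - 2) / 2 by ring]
  ring

variable {p : ℝ}

theorem IsSmoothFamily.hasDerivWithinAt_rpow_tensionField (hF : IsSmoothFamily E F J S)
    (ht : t ∈ J) (hs : s ∈ S) (hp : 2 ≤ p ∨ tensionField E F S t s ≠ 0) :
    HasDerivWithinAt (fun t ↦ ‖tensionField E F S t s‖ ^ p)
      (p * energyDensityDeriv (E := E) p F J S t s) J t :=
  hasDerivWithinAt_rpow_norm (hF.isSmoothField_tensionField.isDiffField_left hF ht hs) hp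

theorem IsSmoothFamily.hasDerivWithinAt_energyDensityDeriv (hF : IsSmoothFamily E F J S)
    (ht : t ∈ J) (hs : s ∈ S) (hp : 2 ≤ p ∨ tensionField E F S t s ≠ 0) :
    HasDerivWithinAt (fun t ↦ energyDensityDeriv (E := E) p F J S t s)
      (energyDensityDerivTwo E p F J S t s) J t := by
  have hτ := hF.isSmoothField_tensionField
  have h1 := covDeriv_rpow_norm_smul (hF.left t ht) (hτ.isDiffField_left hF ht hs) hp
  have h2 := hasDerivWithinAt_inner ((hτ.covDerivLeft hF).isDiffField_left hF ht hs) h1.1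
  refine (h2.congr (fun r _ ↦ ?_) ?_).congr_deriv ?_
  · rw [real_inner_smul_right]; rfl
  · rw [real_inner_smul_right]; rfl
  · rw [h1.2]
    simp only [real_inner_smul_right, inner_add_right, energyDensityDerivTwo]
    change _ * inner ℝ (covDerivLeft F J (covDerivLeft F J (tensionField E F S)) t s) _
      + (_ * inner ℝ _ (covDerivLeft F J (tensionField E F S) t s)
        + _ * (_ * inner ℝ (covDerivLeft F J (tensionField E F S) t s) _) * _) = _
    ring

end Variation

/-! ### Restriction, periodicity, and fixed end points -/

section Boundary

variable {E : Type*} [NormedAddCommGroup E] [NormedSpace ℝ E] [FiniteDimensional ℝ E]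
  {M : Type*} [TopologicalSpace M] [ChartedSpace E M] [IsManifold 𝓘(ℝ, E) ∞ M]
  [RiemannianBundle (fun x : M ↦ TangentSpace 𝓘(ℝ, E) x)]
  [IsContMDiffRiemannianBundle 𝓘(ℝ, E) ∞ E (fun x : M ↦ TangentSpace 𝓘(ℝ, E) x)]
  {γ : ℝ → M} {V : Π s : ℝ, TangentSpace 𝓘(ℝ, E) (γ s)}
  {F : ℝ → ℝ → M} {J S S' : Set ℝ} {t s : ℝ}

section Restriction

theorem velocity_subset (h : S' ⊆ S) (hS' : UniqueDiffWithinAt ℝ S' s)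
    (hγ : MDifferentiableWithinAt 𝓘(ℝ, ℝ) 𝓘(ℝ, E) γ S s) :
    velocity (E := E) γ S' s = velocity γ S s := by
  rw [velocity, mfderivWithin_subset h hS'.uniqueMDiffWithinAt hγ]
  rfl

/-- One-sided covariant derivatives agree with two-sided ones. -/
theorem IsDiffField.covDeriv_subset (hV : IsDiffField γ S V s) (h : S' ⊆ S)
    (hS' : UniqueDiffWithinAt ℝ S' s) : covDeriv γ S' V s = covDeriv γ S V s := by
  have hs := mem_chart_source E (γ s)
  refine coords_injective hs ?_
  rw [(isDiffField_of_hasDerivWithinAt hs hS' (hV.base.mono h)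
    ((hasDerivWithinAt_coords hs hV).mono h)).2, velocity_subset h hS' hV.base]
  abel

theorem IsSmoothFamily.mono (hF : IsSmoothFamily E F J S) (h : S' ⊆ S) (hS' : UniqueDiffOn ℝ S')
    (hc : J ×ˢ S' ⊆ closure (interior (J ×ˢ S'))) : IsSmoothFamily E F J S' :=
  ⟨hF.contMDiffOn.mono (prod_mono_right h), hF.left, hS', hc⟩

theorem IsSmoothFamily.mdifferentiableWithinAt_right (hF : IsSmoothFamily E F J S) (ht : t ∈ J)
    (hs : s ∈ S) : MDifferentiableWithinAt 𝓘(ℝ, ℝ) 𝓘(ℝ, E) (F t) S s :=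
  hF.mdifferentiableWithinAt_comp (hasDerivWithinAt_mk_right t s S) (mapsTo_mk_right ht) hs

theorem IsSmoothFamily.tension_subset (hF : IsSmoothFamily E F J S) (h : S' ⊆ S)
    (hS' : UniqueDiffOn ℝ S') (ht : t ∈ J) (hs : s ∈ S') :
    tension (E := E) (F t) S' s = tension (F t) S s := by
  have h1 : ∀ r ∈ S', velocity (E := E) (F t) S' r = velocity (F t) S r := fun r hr ↦
    velocity_subset h (hS' r hr) (hF.mdifferentiableWithinAt_right ht (h hr))
  have h2 : covDeriv (F t) S' (velocity (F t) S') s = covDeriv (F t) S' (velocity (F t) S) s :=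
    covDeriv_congr (eventually_mem_nhdsWithin.mono h1) (h1 s hs)
  exact h2.trans ((hF.isSmoothField_velocityRight.isDiffField_right hF ht (h hs)).covDeriv_subset
    h (hS' s hs))

end Restriction

section Periodicity

theorem velocity_comp_add_const (hγ : MDifferentiable 𝓘(ℝ, ℝ) 𝓘(ℝ, E) γ) (L s : ℝ) :
    velocity (E := E) (fun r ↦ γ (r + L)) univ s = velocity γ univ (s + L) := by
  have h1 : HasMFDerivAt 𝓘(ℝ, ℝ) 𝓘(ℝ, ℝ) (fun r : ℝ ↦ r + L) s (ContinuousLinearMap.id ℝ ℝ) :=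
    ((hasFDerivAt_id s).add_const L).hasMFDerivAt
  have h2 := (HasMFDerivAt.comp s (hγ (s + L)).hasMFDerivAt h1).mfderiv
  rw [velocity, velocity, mfderivWithin_univ, mfderivWithin_univ]
  exact DFunLike.congr_fun h2 (1 : ℝ)

theorem lift_velocity_add (hγ : MDifferentiable 𝓘(ℝ, ℝ) 𝓘(ℝ, E) γ) {L : ℝ}
    (h : ∀ s, γ (s + L) = γ s) (s : ℝ) :
    lift γ (velocity (E := E) γ univ) (s + L) = lift γ (velocity γ univ) s := by
  have h1 := lift_velocity_congr (E := E) (S := univ) (s := s) (γ₁ := fun r ↦ γ (r + L)) (γ₂ := γ)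
    (Eventually.of_forall h) (h s)
  rw [← h1, lift, lift, velocity_comp_add_const hγ]

/-- The covariant derivative of a periodic field along a periodic curve is periodic. -/
theorem lift_covDeriv_add (hγ : MDifferentiable 𝓘(ℝ, ℝ) 𝓘(ℝ, E) γ) {L : ℝ}
    (h : ∀ s, lift γ V (s + L) = lift γ V s) (s : ℝ) :
    lift γ (covDeriv γ univ V) (s + L) = lift γ (covDeriv γ univ V) s := by
  have h1 := lift_covDeriv_congr (S := univ) (s := s) (γ₁ := fun r ↦ γ (r + L)) (γ₂ := γ)
    (V₁ := fun r ↦ V (r + L)) (V₂ := V) (Eventually.of_forall h) (h s)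
  rw [← h1, lift, lift]
  have h2 : covDeriv (fun r ↦ γ (r + L)) univ (fun r ↦ V (r + L)) s =
      covDeriv γ univ V (s + L) := by
    rw [covDeriv, covDeriv, velocity_comp_add_const hγ, derivWithin_univ, derivWithin_univ]
    congr 2
    exact deriv_comp_add_const (f := fun r ↦ (trivializationAt E (TangentSpace 𝓘(ℝ, E))
      (γ (s + L)) (lift γ V r)).2) L s
  rw [h2]

end Periodicity

section Clamped

theorem eq_zero_of_lift_eq {x y : M} {v : TangentSpace 𝓘(ℝ, E) x}
    (h : (⟨x, v⟩ : TangentBundle 𝓘(ℝ, E) M) = ⟨y, (0 : TangentSpace 𝓘(ℝ, E) y)⟩) : v = 0 := by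
  cases h
  rfl

theorem velocity_eq_zero_of_const {x : M} (h : ∀ t ∈ J, γ t = x) (ht : t ∈ J) :
    velocity (E := E) γ J t = 0 := by
  refine eq_zero_of_lift_eq (y := x) ((lift_velocity_congr (E := E) (γ₂ := fun _ ↦ x)
    (eventually_mem_nhdsWithin.mono h) (h t ht)).trans ?_)
  rw [lift, velocity, mfderivWithin_const]
  rfl

/-- A field along a constant curve that is constant in the tangent bundle is parallel. -/
theorem covDeriv_eq_zero_of_const {q : TangentBundle 𝓘(ℝ, E) M} (h : ∀ t ∈ J, lift γ V t = q)
    (ht : t ∈ J) : covDeriv γ J V t = 0 := by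
  obtain ⟨x, v⟩ := q
  refine eq_zero_of_lift_eq (y := x) ((lift_covDeriv_congr (γ₂ := fun _ ↦ x) (V₂ := fun _ ↦ v)
    (eventually_mem_nhdsWithin.mono h) (h t ht)).trans ?_)
  rw [lift, covDeriv, velocity_eq_zero_of_const (x := x) (fun _ _ ↦ rfl) ht, map_zero]
  have h0 : derivWithin (fun r ↦ (trivializationAt E (TangentSpace 𝓘(ℝ, E)) x
      (lift (fun _ ↦ x) (fun _ ↦ v) r)).2) J t = 0 := by
    simp only [lift]
    exact congrFun (derivWithin_fun_const J _) t
  rw [h0, ← frame_eq_symm (mem_chart_source E x), map_zero, add_zero]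

variable {q : TangentBundle 𝓘(ℝ, E) M}

-- In the following lemmas, the point `F t s` and the velocity of `F t` at `s` do not depend on `t`.

theorem velocityLeft_eq_zero
    (h : ∀ t ∈ J, lift (F t) (velocity (E := E) (F t) S) s = q) (ht : t ∈ J) :
    velocityLeft (E := E) F J t s = 0 :=
  velocity_eq_zero_of_const (x := q.1) (fun t ht ↦ congrArg TotalSpace.proj (h t ht)) ht

theorem covDerivLeft_eq_zero_of_eq_zero {V : Π t s : ℝ, TangentSpace 𝓘(ℝ, E) (F t s)}
    (h : ∀ t ∈ J, lift (F t) (velocity (E := E) (F t) S) s = q) (hV : ∀ t ∈ J, V t s = 0)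
    (ht : t ∈ J) : covDerivLeft F J V t s = 0 := by
  refine covDeriv_eq_zero_of_const (q := ⟨q.1, (0 : TangentSpace 𝓘(ℝ, E) q.1)⟩)
    (fun r hr ↦ ?_) ht
  have h1 : F r s = q.1 := congrArg TotalSpace.proj (h r hr)
  rw [lift, hV r hr, h1]

theorem accelerationLeft_eq_zero
    (h : ∀ t ∈ J, lift (F t) (velocity (E := E) (F t) S) s = q) (ht : t ∈ J) :
    accelerationLeft E F J t s = 0 :=
  covDerivLeft_eq_zero_of_eq_zero h (fun _ hr ↦ velocityLeft_eq_zero h hr) ht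

theorem IsSmoothFamily.covDerivRight_velocityLeft_eq_zero (hF : IsSmoothFamily E F J S)
    (hs : s ∈ S) (h : ∀ t ∈ J, lift (F t) (velocity (E := E) (F t) S) s = q) (ht : t ∈ J) :
    covDerivRight F S (velocityLeft (E := E) F J) t s = 0 := by
  rw [← hF.covDerivLeft_velocityRight ht hs]
  exact covDeriv_eq_zero_of_const h ht

/-- At a fixed end, `∇_s A = ∇_t ∇_s H - R(H, T)H` vanishes together with `H` and `∇_s H`. -/
theorem IsSmoothFamily.covDerivRight_accelerationLeft_eq_zero (hF : IsSmoothFamily E F J S)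
    (hs : s ∈ S) (h : ∀ t ∈ J, lift (F t) (velocity (E := E) (F t) S) s = q) (ht : t ∈ J) :
    covDerivRight F S (accelerationLeft E F J) t s = 0 := by
  have h1 := hF.isSmoothField_velocityLeft.covDerivLeft_covDerivRight hF ht hs
  rw [covDerivLeft_eq_zero_of_eq_zero h
    (fun r hr ↦ hF.covDerivRight_velocityLeft_eq_zero hs h hr) ht,
    velocityLeft_eq_zero h ht, curvature_zero_left, add_zero] at h1
  exact h1.symm

end Clamped

end Boundary

/-! ### Continuity of singular weights and differentiation of integrals -/

section Analysis

/-- The weight `|τ|^{p-4}` is singular at zeros of `τ` if `p < 4`, but a product with two functions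
that are `O(|τ|)` is continuous for `p > 2`, and the factor `p - 2` takes care of `p = 2`. -/
theorem continuousWithinAt_rpow_sub_four {X : Type*} [TopologicalSpace X] {n α β A B : X → ℝ}
    {Ω : Set X} {x : X} {p : ℝ} (hx : x ∈ Ω) (hn : ContinuousWithinAt n Ω x)
    (hα : ContinuousWithinAt α Ω x) (hβ : ContinuousWithinAt β Ω x)
    (hA : ContinuousWithinAt A Ω x) (hB : ContinuousWithinAt B Ω x) (hn0 : ∀ y, 0 ≤ n y)
    (hαA : ∀ y ∈ Ω, |α y| ≤ A y * n y) (hβB : ∀ y ∈ Ω, |β y| ≤ B y * n y)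
    (hp : 2 ≤ p ∨ n x ≠ 0) :
    ContinuousWithinAt (fun y ↦ (p - 2) * (n y ^ (p - 4) * (α y * β y))) Ω x := by
  by_cases h0 : n x = 0
  · have hp2 : 2 ≤ p := hp.resolve_right (not_not.2 h0)
    rcases hp2.eq_or_lt with rfl | hp2
    · simpa using continuousWithinAt_const
    have hα0 : α x = 0 := by simpa [h0] using hαA x hx
    have hlim : Tendsto (fun y ↦ (p - 2) * (A y * B y * n y ^ (p - 2))) (𝓝[Ω] x) (𝓝 0) := by
      have h1 : ContinuousWithinAt (fun y ↦ (p - 2) * (A y * B y * n y ^ (p - 2))) Ω x :=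
        continuousWithinAt_const.mul ((hA.mul hB).mul (hn.rpow_const (Or.inr (by linarith))))
      have h2 := h1.tendsto
      rwa [h0, Real.zero_rpow (by linarith), mul_zero, mul_zero] at h2
    rw [ContinuousWithinAt, hα0, zero_mul, mul_zero, mul_zero]
    refine squeeze_zero_norm' ?_ hlim
    filter_upwards [self_mem_nhdsWithin] with y hy
    have h3 : n y ^ (p - 2) = n y ^ (p - 4) * (n y * n y) := by
      rcases (hn0 y).eq_or_lt with h | h
      · rw [← h, Real.zero_rpow (by linarith)]
        simp
      · rw [show p - 2 = (p - 4) + 2 by ring, Real.rpow_add h, Real.rpow_two, pow_two]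
    have h4 : 0 ≤ n y ^ (p - 4) := Real.rpow_nonneg (hn0 y) _
    rw [Real.norm_eq_abs, abs_mul, abs_mul, abs_mul, abs_of_pos (by linarith : 0 < p - 2),
      abs_of_nonneg h4, h3]
    refine mul_le_mul_of_nonneg_left ?_ (by linarith)
    calc n y ^ (p - 4) * (|α y| * |β y|)
        ≤ n y ^ (p - 4) * ((A y * n y) * (B y * n y)) :=
          mul_le_mul_of_nonneg_left (mul_le_mul (hαA y hy) (hβB y hy) (abs_nonneg _)
            ((abs_nonneg _).trans (hαA y hy))) h4
      _ = A y * B y * (n y ^ (p - 4) * (n y * n y)) := by ring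
  · exact continuousWithinAt_const.mul ((hn.rpow_const (Or.inl h0)).mul (hα.mul hβ))

/-- Differentiation under the integral sign, with continuity on a compact rectangle. -/
theorem hasDerivAt_intervalIntegral_of_continuousOn {f f' : ℝ → ℝ → ℝ} {δ a b t : ℝ} (hab : a ≤ b)
    (hf : ContinuousOn (fun q : ℝ × ℝ ↦ f q.1 q.2) (Icc (-δ) δ ×ˢ Icc a b))
    (hf' : ContinuousOn (fun q : ℝ × ℝ ↦ f' q.1 q.2) (Icc (-δ) δ ×ˢ Icc a b))
    (hd : ∀ t ∈ Ioo (-δ) δ, ∀ s ∈ Icc a b, HasDerivAt (fun t ↦ f t s) (f' t s) t)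
    (ht : t ∈ Ioo (-δ) δ) :
    HasDerivAt (fun t ↦ ∫ s in a..b, f t s) (∫ s in a..b, f' t s) t := by
  have hslice : ∀ {g : ℝ → ℝ → ℝ},
      ContinuousOn (fun q : ℝ × ℝ ↦ g q.1 q.2) (Icc (-δ) δ ×ˢ Icc a b) → ∀ r ∈ Ioo (-δ) δ,
      IntervalIntegrable (g r) volume a b := by
    intro g hg r hr
    refine ContinuousOn.intervalIntegrable_of_Icc hab ?_
    exact hg.comp (f := fun s ↦ (r, s)) (by fun_prop) fun s hs ↦ ⟨Ioo_subset_Icc_self hr, hs⟩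
  obtain ⟨C, hC⟩ := (isCompact_Icc.prod isCompact_Icc).exists_bound_of_continuousOn hf'
  have hu : uIoc a b ⊆ Icc a b := by rw [uIoc_of_le hab]; exact Ioc_subset_Icc_self
  refine (intervalIntegral.hasDerivAt_integral_of_dominated_loc_of_deriv_le (F := f) (F' := f')
    (bound := fun _ ↦ C) (Ioo_mem_nhds ht.1 ht.2) ?_ (hslice hf t ht) ?_ ?_ ?_ ?_).2
  · filter_upwards [Ioo_mem_nhds ht.1 ht.2] with r hr
    exact (intervalIntegrable_iff.1 (hslice hf r hr)).aestronglyMeasurable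
  · exact (intervalIntegrable_iff.1 (hslice hf' t ht)).aestronglyMeasurable
  · exact Eventually.of_forall fun s hs r hr ↦ hC (r, s) ⟨Ioo_subset_Icc_self hr, hu hs⟩
  · exact intervalIntegrable_const
  · exact Eventually.of_forall fun s hs r hr ↦ hd r hr s (hu hs)

/-- A tube lemma: a function without zeros on `{0} × [a, b]` has none on a rectangle around it. -/
theorem exists_rectangle_ne_zero {f : ℝ × ℝ → ℝ} {ε a b : ℝ} (hε : 0 < ε) (hab : a ≤ b)
    (hf : ContinuousOn f (Ioo (-ε) ε ×ˢ Icc a b)) (h0 : ∀ s ∈ Icc a b, f (0, s) ≠ 0) :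
    ∃ δ, 0 < δ ∧ δ < ε ∧ ∀ q ∈ Icc (-δ) δ ×ˢ Icc a b, f q ≠ 0 := by
  -- composition with the projection to `[a, b]` turns neighborhoods within the strip into full ones
  have h1 : ∀ᶠ t in 𝓝 (0 : ℝ), ∀ s ∈ Icc a b, f (t, (projIcc a b hab s : ℝ)) ≠ 0 := by
    refine isCompact_Icc.eventually_forall_of_forall_eventually fun s hs ↦ ?_
    have hm : ((0 : ℝ), s) ∈ Ioo (-ε) ε ×ˢ Icc a b := ⟨⟨by linarith, hε⟩, hs⟩
    have h2 : Tendsto (fun z : ℝ × ℝ ↦ (z.1, (projIcc a b hab z.2 : ℝ))) (𝓝 (0, s))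
        (𝓝[Ioo (-ε) ε ×ˢ Icc a b] (0, s)) := by
      refine tendsto_nhdsWithin_iff.2 ⟨?_, ?_⟩
      · have hc : Continuous fun z : ℝ × ℝ ↦ (z.1, (projIcc a b hab z.2 : ℝ)) := by fun_prop
        have h3 := hc.tendsto (0, s)
        rwa [projIcc_of_mem hab hs] at h3
      · have : ∀ᶠ z : ℝ × ℝ in 𝓝 (0, s), z.1 ∈ Ioo (-ε) ε :=
          continuousAt_fst.preimage_mem_nhds (Ioo_mem_nhds (by simpa using hε) hε)
        filter_upwards [this] with z hz using ⟨hz, (projIcc a b hab z.2).2⟩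
    exact h2.eventually ((hf _ hm).eventually_ne (h0 s hs))
  obtain ⟨r, hr, hball⟩ := Metric.eventually_nhds_iff.1 h1
  refine ⟨min r ε / 2, by positivity, ?_, fun q hq ↦ ?_⟩
  · linarith [min_le_right r ε]
  · have h2 := @hball q.1 (by
      rw [Real.dist_eq, sub_zero]
      have h3 : |q.1| ≤ min r ε / 2 := abs_le.2 hq.1
      have h4 : 0 < min r ε := by positivity
      linarith [min_le_left r ε]) q.2 hq.2
    rwa [projIcc_of_mem hab hq.2] at h2

end Analysis

/-! ### The integrands and the divergence term -/

section Formula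

variable {E : Type*} [NormedAddCommGroup E] [NormedSpace ℝ E] [FiniteDimensional ℝ E]
  {M : Type*} [TopologicalSpace M] [ChartedSpace E M] [IsManifold 𝓘(ℝ, E) ∞ M]
  [RiemannianBundle (fun x : M ↦ TangentSpace 𝓘(ℝ, E) x)]
  [IsContMDiffRiemannianBundle 𝓘(ℝ, E) ∞ E (fun x : M ↦ TangentSpace 𝓘(ℝ, E) x)]
  {F : ℝ → ℝ → M} {J S : Set ℝ} {t s p : ℝ}

theorem IsSmoothField.continuousOn_norm {V : Π t s : ℝ, TangentSpace 𝓘(ℝ, E) (F t s)}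
    (hV : IsSmoothField F J S V) (hF : IsSmoothFamily E F J S) :
    ContinuousOn (fun q : ℝ × ℝ ↦ ‖V q.1 q.2‖) (J ×ˢ S) :=
  (hV.continuousOn_inner hV hF).sqrt.congr fun _ _ ↦ norm_eq_sqrt_real_inner _

variable {K : Set (ℝ × ℝ)}

theorem IsSmoothFamily.continuousOn_energyDensityDeriv (hF : IsSmoothFamily E F J S)
    (hK : K ⊆ J ×ˢ S) (hp : 2 ≤ p ∨ ∀ q ∈ K, tensionField E F S q.1 q.2 ≠ 0) :
    ContinuousOn (fun q : ℝ × ℝ ↦ energyDensityDeriv (E := E) p F J S q.1 q.2) K := by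
  have hτ := hF.isSmoothField_tensionField
  refine ContinuousOn.mul (((hτ.continuousOn_norm hF).mono hK).rpow_const fun q hq ↦ ?_)
    (((hτ.covDerivLeft hF).continuousOn_inner hτ hF).mono hK)
  exact hp.symm.imp (fun h ↦ norm_ne_zero_iff.2 (h q hq)) (fun h ↦ by linarith)

theorem IsSmoothFamily.continuousOn_energyDensityDerivTwo (hF : IsSmoothFamily E F J S)
    (hK : K ⊆ J ×ˢ S) (hp : 2 ≤ p ∨ ∀ q ∈ K, tensionField E F S q.1 q.2 ≠ 0) :
    ContinuousOn (fun q : ℝ × ℝ ↦ energyDensityDerivTwo E p F J S q.1 q.2) K := by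
  have hτ := hF.isSmoothField_tensionField
  have hDτ := hτ.covDerivLeft hF
  refine ContinuousOn.add (ContinuousOn.mul
    (((hτ.continuousOn_norm hF).mono hK).rpow_const fun q hq ↦ ?_)
    (((((hDτ.covDerivLeft hF).continuousOn_inner hτ hF)).add
      (hDτ.continuousOn_inner hDτ hF)).mono hK)) fun q hq ↦ ?_
  · exact hp.symm.imp (fun h ↦ norm_ne_zero_iff.2 (h q hq)) (fun h ↦ by linarith)
  · have h1 := (hDτ.continuousOn_inner hτ hF).mono hK q hq
    have h2 := (hDτ.continuousOn_norm hF).mono hK q hq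
    exact continuousWithinAt_rpow_sub_four hq ((hτ.continuousOn_norm hF).mono hK q hq) h1 h1 h2 h2
      (fun _ ↦ norm_nonneg _) (fun _ _ ↦ abs_real_inner_le_norm _ _)
      (fun _ _ ↦ abs_real_inner_le_norm _ _)
      (hp.imp_right fun h ↦ norm_ne_zero_iff.2 (h q hq))

variable (E) in
/-- The divergence term of the second variation: if `F t` is `p`-biharmonic, its derivative in `s` is
the difference between the second derivative of the energy density and the sum of the ten
integrands. -/
def boundaryTerm (p : ℝ) (F : ℝ → ℝ → M) (J S : Set ℝ) (t s : ℝ) : ℝ :=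
  inner ℝ (covDerivRight F S (accelerationLeft E F J) t s) (powTension (E := E) p (F t) S s)
    - inner ℝ (accelerationLeft E F J t s) (covDeriv (F t) S (powTension (E := E) p (F t) S) s)
    + inner ℝ (curvature (F t s) (velocityLeft F J t s) (velocityRight F S t s)
        (velocityLeft F J t s)) (powTension (E := E) p (F t) S s)

section Algebra

variable {x : M} (a u v w r : TangentSpace 𝓘(ℝ, E) x)

theorem inner_nablaCurvature_swap_left :
    inner ℝ (nablaCurvature x a u v w) r = - inner ℝ (nablaCurvature x a v u w) r := by
  rw [inner_nablaCurvature_pair, inner_nablaCurvature_swap, ← inner_nablaCurvature_pair]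

/-- The pointwise identity behind the second variation formula. Here `DH`, `DDH` stand for the
covariant derivatives of the variation field `H`, `P` for the second one of the acceleration `A`,
`Q` for the first one of `R(H, T)H`, and `Z`, `DW` for the first ones of `A` and of `|τ|^{p-2} τ`;
`c` and `d` stand for `|τ|^{p-2}` and `|τ|^{p-4}`. -/
theorem secondVariation_pointwise (p c d : ℝ)
    (T τ H DH DDH A Z P Q DW : TangentSpace 𝓘(ℝ, E) x) :
    (inner ℝ P (c • τ) + inner ℝ Z DW)
      - (inner ℝ Z DW + inner ℝ A (c • curvature x T τ T))
      + (inner ℝ Q (c • τ) + inner ℝ (curvature x H T H) DW) =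
    c * (inner ℝ (P + Q + curvature x H T DH + (nablaCurvature x H H T T + curvature x A T T
        + curvature x H DH T + curvature x H T DH)) τ
      + inner ℝ (DDH + curvature x H T T) (DDH + curvature x H T T))
    + (p - 2) * (d * (inner ℝ (DDH + curvature x H T T) τ * inner ℝ (DDH + curvature x H T T) τ))
    - (inner ℝ H (curvature x H T DW)
      + -2 * (c * inner ℝ (curvature x DH τ T) H)
      + (p - 2) * (d * |inner ℝ DDH τ| ^ 2)
      + 2 * (p - 2) * (d * inner ℝ DDH τ * inner ℝ (curvature x H T T) τ)
      + c * ‖DDH‖ ^ 2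
      + 2 * (c * inner ℝ (curvature x H T T) DDH)
      + (p - 2) * (d * |inner ℝ (curvature x T τ T) H| ^ 2)
      + -(c * inner ℝ (nablaCurvature x H T τ T) H)
      + c * ‖curvature x T H T‖ ^ 2
      + -(c * inner ℝ (curvature x T τ DH) H)) := by
  have h1 : ∀ B, inner ℝ (curvature x T τ T) B = - inner ℝ (curvature x B T T) τ := fun B ↦ by
    rw [inner_curvature_pair, curvature_swap, inner_neg_left]
  have h2 : inner ℝ H (curvature x H T DW) = - inner ℝ (curvature x H T H) DW := by
    rw [real_inner_comm, inner_curvature_swap]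
  have h3 : inner ℝ (nablaCurvature x H T τ T) H = - inner ℝ (nablaCurvature x H H T T) τ := by
    rw [inner_nablaCurvature_pair, inner_nablaCurvature_swap_left]
  have h4 : inner ℝ (curvature x DH τ T) H = - inner ℝ (curvature x H T DH) τ := by
    rw [inner_curvature_swap, ← inner_curvature_pair]
  have h5 : inner ℝ (curvature x T τ DH) H = - inner ℝ (curvature x H DH T) τ := by
    rw [inner_curvature_swap, ← inner_curvature_pair]
  have h6 : ‖curvature x T H T‖ ^ 2 = inner ℝ (curvature x H T T) (curvature x H T T) := by
    rw [curvature_swap, norm_neg, real_inner_self_eq_norm_sq]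
  rw [h2, h3, h4, h5, h6, real_inner_smul_right A, real_inner_comm (curvature x T τ T) A, h1, h1,
    sq_abs, sq_abs, ← real_inner_self_eq_norm_sq DDH]
  simp only [inner_add_left, inner_add_right, real_inner_smul_right,
    real_inner_comm (curvature x H T T) DDH]
  ring

end Algebra

/-- The vector field `|τ|^{p-2} τ` satisfies the equation of `p`-biharmonic curves on `S`. -/
structure IsCritical (p : ℝ) (γ : ℝ → M) (S : Set ℝ) : Prop where
  isDiffField : ∀ s ∈ S, IsDiffField γ S (powTension (E := E) p γ S) s
  isDiffField_covDeriv : ∀ s ∈ S, IsDiffField γ S (covDeriv γ S (powTension (E := E) p γ S)) s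
  equation : ∀ s ∈ S, covDeriv γ S (covDeriv γ S (powTension (E := E) p γ S)) s =
    ‖tension (E := E) γ S s‖ ^ (p - 2) •
      curvature (γ s) (velocity γ S s) (tension γ S s) (velocity γ S s)

theorem IsSmoothFamily.hasDerivWithinAt_boundaryTerm (hF : IsSmoothFamily E F J S) (ht : t ∈ J)
    (hs : s ∈ S) (hc : IsCritical (E := E) p (F t) S) :
    HasDerivWithinAt (boundaryTerm E p F J S t) (energyDensityDerivTwo E p F J S t s
      - ∑ i, secondVariationIntegrand (E := E) p (F t) S (velocityLeft F J t) i s) S s := by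
  have hA := hF.isSmoothField_accelerationLeft
  have hH := hF.isSmoothField_velocityLeft
  have hT := hF.isSmoothField_velocityRight
  have h1 := hasDerivWithinAt_inner ((hA.covDerivRight hF).isDiffField_right hF ht hs)
    (hc.isDiffField s hs)
  have h2 := hasDerivWithinAt_inner (hA.isDiffField_right hF ht hs)
    (hc.isDiffField_covDeriv s hs)
  have h3 := hasDerivWithinAt_inner ((hH.curvature hT hH hF).isDiffField_right hF ht hs)
    (hc.isDiffField s hs)
  refine ((h1.sub h2).add h3).congr_deriv ?_
  rw [hc.equation s hs]
  have h4 := secondVariation_pointwise p (‖tensionField E F S t s‖ ^ (p - 2))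
    (‖tensionField E F S t s‖ ^ (p - 4)) (velocityRight F S t s) (tensionField E F S t s)
    (velocityLeft F J t s) (covDerivRight F S (velocityLeft F J) t s)
    (covDerivRight F S (covDerivRight F S (velocityLeft F J)) t s) (accelerationLeft E F J t s)
    (covDerivRight F S (accelerationLeft E F J) t s)
    (covDerivRight F S (covDerivRight F S (accelerationLeft E F J)) t s)
    (covDerivRight F S (fun t s ↦ curvature (F t s) (velocityLeft F J t s)
          (velocityRight F S t s) (velocityLeft F J t s)) t s)
    (covDeriv (F t) S (powTension p (F t) S) s)
  refine h4.trans ?_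
  rw [energyDensityDerivTwo, hF.covDerivLeft_covDerivLeft_tensionField ht hs,
    hF.covDerivLeft_tensionField ht hs]
  congr 1
  simp only [Fin.sum_univ_succ, Fin.sum_univ_zero, add_zero, ← add_assoc]
  rfl

end Formula

/-! ### Continuity of the integrands -/

section Continuity

variable {E : Type*} [NormedAddCommGroup E] [NormedSpace ℝ E] [FiniteDimensional ℝ E]
  {M : Type*} [TopologicalSpace M] [ChartedSpace E M] [IsManifold 𝓘(ℝ, E) ∞ M]
  [RiemannianBundle (fun x : M ↦ TangentSpace 𝓘(ℝ, E) x)]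
  [IsContMDiffRiemannianBundle 𝓘(ℝ, E) ∞ E (fun x : M ↦ TangentSpace 𝓘(ℝ, E) x)]
  {F : ℝ → ℝ → M} {J S : Set ℝ} {t s p : ℝ}

theorem IsSmoothField.continuousOn_inner_right {V W : Π t s : ℝ, TangentSpace 𝓘(ℝ, E) (F t s)}
    (hV : IsSmoothField F J S V) (hW : IsSmoothField F J S W) (hF : IsSmoothFamily E F J S)
    (ht : t ∈ J) : ContinuousOn (fun s ↦ inner ℝ (V t s) (W t s)) S :=
  (hV.continuousOn_inner hW hF).comp (f := fun s ↦ (t, s)) (by fun_prop) (mapsTo_mk_right ht)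

theorem IsSmoothField.continuousOn_norm_right {V : Π t s : ℝ, TangentSpace 𝓘(ℝ, E) (F t s)}
    (hV : IsSmoothField F J S V) (hF : IsSmoothFamily E F J S) (ht : t ∈ J) :
    ContinuousOn (fun s ↦ ‖V t s‖) S :=
  (hV.continuousOn_norm hF).comp (f := fun s ↦ (t, s)) (by fun_prop) (mapsTo_mk_right ht)

/-- Continuity of `⟨(∇_H R)(U, V)W, Z⟩`, which the product rule in the direction of `t` expresses in
terms of curvatures of smooth fields. -/
theorem IsSmoothFamily.continuousOn_inner_nablaCurvature (hF : IsSmoothFamily E F J S)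
    (ht : t ∈ J) {U V W Z : Π t s : ℝ, TangentSpace 𝓘(ℝ, E) (F t s)}
    (hU : IsSmoothField F J S U) (hV : IsSmoothField F J S V) (hW : IsSmoothField F J S W)
    (hZ : IsSmoothField F J S Z) :
    ContinuousOn (fun s ↦ inner ℝ (nablaCurvature (F t s) (velocityLeft F J t s)
      (U t s) (V t s) (W t s)) (Z t s)) S := by
  have h1 := ((hU.curvature hV hW hF).covDerivLeft hF).continuousOn_inner_right hZ hF ht
  have h2 := ((hU.covDerivLeft hF).curvature hV hW hF).continuousOn_inner_right hZ hF ht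
  have h3 := (hU.curvature (hV.covDerivLeft hF) hW hF).continuousOn_inner_right hZ hF ht
  have h4 := (hU.curvature hV (hW.covDerivLeft hF) hF).continuousOn_inner_right hZ hF ht
  refine (((h1.sub h4).sub h3).sub h2).congr fun s hs ↦ ?_
  have h5 := (covDeriv_curvature (hF.left t ht) (hU.isDiffField_left hF ht hs)
    (hV.isDiffField_left hF ht hs) (hW.isDiffField_left hF ht hs)).2
  have h6 := congrArg (fun v ↦ inner ℝ v (Z t s)) h5
  simp only [inner_add_left] at h6
  refine eq_sub_of_add_eq (eq_sub_of_add_eq (eq_sub_of_add_eq ?_))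
  exact h6.symm

theorem IsSmoothFamily.continuousOn_secondVariationIntegrand (hF : IsSmoothFamily E F J S)
    (ht : t ∈ J) (hc : IsCritical (E := E) p (F t) S)
    (hp : 2 ≤ p ∨ ∀ s ∈ S, tension (E := E) (F t) S s ≠ 0) (i : Fin 10) :
    ContinuousOn (secondVariationIntegrand (E := E) p (F t) S (velocityLeft F J t) i) S := by
  have hH := hF.isSmoothField_velocityLeft
  have hT := hF.isSmoothField_velocityRight
  have hτ := hF.isSmoothField_tensionField
  have hDH := hH.covDerivRight hF
  have hDDH := hDH.covDerivRight hF
  have hR := hH.curvature hT hT hF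
  have hR' := hT.curvature hτ hT hF
  have hn := hτ.continuousOn_norm_right hF ht
  have hn2 : ContinuousOn (fun s ↦ ‖tension (E := E) (F t) S s‖ ^ (p - 2)) S :=
    hn.rpow_const fun s hs ↦
      hp.symm.imp (fun h ↦ norm_ne_zero_iff.2 (h s hs)) (fun h ↦ by linarith)
  -- the products with `|τ|^{p-4}`
  have hn4 : ∀ {α β : ℝ → ℝ} {A B : ℝ → ℝ}, ContinuousOn α S → ContinuousOn β S →
      ContinuousOn A S → ContinuousOn B S →
      (∀ s ∈ S, |α s| ≤ A s * ‖tensionField E F S t s‖) →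
      (∀ s ∈ S, |β s| ≤ B s * ‖tensionField E F S t s‖) →
      ContinuousOn (fun s ↦ (p - 2) * (‖tensionField E F S t s‖ ^ (p - 4) * (α s * β s))) S := by
    intro α β A B hα hβ hA hB hαA hβB s hs
    exact continuousWithinAt_rpow_sub_four hs (hn s hs) (hα s hs) (hβ s hs) (hA s hs) (hB s hs)
      (fun _ ↦ norm_nonneg _) hαA hβB (hp.imp_right fun h ↦ norm_ne_zero_iff.2 (h s hs))
  have hα := hDDH.continuousOn_inner_right hτ hF ht
  have hβ := hR.continuousOn_inner_right hτ hF ht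
  have hA := hDDH.continuousOn_norm_right hF ht
  have hB := hR.continuousOn_norm_right hF ht
  fin_cases i
  -- `∇_s(|τ|^{p-2} τ)` is known to be differentiable only along the critical curve
  · intro s hs
    have h1 := (hasDerivWithinAt_inner ((hH.curvature hT hH hF).isDiffField_right hF ht hs)
      (hc.isDiffField_covDeriv s hs)).continuousWithinAt
    refine h1.neg.congr (fun r _ ↦ ?_) ?_
    · exact (real_inner_comm _ _).trans (inner_curvature_swap _ _ _ _)
    · exact (real_inner_comm _ _).trans (inner_curvature_swap _ _ _ _)
  · exact continuousOn_const.mul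
      (hn2.mul ((hDH.curvature hτ hT hF).continuousOn_inner_right hH hF ht))
  · refine (hn4 hα hα hA hA (fun s _ ↦ abs_real_inner_le_norm _ _)
      (fun s _ ↦ abs_real_inner_le_norm _ _)).congr fun s _ ↦ ?_
    change (p - 2) * (_ * |_| ^ 2) = _
    rw [sq_abs, pow_two]
    rfl
  · refine ((continuousOn_const (c := (2 : ℝ))).mul (hn4 hα hβ hA hB (fun s _ ↦ abs_real_inner_le_norm _ _)
      (fun s _ ↦ abs_real_inner_le_norm _ _))).congr fun s _ ↦ ?_
    change 2 * (p - 2) * (_ * _ * _) = 2 * ((p - 2) * (_ * (_ * _)))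
    rw [mul_assoc, mul_assoc (_ ^ _)]
    rfl
  · exact hn2.mul (hA.pow 2)
  · exact continuousOn_const.mul (hn2.mul (hR.continuousOn_inner_right hDDH hF ht))
  · refine (hn4 hβ hβ hB hB (fun s _ ↦ abs_real_inner_le_norm _ _)
      (fun s _ ↦ abs_real_inner_le_norm _ _)).congr fun s _ ↦ ?_
    change (p - 2) * (_ * |inner ℝ (curvature (F t s) (velocityRight F S t s)
      (tensionField E F S t s) (velocityRight F S t s)) (velocityLeft F J t s)| ^ 2) = _
    rw [inner_curvature_pair, curvature_swap, inner_neg_left, abs_neg, sq_abs, pow_two]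
    rfl
  · exact (hn2.mul (hF.continuousOn_inner_nablaCurvature ht hT hτ hT hH)).neg
  · exact hn2.mul (((hT.curvature hH hT hF).continuousOn_norm_right hF ht).pow 2)
  · exact (hn2.mul ((hT.curvature hτ hDH hF).continuousOn_inner_right hH hF ht)).neg

end Continuity

/-! ### Jiang's formula -/

section Jiang

variable {E : Type*} [NormedAddCommGroup E] [NormedSpace ℝ E] [FiniteDimensional ℝ E]
  {M : Type*} [TopologicalSpace M] [ChartedSpace E M] [IsManifold 𝓘(ℝ, E) ∞ M]
  [RiemannianBundle (fun x : M ↦ TangentSpace 𝓘(ℝ, E) x)]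
  [IsContMDiffRiemannianBundle 𝓘(ℝ, E) ∞ E (fun x : M ↦ TangentSpace 𝓘(ℝ, E) x)]
  {F : ℝ → ℝ → M} {J S : Set ℝ} {t s : ℝ}

/-- The comparison of the two second variation formulas for `p = 2`, by the first and the second
Bianchi identity. Here `DH`, `DDH`, `Dτ` stand for the covariant derivatives of `H` and `τ`. -/
theorem jiang_pointwise {x : M} (T τ H DH DDH Dτ : TangentSpace 𝓘(ℝ, E) x) :
    ‖DDH + curvature x H T T‖ ^ 2 - inner ℝ H (nablaCurvature x T T τ H + nablaCurvature x τ T H T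
        + curvature x τ H τ + (2 : ℝ) • curvature x T H Dτ + (2 : ℝ) • curvature x T τ DH) =
    (inner ℝ H (curvature x H T Dτ) + -2 * inner ℝ (curvature x DH τ T) H
      + ‖DDH‖ ^ 2 + 2 * inner ℝ (curvature x H T T) DDH + -inner ℝ (nablaCurvature x H T τ T) H
      + ‖curvature x T H T‖ ^ 2 + -inner ℝ (curvature x T τ DH) H)
    - (inner ℝ (nablaCurvature x T τ H T + curvature x Dτ H T + curvature x τ DH T
        + curvature x τ H τ) H + inner ℝ (curvature x τ H T) DH) := by
  have h0 : inner ℝ (nablaCurvature x T T τ H) H = 0 := by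
    have := inner_nablaCurvature_swap T T τ H H
    linarith
  have h1 := congrArg (fun v ↦ inner ℝ v H) (nablaCurvature_bianchi T τ H T)
  have h2 := inner_nablaCurvature_swap_left τ H T T H
  have h3 : inner ℝ (curvature x H T Dτ) H = - inner ℝ (curvature x T H Dτ) H := by
    rw [curvature_swap, inner_neg_left]
  have h4 := inner_curvature_pair Dτ H T H
  have h5 := congrArg (fun v ↦ inner ℝ v H) (curvature_bianchi DH τ T)
  have h6 := inner_curvature_pair τ H T DH
  have h7 : inner ℝ (curvature x τ DH T) H = - inner ℝ (curvature x DH τ T) H := by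
    rw [curvature_swap, inner_neg_left]
  have h8 : inner ℝ (curvature x τ T DH) H = - inner ℝ (curvature x T τ DH) H := by
    rw [curvature_swap, inner_neg_left]
  simp only [inner_add_left, inner_zero_left] at h1 h5
  rw [norm_add_sq_real, curvature_swap T H T, norm_neg, real_inner_comm _ H, real_inner_comm _ H,
    real_inner_comm (curvature x H T T) DDH]
  simp only [inner_add_left, real_inner_smul_left]
  linarith

variable (E) in
/-- The function by whose derivative the integrands of the two formulas differ for `p = 2`. -/
def jiangTerm (F : ℝ → ℝ → M) (J S : Set ℝ) (t s : ℝ) : ℝ :=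
  inner ℝ (curvature (E := E) (F t s) (tensionField E F S t s) (velocityLeft F J t s)
    (velocityRight F S t s)) (velocityLeft F J t s)

variable (E) in
/-- The derivative of `jiangTerm` in `s`. -/
def jiangTermDeriv (F : ℝ → ℝ → M) (J S : Set ℝ) (t s : ℝ) : ℝ :=
  inner ℝ (covDerivRight F S (fun t s ↦ curvature (E := E) (F t s) (tensionField E F S t s)
      (velocityLeft F J t s) (velocityRight F S t s)) t s) (velocityLeft F J t s)
    + inner ℝ (curvature (E := E) (F t s) (tensionField E F S t s) (velocityLeft F J t s)
      (velocityRight F S t s)) (covDerivRight F S (velocityLeft F J) t s)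

theorem IsSmoothFamily.hasDerivWithinAt_jiangTerm (hF : IsSmoothFamily E F J S) (ht : t ∈ J)
    (hs : s ∈ S) :
    HasDerivWithinAt (jiangTerm E F J S t) (jiangTermDeriv E F J S t s) S s :=
  hasDerivWithinAt_inner ((hF.isSmoothField_tensionField.curvature hF.isSmoothField_velocityLeft
    hF.isSmoothField_velocityRight hF).isDiffField_right hF ht hs)
    (hF.isSmoothField_velocityLeft.isDiffField_right hF ht hs)

theorem IsSmoothFamily.continuousOn_jiangTermDeriv (hF : IsSmoothFamily E F J S) (ht : t ∈ J) :
    ContinuousOn (jiangTermDeriv E F J S t) S := by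
  have hH := hF.isSmoothField_velocityLeft
  have hR := hF.isSmoothField_tensionField.curvature hH hF.isSmoothField_velocityRight hF
  exact ((hR.covDerivRight hF).continuousOn_inner_right hH hF ht).add
    (hR.continuousOn_inner_right (hH.covDerivRight hF) hF ht)

theorem powTension_two (γ : ℝ → M) (S : Set ℝ) :
    powTension (E := E) 2 γ S = tension γ S := by
  funext s
  simp [powTension]

theorem IsSmoothFamily.jiangIntegrand_eq (hF : IsSmoothFamily E F J S) (ht : t ∈ J)
    (hs : s ∈ S) :
    jiangIntegrand (E := E) (F t) S (velocityLeft F J t) s =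
      ∑ i, secondVariationIntegrand (E := E) 2 (F t) S (velocityLeft F J t) i s
        - jiangTermDeriv E F J S t s := by
  have h1 := (covDeriv_curvature (hF.right s hs)
    (hF.isSmoothField_tensionField.isDiffField_right hF ht hs)
    (hF.isSmoothField_velocityLeft.isDiffField_right hF ht hs)
    (hF.isSmoothField_velocityRight.isDiffField_right hF ht hs)).2
  have h2 := jiang_pointwise (velocityRight F S t s) (tensionField E F S t s)
    (velocityLeft F J t s) (covDerivRight F S (velocityLeft F J) t s)
    (covDerivRight F S (covDerivRight F S (velocityLeft F J)) t s)
    (covDerivRight F S (tensionField E F S) t s)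
  refine h2.trans (congrArg₂ (· - ·) ?_ (congrArg (fun v ↦ inner ℝ v _ + _) h1.symm))
  simp only [Fin.sum_univ_succ, Fin.sum_univ_zero, add_zero, ← add_assoc]
  have h3 : covDeriv (F t) S (powTension (E := E) 2 (F t) S) s =
      covDerivRight F S (tensionField E F S) t s := by rw [powTension_two]; rfl
  change _ = inner ℝ _ (curvature (E := E) _ _ _ (covDeriv (F t) S (powTension (E := E) 2 (F t) S) s))
    + -2 * (‖tension (E := E) (F t) S s‖ ^ ((2 : ℝ) - 2) * _) + (2 - 2) * _ + 2 * (2 - 2) * _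
    + ‖tension (E := E) (F t) S s‖ ^ ((2 : ℝ) - 2) * _
    + 2 * (‖tension (E := E) (F t) S s‖ ^ ((2 : ℝ) - 2) * _) + (2 - 2) * _
    + -(‖tension (E := E) (F t) S s‖ ^ ((2 : ℝ) - 2) * _)
    + ‖tension (E := E) (F t) S s‖ ^ ((2 : ℝ) - 2) * _
    + -(‖tension (E := E) (F t) S s‖ ^ ((2 : ℝ) - 2) * _)
  simp only [h3, sub_self, Real.rpow_zero, one_mul, mul_zero, zero_mul, add_zero]
  rfl

end Jiang

/-! ### The boundary terms -/

section EndPoints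

variable {E : Type*} [NormedAddCommGroup E] [NormedSpace ℝ E] [FiniteDimensional ℝ E]
  {M : Type*} [TopologicalSpace M] [ChartedSpace E M] [IsManifold 𝓘(ℝ, E) ∞ M]
  [RiemannianBundle (fun x : M ↦ TangentSpace 𝓘(ℝ, E) x)]
  [IsContMDiffRiemannianBundle 𝓘(ℝ, E) ∞ E (fun x : M ↦ TangentSpace 𝓘(ℝ, E) x)]
  {F : ℝ → ℝ → M} {ε a b t s p : ℝ}

theorem prod_subset_closure_interior {J S : Set ℝ} (hJ : J ⊆ closure (interior J))
    (hS : S ⊆ closure (interior S)) : J ×ˢ S ⊆ closure (interior (J ×ˢ S)) := by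
  rw [interior_prod_eq, closure_prod_eq]
  exact prod_mono hJ hS

theorem IsClampedVariation.isSmoothFamily (hab : a < b) (hF : IsClampedVariation E F ε a b) :
    IsSmoothFamily E F (Ioo (-ε) ε) (Icc a b) := by
  refine ⟨hF.1, uniqueDiffOn_Ioo _ _, uniqueDiffOn_Icc hab, prod_subset_closure_interior ?_ ?_⟩
  · rw [interior_Ioo]; exact subset_closure
  · rw [interior_Icc, closure_Ioo hab.ne]

theorem IsClosedVariation.isSmoothFamily_univ (hF : IsClosedVariation E F ε a b) :
    IsSmoothFamily E F (Ioo (-ε) ε) univ := by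
  refine ⟨hF.1, uniqueDiffOn_Ioo _ _, uniqueDiffOn_univ, prod_subset_closure_interior ?_ ?_⟩
  · rw [interior_Ioo]; exact subset_closure
  · rw [interior_univ]; exact subset_closure

theorem IsClosedVariation.isSmoothFamily (hab : a < b) (hF : IsClosedVariation E F ε a b) :
    IsSmoothFamily E F (Ioo (-ε) ε) (Icc a b) := by
  refine hF.isSmoothFamily_univ.mono (subset_univ _) (uniqueDiffOn_Icc hab)
    (prod_subset_closure_interior ?_ ?_)
  · rw [interior_Ioo]; exact subset_closure
  · rw [interior_Icc, closure_Ioo hab.ne]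

theorem boundaryTerm_eq_zero {J S : Set ℝ} {q : TangentBundle 𝓘(ℝ, E) M}
    (hF : IsSmoothFamily E F J S) (hs : s ∈ S)
    (h : ∀ t ∈ J, lift (F t) (velocity (E := E) (F t) S) s = q) (ht : t ∈ J) :
    boundaryTerm E p F J S t s = 0 := by
  rw [boundaryTerm, hF.covDerivRight_accelerationLeft_eq_zero hs h ht,
    accelerationLeft_eq_zero h ht, velocityLeft_eq_zero h ht, curvature_zero_left]
  simp

theorem jiangTerm_eq_zero {J S : Set ℝ} {q : TangentBundle 𝓘(ℝ, E) M}
    (h : ∀ t ∈ J, lift (F t) (velocity (E := E) (F t) S) s = q) (ht : t ∈ J) :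
    jiangTerm E F J S t s = 0 := by
  rw [jiangTerm, velocityLeft_eq_zero h ht, inner_zero_right]

/-- Equality of the boundary terms at two points of `M`, from equality of vectors in the tangent
bundle. -/
theorem boundary_congr {x y : M} {A Z W DW T H : TangentSpace 𝓘(ℝ, E) x}
    {A' Z' W' DW' T' H' : TangentSpace 𝓘(ℝ, E) y}
    (hA : (⟨x, A⟩ : TangentBundle 𝓘(ℝ, E) M) = ⟨y, A'⟩)
    (hZ : (⟨x, Z⟩ : TangentBundle 𝓘(ℝ, E) M) = ⟨y, Z'⟩)
    (hW : (⟨x, W⟩ : TangentBundle 𝓘(ℝ, E) M) = ⟨y, W'⟩)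
    (hDW : (⟨x, DW⟩ : TangentBundle 𝓘(ℝ, E) M) = ⟨y, DW'⟩)
    (hT : (⟨x, T⟩ : TangentBundle 𝓘(ℝ, E) M) = ⟨y, T'⟩)
    (hH : (⟨x, H⟩ : TangentBundle 𝓘(ℝ, E) M) = ⟨y, H'⟩) :
    (inner ℝ Z W - inner ℝ A DW + inner ℝ (curvature x H T H) W : ℝ) =
      inner ℝ Z' W' - inner ℝ A' DW' + inner ℝ (curvature y H' T' H') W' := by
  cases hA; cases hZ; cases hW; cases hDW; cases hT; cases hH
  rfl

theorem jiang_congr {x y : M} {τ T H : TangentSpace 𝓘(ℝ, E) x}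
    {τ' T' H' : TangentSpace 𝓘(ℝ, E) y}
    (hτ : (⟨x, τ⟩ : TangentBundle 𝓘(ℝ, E) M) = ⟨y, τ'⟩)
    (hT : (⟨x, T⟩ : TangentBundle 𝓘(ℝ, E) M) = ⟨y, T'⟩)
    (hH : (⟨x, H⟩ : TangentBundle 𝓘(ℝ, E) M) = ⟨y, H'⟩) :
    (inner ℝ (curvature x τ H T) H : ℝ) = inner ℝ (curvature y τ' H' T') H' := by
  cases hτ; cases hT; cases hH
  rfl

theorem lift_rpow_smul_congr {x y : M} {τ : TangentSpace 𝓘(ℝ, E) x} {τ' : TangentSpace 𝓘(ℝ, E) y}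
    (hτ : (⟨x, τ⟩ : TangentBundle 𝓘(ℝ, E) M) = ⟨y, τ'⟩) (r : ℝ) :
    (⟨x, ‖τ‖ ^ r • τ⟩ : TangentBundle 𝓘(ℝ, E) M) = ⟨y, ‖τ'‖ ^ r • τ'⟩ := by
  cases hτ
  rfl

section Restriction

variable {J S S' : Set ℝ}

theorem IsSmoothFamily.velocityRight_subset (hF : IsSmoothFamily E F J S) (h : S' ⊆ S)
    (hS' : UniqueDiffOn ℝ S') (ht : t ∈ J) (hs : s ∈ S') :
    velocityRight (E := E) F S' t s = velocityRight F S t s :=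
  velocity_subset h (hS' s hs) (hF.mdifferentiableWithinAt_right ht (h hs))

theorem IsSmoothFamily.covDeriv_powTension_subset (hF : IsSmoothFamily E F J S) (h : S' ⊆ S)
    (hS' : UniqueDiffOn ℝ S') (ht : t ∈ J) (hs : s ∈ S')
    (hp : 2 ≤ p ∨ tension (E := E) (F t) S' s ≠ 0) :
    covDeriv (F t) S' (powTension (E := E) p (F t) S') s =
      covDeriv (F t) S (powTension p (F t) S) s := by
  have h1 : ∀ r ∈ S', powTension (E := E) p (F t) S' r = powTension p (F t) S r := fun r hr ↦ by
    rw [powTension, powTension, hF.tension_subset h hS' ht hr]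
  refine (covDeriv_congr (eventually_mem_nhdsWithin.mono h1) (h1 s hs)).trans ?_
  rw [hF.tension_subset h hS' ht hs] at hp
  exact (covDeriv_rpow_norm_smul (hF.right s (h hs))
    (hF.isSmoothField_tensionField.isDiffField_right hF ht (h hs)) hp).1.covDeriv_subset h
    (hS' s hs)

theorem IsSmoothFamily.boundaryTerm_subset (hF : IsSmoothFamily E F J S) (h : S' ⊆ S)
    (hS' : UniqueDiffOn ℝ S') (ht : t ∈ J) (hs : s ∈ S')
    (hp : 2 ≤ p ∨ tension (E := E) (F t) S' s ≠ 0) :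
    boundaryTerm E p F J S' t s = boundaryTerm E p F J S t s := by
  have h1 : covDerivRight F S' (accelerationLeft E F J) t s =
      covDerivRight F S (accelerationLeft E F J) t s :=
    (hF.isSmoothField_accelerationLeft.isDiffField_right hF ht (h hs)).covDeriv_subset h (hS' s hs)
  rw [boundaryTerm, boundaryTerm, h1, hF.covDeriv_powTension_subset h hS' ht hs hp,
    hF.velocityRight_subset h hS' ht hs, powTension, powTension,
    hF.tension_subset h hS' ht hs]

theorem IsSmoothFamily.jiangTerm_subset (hF : IsSmoothFamily E F J S) (h : S' ⊆ S)
    (hS' : UniqueDiffOn ℝ S') (ht : t ∈ J) (hs : s ∈ S') :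
    jiangTerm E F J S' t s = jiangTerm E F J S t s := by
  rw [jiangTerm, jiangTerm, hF.velocityRight_subset h hS' ht hs, tensionField, tensionField,
    hF.tension_subset h hS' ht hs]

end Restriction

-- For closed curves, the family over `[a, b]` is compared with the one over the whole line, whose
-- fields are periodic.

section Closed

theorem IsSmoothFamily.mdifferentiable_right {J : Set ℝ} (hF : IsSmoothFamily E F J univ)
    (ht : t ∈ J) : MDifferentiable 𝓘(ℝ, ℝ) 𝓘(ℝ, E) (F t) := fun s ↦
  mdifferentiableWithinAt_univ.1 (hF.mdifferentiableWithinAt_right ht (mem_univ s))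

variable {J : Set ℝ} {L : ℝ} (hF : IsSmoothFamily E F J univ)
  (hL : ∀ t ∈ J, ∀ s, F t (s + L) = F t s)

include hF hL

theorem lift_velocityRight_add (ht : t ∈ J) (s : ℝ) :
    lift (F t) (velocityRight (E := E) F univ t) (s + L) = lift (F t) (velocityRight F univ t) s :=
  lift_velocity_add (hF.mdifferentiable_right ht) (hL t ht) s

theorem lift_tensionField_add (ht : t ∈ J) (s : ℝ) :
    lift (F t) (tensionField E F univ t) (s + L) = lift (F t) (tensionField E F univ t) s :=
  lift_covDeriv_add (hF.mdifferentiable_right ht) (lift_velocityRight_add hF hL ht) s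

theorem lift_velocityLeft_add (ht : t ∈ J) (s : ℝ) :
    lift (F t) (velocityLeft (E := E) F J t) (s + L) = lift (F t) (velocityLeft F J t) s :=
  lift_velocity_congr (γ₁ := fun t ↦ F t (s + L)) (γ₂ := fun t ↦ F t s)
    (eventually_mem_nhdsWithin.mono fun r hr ↦ hL r hr s) (hL t ht s)

theorem lift_accelerationLeft_add (ht : t ∈ J) (s : ℝ) :
    lift (F t) (accelerationLeft E F J t) (s + L) = lift (F t) (accelerationLeft E F J t) s :=
  lift_covDeriv_congr (γ₁ := fun t ↦ F t (s + L)) (γ₂ := fun t ↦ F t s)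
    (V₁ := fun t ↦ velocityLeft F J t (s + L)) (V₂ := fun t ↦ velocityLeft F J t s)
    (eventually_mem_nhdsWithin.mono fun _ hr ↦ lift_velocityLeft_add hF hL hr s)
    (lift_velocityLeft_add hF hL ht s)

theorem boundaryTerm_add (ht : t ∈ J) (s : ℝ) :
    boundaryTerm E p F J univ t (s + L) = boundaryTerm E p F J univ t s := by
  have hγ := hF.mdifferentiable_right ht
  have hW : ∀ s, lift (F t) (powTension (E := E) p (F t) univ) (s + L) =
      lift (F t) (powTension p (F t) univ) s := fun s ↦
    lift_rpow_smul_congr (lift_tensionField_add hF hL ht s) (p - 2)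
  exact boundary_congr (lift_accelerationLeft_add hF hL ht s)
    (lift_covDeriv_add hγ (lift_accelerationLeft_add hF hL ht) s) (hW s)
    (lift_covDeriv_add hγ hW s) (lift_velocityRight_add hF hL ht s)
    (lift_velocityLeft_add hF hL ht s)

theorem jiangTerm_add (ht : t ∈ J) (s : ℝ) :
    jiangTerm E F J univ t (s + L) = jiangTerm E F J univ t s :=
  jiang_congr (lift_tensionField_add hF hL ht s) (lift_velocityRight_add hF hL ht s)
    (lift_velocityLeft_add hF hL ht s)

end Closed

/-- The boundary terms of the integrations by parts cancel. -/
theorem boundaryTerm_eq (hab : a < b) (hε : 0 < ε)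
    (hF : IsClampedVariation E F ε a b ∨ IsClosedVariation E F ε a b)
    (hp : 2 ≤ p ∨ ∀ s ∈ Icc a b, tension (E := E) (F 0) (Icc a b) s ≠ 0) :
    boundaryTerm E p F (Ioo (-ε) ε) (Icc a b) 0 b = boundaryTerm E p F (Ioo (-ε) ε) (Icc a b) 0 a ∧
    jiangTerm E F (Ioo (-ε) ε) (Icc a b) 0 b = jiangTerm E F (Ioo (-ε) ε) (Icc a b) 0 a := by
  have h0 : (0 : ℝ) ∈ Ioo (-ε) ε := ⟨by linarith, hε⟩
  have ha := left_mem_Icc.2 hab.le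
  have hb := right_mem_Icc.2 hab.le
  rcases hF with hF | hF
  · have h1 := hF.isSmoothFamily hab
    have h2 := fun t ht ↦ (hF.2 t ht).1
    have h3 := fun t ht ↦ (hF.2 t ht).2
    rw [boundaryTerm_eq_zero h1 ha h2 h0, boundaryTerm_eq_zero h1 hb h3 h0,
      jiangTerm_eq_zero h2 h0, jiangTerm_eq_zero h3 h0]
    exact ⟨rfl, rfl⟩
  · have h1 := hF.isSmoothFamily_univ
    have hS := uniqueDiffOn_Icc hab
    have h2 := boundaryTerm_add (p := p) h1 hF.2 h0 a
    have h3 := jiangTerm_add h1 hF.2 h0 a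
    rw [add_sub_cancel] at h2 h3
    rw [h1.boundaryTerm_subset (subset_univ _) hS h0 ha (hp.imp_right fun h ↦ h a ha),
      h1.boundaryTerm_subset (subset_univ _) hS h0 hb (hp.imp_right fun h ↦ h b hb),
      h1.jiangTerm_subset (subset_univ _) hS h0 ha, h1.jiangTerm_subset (subset_univ _) hS h0 hb]
    exact ⟨h2, h3⟩

theorem variationField_eq (hε : 0 < ε) :
    variationField (E := E) F = velocityLeft F (Ioo (-ε) ε) 0 := by
  funext s
  rw [variationField, velocityLeft, velocity,
    mfderivWithin_of_mem_nhds (Ioo_mem_nhds (by linarith) hε)]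

theorem integral_eq_zero_of_hasDerivWithinAt {g g' : ℝ → ℝ} (hab : a ≤ b)
    (hg : ∀ s ∈ Icc a b, HasDerivWithinAt g (g' s) (Icc a b) s) (hg' : ContinuousOn g' (Icc a b))
    (h : g b = g a) : ∫ s in a..b, g' s = 0 := by
  rw [intervalIntegral.integral_eq_sub_of_hasDerivAt_of_le hab
    (fun s hs ↦ (hg s hs).continuousWithinAt)
    (fun s hs ↦ (hg s (Ioo_subset_Icc_self hs)).hasDerivAt (Icc_mem_nhds hs.1 hs.2))
    (hg'.intervalIntegrable_of_Icc hab), h, sub_self]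

theorem IsPBiharmonic.isCritical {γ : ℝ → M} (h : IsPBiharmonic E p γ a b) :
    IsCritical (E := E) p γ (Icc a b) :=
  ⟨h.differentiable, h.differentiable_covDeriv, fun s hs ↦ sub_eq_zero.1 (h.equation s hs)⟩

end EndPoints

end PBiharmonic

end

theorem mainTheorem6
    {E : Type*} [NormedAddCommGroup E] [NormedSpace ℝ E] [FiniteDimensional ℝ E]
    {M : Type*} [TopologicalSpace M] [T2Space M] [ChartedSpace E M] [IsManifold 𝓘(ℝ, E) ∞ M]
    [RiemannianBundle (fun x : M ↦ TangentSpace 𝓘(ℝ, E) x)]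
    [IsContMDiffRiemannianBundle 𝓘(ℝ, E) ∞ E (fun x : M ↦ TangentSpace 𝓘(ℝ, E) x)]
    (p : ℝ) (hp : 0 < p) (a b ε : ℝ) (hab : a < b) (hε : 0 < ε)
    (F : ℝ → ℝ → M)
    (hF : PBiharmonic.IsClampedVariation E F ε a b ∨ PBiharmonic.IsClosedVariation E F ε a b)
    (hcrit : PBiharmonic.IsPBiharmonic E p (F 0) a b)
    (hreg : 2 ≤ p ∨ ∀ s ∈ Icc a b, PBiharmonic.tension (E := E) (F 0) (Icc a b) s ≠ 0) :
    (∀ t ∈ Ioo (-ε) ε, IntervalIntegrable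
      (fun s ↦ ‖PBiharmonic.tension (E := E) (F t) (Icc a b) s‖ ^ p) volume a b) ∧
    (∀ i, IntervalIntegrable
      (PBiharmonic.secondVariationIntegrand (E := E) p (F 0) (Icc a b)
        (PBiharmonic.variationField F) i) volume a b) ∧
    (∀ᶠ t in 𝓝 (0 : ℝ), DifferentiableAt ℝ (fun t ↦ PBiharmonic.energy E p (F t) a b) t) ∧
    HasDerivAt (deriv fun t ↦ PBiharmonic.energy E p (F t) a b)
      (PBiharmonic.secondVariation (E := E) p (F 0) (PBiharmonic.variationField F) a b) 0 ∧
    (p = 2 →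
      IntervalIntegrable (PBiharmonic.jiangIntegrand (E := E) (F 0) (Icc a b)
        (PBiharmonic.variationField F)) volume a b ∧
      PBiharmonic.secondVariation (E := E) p (F 0) (PBiharmonic.variationField F) a b =
        ∫ s in a..b, PBiharmonic.jiangIntegrand (E := E) (F 0) (Icc a b)
          (PBiharmonic.variationField F) s) := by
  open PBiharmonic in
  have hfam : IsSmoothFamily E F (Ioo (-ε) ε) (Icc a b) :=
    hF.elim (fun h ↦ h.isSmoothFamily hab) (fun h ↦ h.isSmoothFamily hab)
  have h0 : (0 : ℝ) ∈ Ioo (-ε) ε := ⟨by linarith, hε⟩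
  have hτ := hfam.isSmoothField_tensionField
  have hc := hcrit.isCritical
  obtain ⟨hbd, hbd'⟩ := boundaryTerm_eq hab hε hF hreg
  have hcont := hfam.continuousOn_secondVariationIntegrand h0 hc hreg
  have hint : ∀ i, IntervalIntegrable (secondVariationIntegrand (E := E) p (F 0) (Icc a b)
      (velocityLeft F (Ioo (-ε) ε) 0) i) volume a b :=
    fun i ↦ (hcont i).intervalIntegrable_of_Icc hab.le
  have hsum : secondVariation (E := E) p (F 0) (velocityLeft F (Ioo (-ε) ε) 0) a b =
      ∫ s in a..b, ∑ i, secondVariationIntegrand (E := E) p (F 0) (Icc a b)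
        (velocityLeft F (Ioo (-ε) ε) 0) i s :=
    (intervalIntegral.integral_finsetSum fun i _ ↦ hint i).symm
  have hcontsum : ContinuousOn (fun s ↦ ∑ i, secondVariationIntegrand (E := E) p (F 0) (Icc a b)
      (velocityLeft F (Ioo (-ε) ε) 0) i s) (Icc a b) := continuousOn_finsetSum _ fun i _ ↦ hcont i
  rw [variationField_eq hε]
  -- a rectangle around `{0} × [a, b]` on which `τ` has no zeros, if `p < 2`
  obtain ⟨δ, hδ, hδε, hreg'⟩ : ∃ δ, 0 < δ ∧ δ < ε ∧
      (2 ≤ p ∨ ∀ q ∈ Icc (-δ) δ ×ˢ Icc a b, tensionField E F (Icc a b) q.1 q.2 ≠ 0) := by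
    rcases hreg with h | h
    · exact ⟨ε / 2, by linarith, by linarith, Or.inl h⟩
    · obtain ⟨δ, h1, h2, h3⟩ := exists_rectangle_ne_zero hε hab.le (hτ.continuousOn_norm hfam)
        fun s hs ↦ norm_ne_zero_iff.2 (h s hs)
      exact ⟨δ, h1, h2, Or.inr fun q hq ↦ norm_ne_zero_iff.1 (h3 q hq)⟩
  have hK : Icc (-δ) δ ×ˢ Icc a b ⊆ Ioo (-ε) ε ×ˢ Icc a b :=
    prod_mono_left (Icc_subset_Ioo (by linarith) hδε)
  have hδ0 : (0 : ℝ) ∈ Ioo (-δ) δ := ⟨by linarith, hδ⟩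
  have hreg'' : ∀ t ∈ Ioo (-δ) δ, ∀ s ∈ Icc a b, 2 ≤ p ∨ tensionField E F (Icc a b) t s ≠ 0 :=
    fun t ht s hs ↦ hreg'.imp_right fun h ↦ h (t, s) ⟨Ioo_subset_Icc_self ht, hs⟩
  have hmem : ∀ t ∈ Ioo (-δ) δ, t ∈ Ioo (-ε) ε := fun t ht ↦
    ⟨by linarith [ht.1], by linarith [ht.2]⟩
  have hc1 := hfam.continuousOn_energyDensityDeriv hK hreg'
  have hc2 := hfam.continuousOn_energyDensityDerivTwo hK hreg'
  have hc0 : ContinuousOn (fun q : ℝ × ℝ ↦ ‖tensionField E F (Icc a b) q.1 q.2‖ ^ p)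
      (Ioo (-ε) ε ×ˢ Icc a b) :=
    (hτ.continuousOn_norm hfam).rpow_const fun _ _ ↦ Or.inr hp.le
  have hd1 : ∀ t ∈ Ioo (-δ) δ, HasDerivAt (fun t ↦ energy E p (F t) a b)
      (∫ s in a..b, energyDensityDeriv (E := E) p F (Ioo (-ε) ε) (Icc a b) t s) t := by
    intro t ht
    have h1 := (hasDerivAt_intervalIntegral_of_continuousOn hab.le (hc0.mono hK)
      (hc1.const_smul p) (fun t ht s hs ↦
        (hfam.hasDerivWithinAt_rpow_tensionField (hmem t ht) hs (hreg'' t ht s hs)).hasDerivAt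
          (Ioo_mem_nhds (hmem t ht).1 (hmem t ht).2)) ht).const_mul (1 / p)
    refine h1.congr_deriv ?_
    rw [intervalIntegral.integral_const_mul, ← mul_assoc, one_div_mul_cancel hp.ne', one_mul]
  have hd2 := hasDerivAt_intervalIntegral_of_continuousOn hab.le hc1 hc2 (fun t ht s hs ↦
    (hfam.hasDerivWithinAt_energyDensityDeriv (hmem t ht) hs (hreg'' t ht s hs)).hasDerivAt
      (Ioo_mem_nhds (hmem t ht).1 (hmem t ht).2)) hδ0
  refine ⟨fun t ht ↦ ?_, hint, ?_, ?_, ?_⟩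
  · exact (hc0.comp (f := fun s ↦ (t, s)) (by fun_prop)
      fun s hs ↦ ⟨ht, hs⟩).intervalIntegrable_of_Icc hab.le
  · filter_upwards [Ioo_mem_nhds hδ0.1 hδ0.2] with t ht using (hd1 t ht).differentiableAt
  · refine (hd2.congr_of_eventuallyEq ?_).congr_deriv ?_
    · filter_upwards [Ioo_mem_nhds hδ0.1 hδ0.2] with t ht using (hd1 t ht).deriv
    · have hc3 : ContinuousOn (energyDensityDerivTwo E p F (Ioo (-ε) ε) (Icc a b) 0) (Icc a b) :=
        hc2.comp (f := fun s ↦ ((0 : ℝ), s)) (by fun_prop)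
          fun s hs ↦ ⟨Ioo_subset_Icc_self hδ0, hs⟩
      have h2 := integral_eq_zero_of_hasDerivWithinAt hab.le
        (fun s hs ↦ hfam.hasDerivWithinAt_boundaryTerm h0 hs hc) (hc3.sub hcontsum) hbd
      rw [intervalIntegral.integral_sub (hc3.intervalIntegrable_of_Icc hab.le)
        (hcontsum.intervalIntegrable_of_Icc hab.le), ← hsum] at h2
      exact sub_eq_zero.1 h2
  · rintro rfl
    have h1 := hfam.continuousOn_jiangTermDeriv h0
    have h2 := integral_eq_zero_of_hasDerivWithinAt hab.le
      (fun s hs ↦ hfam.hasDerivWithinAt_jiangTerm h0 hs) h1 hbd'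
    have h3 := hcontsum.sub h1
    have h4 := h3.congr fun s hs ↦ hfam.jiangIntegrand_eq h0 hs
    refine ⟨h4.intervalIntegrable_of_Icc hab.le, ?_⟩
    have h5 : ∫ s in a..b, jiangIntegrand (E := E) (F 0) (Icc a b)
        (velocityLeft F (Ioo (-ε) ε) 0) s = ∫ s in a..b,
        (∑ i, secondVariationIntegrand (E := E) 2 (F 0) (Icc a b)
          (velocityLeft F (Ioo (-ε) ε) 0) i s) - jiangTermDeriv E F (Ioo (-ε) ε) (Icc a b) 0 s :=
      intervalIntegral.integral_congr fun s hs ↦ by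
        rw [uIcc_of_le hab.le] at hs
        exact hfam.jiangIntegrand_eq h0 hs
    rw [h5, intervalIntegral.integral_sub (hcontsum.intervalIntegrable_of_Icc hab.le)
      (h1.intervalIntegrable_of_Icc hab.le), h2, sub_zero, hsum]
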